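/- **Setting.** Everything is $C^\infty$, and $M$ is a (Hausdorff) manifold of dimension $2m$. A *3-web* on $M$ is a triple $\{\mathcal F_1,\mathcal F_2,\mathcal F_3\}$ of $m$-dimensional foliations such that any two of them are transversal at each point. Let $\pi_h\colon TM\to T\mathcal F_2$ be the projection along $T\mathcal F_1$, let $\pi_v\colon TM\to T\mathcal F_1$ be the projection along $T\mathcal F_2$, and let $j\colon TM\to TM$ be the endomorphism that maps $X\in T\mathcal F_2$ to the vector $jX\in T\mathcal F_1$ with $jX-X\in T\mathcal F_3$ and $X\in T\mathcal F_1$ to the vector $jX\in T\mathcal F_2$ with $jX-X\in T\mathcal F_3$. The *Chern connection* of the web is $$\nabla^C_XY=\pi_h\bigl(j[\pi_hX,j\pi_hY]+[\pi_vX,\pi_hY]\bigr)+\pi_v\bigl(j[\pi_vX,j\pi_vY]+[\pi_hX,\pi_vY]\bigr).$$ A *Segre structure* $S$ on $M$ is a field of cones $S(x)\subset T_xM$, together with a family of $m$-dimensional subspaces of $T_xM$ called *$\alpha$-planes*, given near each point by a smoothly varying linear identification $T_xM\cong\mathbb R^m\otimes\mathbb R^2$: $S(x)$ corresponds to the nonzero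 decomposable tensors and the $\alpha$-planes to the subspaces $\mathbb R^m\otimes v$, $v\in\mathbb R^2\setminus\{0\}$. It is *$\alpha$-integrable* if every $\alpha$-plane is tangent to an $m$-dimensional submanifold all of whose tangent spaces are $\alpha$-planes. A *hyper-para-complex structure* is a triple $(I,K,J)$ of anti-commuting endomorphisms of $TM$ with $IK=-KI=J$, where $J$ is a complex structure ($J^2=-1$, vanishing Nijenhuis tensor) and $I,K$ are para-complex structures (square $1$, eigenspaces for $\pm1$ of equal dimension, vanishing Nijenhuis tensor). It is *compatible* with $S$ if $I,J,K$ preserve all the cones $S(x)$. It is *defined by* a 3-web if the eigenspaces of $I$ for $1$ and $-1$ are $T\mathcal F_1$ and $T\mathcal F_2$, and those of $K$ are $T\mathcal F_3$ and $\{X+jX : X\in T\mathcal F_1\}$. **Theorem 1.** 1. For every 3-web on $M$ there is a unique Segre structure $S$ on $M$ such that the tangent spaces of $\mathcal F_1,\mathcal F_2,\mathcal F_3$ are $\alpha$-planes of $S$. 2. If the torsion of the Chern connection of the web vanishes, then $S$ is $\alpha$-integrable, and the web defines a hyper-para-complex structure, which is compatible with $S$. 3. Conversely, let $(I,K,J)$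 be a hyper-para-complex structure compatible with a Segre structure $S$ on $M$. Then there is a 3-web on $M$ (hence also on a neighbourhood of each point) whose Chern connection is torsion-free, such that $(I,K,J)$ is the hyper-para-complex structure defined by this web and is compatible with the Segre structure that the web determines. The latter Segre structure equals $S$ if and only if $I$ and $K$ act at each point through the factor $\mathbb R^2$ only, i.e. have the form $1\otimes P$ for some identification $T_xM\cong\mathbb R^m\otimes\mathbb R^2$ adapted to $S$ (i.e. carrying $S(x)$ and its $\alpha$-planes to the standard ones). -/

import Mathlib

open scoped Manifold ContDiff

noncomputable section

/-- Manifolds of dimension `2m` are modelled on `ℝ^{2m}`. -/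
abbrev Model (m : ℕ) : Type := EuclideanSpace ℝ (Fin (2 * m))

section

variable (m : ℕ) {M : Type*} [TopologicalSpace M] [ChartedSpace (Model m) M]
  [IsManifold (𝓡 (2 * m)) ∞ M]

/-- The tangent space of a `2m`-dimensional manifold `M` at `x`. -/
abbrev Tan (x : M) : Type := TangentSpace (𝓡 (2 * m)) x

/-! ### Vector fields -/

/-- The vector field `X` is smooth on the set `U`. -/
def SmoothFieldOn (X : ∀ x : M, Tan m x) (U : Set M) : Prop :=
  ContMDiffOn (𝓡 (2 * m)) (𝓡 (2 * m)).tangent ∞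
    (fun x => (⟨x, X x⟩ : TangentBundle (𝓡 (2 * m)) M)) U

/-- The vector field `X` is smooth on all of `M`. -/
def SmoothField (X : ∀ x : M, Tan m x) : Prop := SmoothFieldOn m X Set.univ

/-- The Lie bracket `[X, Y]` of vector fields. -/
def bracket (X Y : ∀ x : M, Tan m x) (x : M) : Tan m x :=
  VectorField.mlieBracket (𝓡 (2 * m)) X Y x

/-! ### Slices, foliations, 3-webs -/

/-- The differential of a chart `e` at `x`, as a linear map `T_x M → ℝ^{2m}`. -/
def chartDiff (e : OpenPartialHomeomorph M (Model m)) (x : M) : Tan m x →ₗ[ℝ] Model m :=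
  (mfderiv (𝓡 (2 * m)) (𝓡 (2 * m)) e x).toLinearMap

/-- The `m`-dimensional subspace of `T_x M` tangent to the slice
`{z | z_i = e(x)_i for all i ≥ m}` of the chart `e`. -/
def sliceSpace (e : OpenPartialHomeomorph M (Model m)) (x : M) : Submodule ℝ (Tan m x) where
  carrier := {u | ∀ i : Fin (2 * m), m ≤ (i : ℕ) → chartDiff m e x u i = 0}
  add_mem' := by
    intro a b ha hb i hi
    rw [map_add, PiLp.add_apply, ha i hi, hb i hi, add_zero]
  zero_mem' := by
    intro i _
    rw [map_zero, PiLp.zero_apply]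
  smul_mem' := by
    intro c a ha i hi
    rw [map_smul, PiLp.smul_apply, ha i hi, smul_zero]

variable (M) in
/-- An `m`-dimensional smooth foliation of `M`, given by its tangent distribution: around every
point there is a smooth chart in which the leaves are the slices
`{z | z_i = const for all i ≥ m}`, so that the tangent spaces of the leaves are those of the
slices. -/
structure WebFoliation where
  /-- the tangent space of the leaf through `x` -/
  tangent : ∀ x : M, Submodule ℝ (Tan m x)
  exists_chart : ∀ x : M, ∃ e ∈ IsManifold.maximalAtlas (𝓡 (2 * m)) ∞ M,
    x ∈ e.source ∧ ∀ y ∈ e.source, tangent y = sliceSpace m e y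

variable (M) in
/-- A 3-web on a `2m`-dimensional manifold: three `m`-dimensional foliations, any two of which are
transversal at each point. The foliations `F 0`, `F 1`, `F 2` are the usual `ℱ₁`, `ℱ₂`, `ℱ₃`. -/
structure ThreeWeb where
  F : Fin 3 → WebFoliation m M
  transversal : ∀ i j : Fin 3, i ≠ j → ∀ x : M, IsCompl ((F i).tangent x) ((F j).tangent x)

/-! ### Segre structures -/

/-- The Segre cone: linear maps `ℝ^m → ℝ^2` of rank one, i.e. the nonzero decomposable elements
`w ⊗ v` of `ℝ^m ⊗ ℝ^2`, whose elements are written as `m × 2` matrices. -/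
def segreCone : Set (Matrix (Fin m) (Fin 2) ℝ) := {A | A.rank = 1}

/-- The subspace `ℝ^m ⊗ v` of `ℝ^m ⊗ ℝ^2`. -/
def alphaModel (v : Fin 2 → ℝ) : Submodule ℝ (Matrix (Fin m) (Fin 2) ℝ) where
  carrier := {A | ∃ w : Fin m → ℝ, A = Matrix.vecMulVec w v}
  add_mem' := by
    rintro _ _ ⟨w, rfl⟩ ⟨w', rfl⟩
    exact ⟨w + w', (Matrix.add_vecMulVec w w' v).symm⟩
  zero_mem' := ⟨0, (Matrix.zero_vecMulVec v).symm⟩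
  smul_mem' := by
    rintro c _ ⟨w, rfl⟩
    exact ⟨c • w, (Matrix.smul_vecMulVec c w v).symm⟩

variable (M) in
/-- An `(m,2)`-Segre structure: a field of cones `S(x) ⊆ T_x M` together with the distinguished
family of `α`-planes, which near each point are the images of the Segre cone and of the subspaces
`ℝ^m ⊗ v`, `v ≠ 0`, under a smoothly varying linear identification `ℝ^m ⊗ ℝ^2 ≃ T_x M`.

For `m ≠ 2` the `α`-planes are determined by the cones; for `m = 2` the cone has two rulings by
planes and the identification `T_x M ≃ ℝ^m ⊗ ℝ^2` says which of them consists of `α`-planes. -/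
structure SegreStructure where
  /-- the cone `S(x)` -/
  cone : ∀ x : M, Set (Tan m x)
  /-- the set of `α`-planes at `x` -/
  alphaPlanes : ∀ x : M, Set (Submodule ℝ (Tan m x))
  smooth : ∀ x : M, ∃ U : Set M, IsOpen U ∧ x ∈ U ∧
    ∃ φ : ∀ y : M, Matrix (Fin m) (Fin 2) ℝ ≃ₗ[ℝ] Tan m y,
      (∀ A, SmoothFieldOn m (fun y => φ y A) U) ∧
      ∀ y ∈ U, cone y = φ y '' segreCone m ∧
        alphaPlanes y = {P | ∃ v : Fin 2 → ℝ, v ≠ 0 ∧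
          P = (alphaModel m v).map (φ y).toLinearMap}

/-- `e` is a slice chart at `x` for `N`, as an `m`-dimensional submanifold of `M`. -/
def IsSliceChart (N : Set M) (e : OpenPartialHomeomorph M (Model m)) (x : M) : Prop :=
  e ∈ IsManifold.maximalAtlas (𝓡 (2 * m)) ∞ M ∧ x ∈ e.source ∧
    ∀ z ∈ e.source, z ∈ N ↔ ∀ i : Fin (2 * m), m ≤ (i : ℕ) → e z i = e x i

/-- `N` is an `m`-dimensional submanifold of `M` near `x ∈ N`, and its tangent space at `x`
is `P`. -/
def HasTangentPlane (N : Set M) (x : M) (P : Submodule ℝ (Tan m x)) : Prop :=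
  ∃ e, IsSliceChart m N e x ∧ P = sliceSpace m e x

variable {m}

/-- `N` is an `α`-submanifold of `S`: an `m`-dimensional submanifold whose tangent spaces are all
`α`-planes. -/
def SegreStructure.IsAlphaSubmanifold (S : SegreStructure m M) (N : Set M) : Prop :=
  ∀ x ∈ N, ∃ P ∈ S.alphaPlanes x, HasTangentPlane m N x P

/-- `S` is `α`-integrable: every `α`-plane is tangent to an `α`-submanifold. -/
def SegreStructure.AlphaIntegrable (S : SegreStructure m M) : Prop :=
  ∀ x : M, ∀ P ∈ S.alphaPlanes x,
    ∃ N : Set M, x ∈ N ∧ S.IsAlphaSubmanifold N ∧ HasTangentPlane m N x P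

namespace ThreeWeb

variable (W : ThreeWeb m M)

/-- The tangent spaces to the three foliations of `W` are `α`-planes of `S`. -/
def HasSegre (S : SegreStructure m M) : Prop :=
  ∀ (i : Fin 3) (x : M), (W.F i).tangent x ∈ S.alphaPlanes x

/-! ### The Chern connection of a 3-web -/

/-- The projection of `T_x M` onto the tangent space of the `i`-th foliation along that of the
`k`-th one. -/
def proj (i k : Fin 3) (h : i ≠ k) (x : M) : Tan m x →ₗ[ℝ] Tan m x :=
  ((W.F i).tangent x).projection ((W.F k).tangent x) (W.transversal i k h x)

/-- `π_h`, the projection onto `Tℱ₂` along `Tℱ₁`. -/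
def piH (x : M) : Tan m x →ₗ[ℝ] Tan m x := W.proj 1 0 (by decide) x

/-- `π_v`, the projection onto `Tℱ₁` along `Tℱ₂`. -/
def piV (x : M) : Tan m x →ₗ[ℝ] Tan m x := W.proj 0 1 (by decide) x

/-- The endomorphism `j` that exchanges `Tℱ₁` and `Tℱ₂` by projection along `Tℱ₃`; see
`ThreeWeb.j_unique`. -/
def j (x : M) : Tan m x →ₗ[ℝ] Tan m x :=
  W.proj 0 2 (by decide) x ∘ₗ W.piH x + W.proj 1 2 (by decide) x ∘ₗ W.piV x

/-- The Chern connection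
`∇_X Y = π_h(j[π_h X, j π_h Y] + [π_v X, π_h Y]) + π_v(j[π_v X, j π_v Y] + [π_h X, π_v Y])`. -/
def chern (X Y : ∀ x : M, Tan m x) (x : M) : Tan m x :=
  W.piH x
      (W.j x (bracket m (fun y => W.piH y (X y)) (fun y => W.j y (W.piH y (Y y))) x)
        + bracket m (fun y => W.piV y (X y)) (fun y => W.piH y (Y y)) x)
    + W.piV x
      (W.j x (bracket m (fun y => W.piV y (X y)) (fun y => W.j y (W.piV y (Y y))) x)
        + bracket m (fun y => W.piH y (X y)) (fun y => W.piV y (Y y)) x)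

/-- The torsion `T(X, Y) = ∇_X Y - ∇_Y X - [X, Y]` of the Chern connection vanishes. -/
def TorsionFree : Prop :=
  ∀ X Y : ∀ x : M, Tan m x, SmoothField m X → SmoothField m Y →
    ∀ x : M, W.chern X Y x - W.chern Y X x - bracket m X Y x = 0

/-- `j` is the unique endomorphism of `T_x M` with `j π_h u ∈ Tℱ₁`, `j π_h u - π_h u ∈ Tℱ₃`,
`j π_v u ∈ Tℱ₂`, `j π_v u - π_v u ∈ Tℱ₃` for all `u`. -/
theorem j_unique (x : M) (f : Tan m x →ₗ[ℝ] Tan m x) :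
    f = W.j x ↔ ∀ u : Tan m x,
      (f (W.piH x u) ∈ (W.F 0).tangent x ∧
        f (W.piH x u) - W.piH x u ∈ (W.F 2).tangent x) ∧
      (f (W.piV x u) ∈ (W.F 1).tangent x ∧
        f (W.piV x u) - W.piV x u ∈ (W.F 2).tangent x) := by
  have proj_mem : ∀ (i k : Fin 3) (h : i ≠ k) (u : Tan m x),
      W.proj i k h x u ∈ (W.F i).tangent x := fun i k h u =>
    Submodule.projection_apply_mem (W.transversal i k h x) u
  have proj_eq : ∀ (i k : Fin 3) (h : i ≠ k) (u v : Tan m x), v ∈ (W.F i).tangent x →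
      v - u ∈ (W.F k).tangent x → v = W.proj i k h x u := by
    intro i k h u v hv hd
    have h1 : W.proj i k h x v = v :=
      Submodule.projection_apply_of_mem_left (W.transversal i k h x) hv
    have h2 : W.proj i k h x (v - u) = 0 :=
      (Submodule.projection_apply_eq_zero_iff (W.transversal i k h x)).2 hd
    rw [map_sub, sub_eq_zero] at h2
    exact h1.symm.trans h2
  have proj_sub : ∀ (i k : Fin 3) (h : i ≠ k) (u : Tan m x),
      W.proj i k h x u - u ∈ (W.F k).tangent x := by
    intro i k h u
    refine (Submodule.projection_apply_eq_zero_iff (W.transversal i k h x)).1 ?_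
    rw [map_sub, sub_eq_zero]
    exact Submodule.projection_apply_of_mem_left (W.transversal i k h x) (proj_mem i k h u)
  have self : ∀ (i k : Fin 3) (h : i ≠ k) (u : Tan m x), u ∈ (W.F i).tangent x →
      W.proj i k h x u = u := fun i k h u hu =>
    Submodule.projection_apply_of_mem_left (W.transversal i k h x) hu
  have kill : ∀ (i k : Fin 3) (h : i ≠ k) (u : Tan m x), u ∈ (W.F k).tangent x →
      W.proj i k h x u = 0 := fun i k h u hu =>
    (Submodule.projection_apply_eq_zero_iff (W.transversal i k h x)).2 hu
  have hjH : ∀ u, W.j x (W.piH x u) = W.proj 0 2 (by decide) x (W.piH x u) := by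
    intro u
    have hu : W.piH x u ∈ (W.F 1).tangent x := proj_mem 1 0 (by decide) u
    have e1 : W.piH x (W.piH x u) = W.piH x u := self 1 0 (by decide) _ hu
    have e2 : W.piV x (W.piH x u) = 0 := kill 0 1 (by decide) _ hu
    simp only [j, LinearMap.add_apply, LinearMap.comp_apply, e1, e2, map_zero, add_zero]
  have hjV : ∀ u, W.j x (W.piV x u) = W.proj 1 2 (by decide) x (W.piV x u) := by
    intro u
    have hu : W.piV x u ∈ (W.F 0).tangent x := proj_mem 0 1 (by decide) u
    have e1 : W.piV x (W.piV x u) = W.piV x u := self 0 1 (by decide) _ hu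
    have e2 : W.piH x (W.piV x u) = 0 := kill 1 0 (by decide) _ hu
    simp only [j, LinearMap.add_apply, LinearMap.comp_apply, e1, e2, map_zero, zero_add]
  constructor
  · rintro rfl u
    rw [hjH, hjV]
    exact ⟨⟨proj_mem _ _ _ _, proj_sub _ _ _ _⟩, ⟨proj_mem _ _ _ _, proj_sub _ _ _ _⟩⟩
  · intro hf
    ext1 u
    have hsum : W.piH x u + W.piV x u = u := by
      have hm := proj_sub 0 1 (by decide) u
      have h3 := proj_eq 1 0 (by decide) u (u - W.piV x u) (by
        rw [← neg_sub]
        exact neg_mem hm) (by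
        rw [sub_sub_cancel_left]
        exact neg_mem (proj_mem 0 1 (by decide) u))
      have h4 : u - W.piV x u = W.piH x u := h3
      rw [← h4, sub_add_cancel]
    rw [← hsum, map_add, map_add, hjH, hjV,
      proj_eq 0 2 (by decide) _ _ (hf u).1.1 (hf u).1.2,
      proj_eq 1 2 (by decide) _ _ (hf u).2.1 (hf u).2.2]

end ThreeWeb

/-! ### Hyper-para-complex structures -/

/-- The endomorphism field `A` of the tangent bundle is smooth: it takes smooth vector fields to
smooth vector fields. -/
def SmoothEnd (A : ∀ x : M, Module.End ℝ (Tan m x)) : Prop :=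
  ∀ X : ∀ x : M, Tan m x, SmoothField m X → SmoothField m (fun x => A x (X x))

/-- The Nijenhuis tensor `[AX, AY] - A[AX, Y] - A[X, AY] + A²[X, Y]` of `A` vanishes. -/
def NijenhuisZero (A : ∀ x : M, Module.End ℝ (Tan m x)) : Prop :=
  ∀ X Y : ∀ x : M, Tan m x, SmoothField m X → SmoothField m Y → ∀ x : M,
    bracket m (fun y => A y (X y)) (fun y => A y (Y y)) x
      - A x (bracket m (fun y => A y (X y)) Y x)
      - A x (bracket m X (fun y => A y (Y y)) x)
      + A x (A x (bracket m X Y x)) = 0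

/-- A complex structure: a smooth `A` with `A² = -1` and vanishing Nijenhuis tensor. -/
structure IsComplexStructure (A : ∀ x : M, Module.End ℝ (Tan m x)) : Prop where
  smooth : SmoothEnd A
  sq : ∀ x : M, A x * A x = -1
  integrable : NijenhuisZero A

/-- A para-complex structure: a smooth `A` with `A² = 1`, eigenspaces for `1` and `-1` of equal
dimension, and vanishing Nijenhuis tensor. -/
structure IsParaComplexStructure (A : ∀ x : M, Module.End ℝ (Tan m x)) : Prop where
  smooth : SmoothEnd A
  sq : ∀ x : M, A x * A x = 1
  rank_eq : ∀ x : M, Module.finrank ℝ ((A x).eigenspace 1) =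
    Module.finrank ℝ ((A x).eigenspace (-1))
  integrable : NijenhuisZero A

variable (m M) in
/-- A hyper-para-complex structure `(I, K, J)`: anti-commuting `I, K, J` with `IK = -KI = J`,
where `I`, `K` are para-complex structures and `J` is a complex structure. (That `J` anti-commutes
with `I` and `K` follows.) -/
structure HyperParaComplex where
  I : ∀ x : M, Module.End ℝ (Tan m x)
  K : ∀ x : M, Module.End ℝ (Tan m x)
  J : ∀ x : M, Module.End ℝ (Tan m x)
  paraI : IsParaComplexStructure I
  paraK : IsParaComplexStructure K
  complexJ : IsComplexStructure J
  mul_IK : ∀ x : M, I x * K x = J x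
  mul_KI : ∀ x : M, K x * I x = -J x

/-- `(I, K, J)` is compatible with `S`: all of `I`, `J`, `K` preserve the Segre cones. -/
def HyperParaComplex.CompatibleWith (H : HyperParaComplex m M) (S : SegreStructure m M) : Prop :=
  ∀ x : M, H.I x '' S.cone x = S.cone x ∧ H.J x '' S.cone x = S.cone x ∧
    H.K x '' S.cone x = S.cone x

/-- `(I, K, J)` acts through the factor `ℝ^2` only: at each point, for some identification
`ℝ^m ⊗ ℝ^2 ≃ T_x M` adapted to `S`, the endomorphisms `I` and `K` (hence also `J = IK`) have the
form `1 ⊗ P`, i.e. they are right multiplications by `2 × 2` matrices. -/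
def HyperParaComplex.ActsOnPlaneFactor (H : HyperParaComplex m M) (S : SegreStructure m M) :
    Prop :=
  ∀ x : M, ∃ φ : Matrix (Fin m) (Fin 2) ℝ ≃ₗ[ℝ] Tan m x,
    S.cone x = φ '' segreCone m ∧
    S.alphaPlanes x = {P | ∃ v : Fin 2 → ℝ, v ≠ 0 ∧ P = (alphaModel m v).map φ.toLinearMap} ∧
    ∃ P Q : Matrix (Fin 2) (Fin 2) ℝ, ∀ A : Matrix (Fin m) (Fin 2) ℝ,
      H.I x (φ A) = φ (A * P) ∧ H.K x (φ A) = φ (A * Q)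

/-- The hyper-para-complex structure `(I, K, J)` is the one defined by the 3-web `W` through the
decompositions `TM = Tℱ₁ ⊕ Tℱ₂` and `TM = Tℱ₃ ⊕ {X + jX | X ∈ Tℱ₁}`: these are the decompositions
into the eigenspaces of `I` and of `K` for `1` and `-1`. -/
def ThreeWeb.Induces (W : ThreeWeb m M) (H : HyperParaComplex m M) : Prop :=
  ∀ x : M, (H.I x).eigenspace 1 = (W.F 0).tangent x ∧
    (H.I x).eigenspace (-1) = (W.F 1).tangent x ∧
    (H.K x).eigenspace 1 = (W.F 2).tangent x ∧
    (H.K x).eigenspace (-1) = ((W.F 0).tangent x).map (LinearMap.id + W.j x)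

end

end

/-!
# 3-webs, Segre structures and hyper-para-complex structures

**From webs to Segre structures.** Let `a` run through `Tℱ₁`. The involution `j` exchanges `Tℱ₁` and
`Tℱ₂`, and `Tℱ₃` is its eigenspace for `-1`, so the three foliations are the members `(1, 0)`,
`(0, 1)`, `(1, -1)` of the pencil of distributions `{s a + t j a}` (`ThreeWeb.pencil`). A basis of
`Tℱ₁` therefore gives an identification `TM ≅ ℝ^m ⊗ ℝ^2` whose `α`-planes are the members of the
pencil (`ThreeWeb.segre`). Conversely three pairwise different points of the projective line are
equivalent to any other three, so the `α`-planes of each Segre structure containing the web are the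
members of the pencil (`ThreeWeb.HasSegre.alphaPlanes_eq`); the cones are the unions of the
`α`-planes without the origin.

**The torsion.** On pairs of fields tangent to one of the first two foliations, the vanishing of the
torsion of the Chern connection says that `j([a, j b] + [j a, b]) = [a, b] + [j a, j b]`, that is,
`j` has vanishing Nijenhuis tensor; on mixed pairs the torsion vanishes always
(`WebAlgebra.torsion_eq_zero_iff`, `WebAlgebra.flat_of_nijenhuis_j`). The same identity makes every
distribution of the pencil involutive (`WebAlgebra.Flat.br_range`), which gives `α`-integrability,
and makes `I = π_v - π_h`, `K = -j`, `J = IK` a hyper-para-complex structure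
(`ThreeWeb.TorsionFree.hyperParaComplex`). In the description `s a + t j a` the endomorphisms `I`
and `K` act on `(s, t)` only, so they preserve the cones.

**From hyper-para-complex structures to webs.** The eigendistributions of the integrable `I` and `K`
are involutive, and pairwise transversal since `I` and `K` anti-commute
(`HyperParaComplex.exists_web`). For the resulting web `j = -K`, so that the torsion vanishes. Its
Segre structure is `S` if and only if `I` and `K` have the form `1 ⊗ P`: the identifications above
bring them into this form, and conversely the eigenspaces of an involution `1 ⊗ P`, `P ≠ ±1`, have
the form `ℝ^m ⊗ v` (`ThreeWeb.hasSegre_iff_actsOnPlaneFactor`).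

**Frobenius' theorem.** Foliations are obtained from involutive distributions by Frobenius' theorem
(`exists_foliation_tangent_eq_range`), for distributions given as ranges of smooth endomorphism
fields. Locally the distribution consists of the graphs of linear maps `F p : P → Q`, and leaves are
found by solving the differential equation `w' = F (p₀ + t x, w) x` along the rays of `P`; the
integrability condition says that the graphs of the solutions are tangent to the distribution
(`linearized_radialSolution_eq`). Smooth dependence on the initial data follows from the implicit
function theorem in the Banach space `C([0, 1], Q)`, applied to the integral equation
(`exists_radialSolution`).
-/

noncomputable section

/-! ### Composition operators on spaces of continuous maps -/

section Composition

variable {K : Type*} [TopologicalSpace K] [CompactSpace K]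

/-- Pointwise application of a family of continuous linear maps to a continuous map, as a bounded
bilinear map. -/
def pointwiseApply (K : Type*) [TopologicalSpace K] [CompactSpace K] (E F : Type*)
    [NormedAddCommGroup E] [NormedSpace ℝ E] [NormedAddCommGroup F] [NormedSpace ℝ F] :
    C(K, E →L[ℝ] F) →L[ℝ] C(K, E) →L[ℝ] C(K, F) :=
  LinearMap.mkContinuous₂
    (LinearMap.mk₂ ℝ (fun (L : C(K, E →L[ℝ] F)) (h : C(K, E)) =>
        (⟨fun t => L t (h t), by fun_prop⟩ : C(K, F)))
      (fun L L' h => by ext t; simp) (fun c L h => by ext t; simp)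
      (fun L h h' => by ext t; simp) (fun c L h => by ext t; simp)) 1
    (fun L h => by
      rw [one_mul]
      refine (ContinuousMap.norm_le _ (by positivity)).2 fun t => ?_
      exact ((L t).le_opNorm _).trans
        (mul_le_mul (L.norm_coe_le_norm t) (h.norm_coe_le_norm t) (norm_nonneg _)
          (norm_nonneg L)))

variable {E F : Type} [NormedAddCommGroup E] [NormedSpace ℝ E] [NormedAddCommGroup F]
  [NormedSpace ℝ F]

@[simp] lemma pointwiseApply_apply (L : C(K, E →L[ℝ] F)) (h : C(K, E)) (t : K) :
    pointwiseApply K E F L h t = L t (h t) := rfl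

lemma hasFDerivAt_continuousMap_comp {f : C(E, F)} {f' : C(E, E →L[ℝ] F)}
    (hf : ∀ x, HasFDerivAt f (f' x) x) (w : C(K, E)) :
    HasFDerivAt (fun w : C(K, E) => f.comp w) (pointwiseApply K E F (f'.comp w)) w := by
  refine HasFDerivAt.of_isLittleO (Asymptotics.isLittleO_iff.2 fun ε hε => ?_)
  have hc : ContinuousAt (fun w : C(K, E) => f'.comp w) w :=
    (ContinuousMap.continuous_postcomp f').continuousAt
  obtain ⟨δ, hδ, h⟩ := (Metric.continuousAt_iff (α := C(K, E)) (β := C(K, E →L[ℝ] F))).1 hc ε hε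
  filter_upwards [Metric.ball_mem_nhds w hδ] with w' hw'
  refine (ContinuousMap.norm_le _ (by positivity)).2 fun t => ?_
  have key : ‖f (w' t) - f (w t) - f' (w t) (w' t - w t)‖ ≤ ε * ‖w' t - w t‖ := by
    refine Convex.norm_image_sub_le_of_norm_hasFDerivWithin_le' (s := segment ℝ (w t) (w' t))
      (f' := f') (fun x _ => (hf x).hasFDerivWithinAt) ?_ (convex_segment _ _)
      (left_mem_segment _ _ _) (right_mem_segment _ _ _)
    rintro x ⟨a, b, ha, hb, hab, rfl⟩
    -- the intermediate point is the value at `t` of a continuous map that is `δ`-close to `w`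
    have hd : dist (a • w + b • w') w < δ := by
      have : a • w + b • w' - w = b • (w' - w) := by
        rw [← eq_sub_iff_add_eq] at hab
        subst hab
        module
      rw [dist_eq_norm, this, norm_smul, Real.norm_of_nonneg hb]
      have := (mem_ball_iff_norm.1 hw')
      nlinarith [norm_nonneg (w' - w)]
    have := (ContinuousMap.dist_lt_iff hε).1 (h hd) t
    rw [dist_eq_norm] at this
    exact this.le
  refine le_trans (le_of_eq ?_) (key.trans (mul_le_mul_of_nonneg_left ?_ hε.le))
  · simp
  · exact (w' - w).norm_coe_le_norm t

/-- The operator `w ↦ f ∘ w` on continuous maps from a compact space is smooth when `f` is. -/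
lemma contDiff_continuousMap_comp {f : C(E, F)} (hf : ContDiff ℝ ∞ f) :
    ContDiff ℝ ∞ (fun w : C(K, E) => f.comp w) := by
  rw [contDiff_infty]
  intro n
  induction n generalizing F with
  | zero => exact contDiff_zero.2 (ContinuousMap.continuous_postcomp f)
  | succ n ih =>
    have hf' : ContDiff ℝ ∞ (fderiv ℝ f) := hf.fderiv_right (by simp)
    let f' : C(E, E →L[ℝ] F) := ⟨fderiv ℝ f, hf'.continuous⟩
    have := ih (f := f') hf'
    push_cast
    refine contDiff_succ_iff_hasFDerivAt.2
      ⟨fun w => pointwiseApply K E F (f'.comp w), ?_, fun w => ?_⟩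
    · exact (pointwiseApply K E F).contDiff.comp this
    · exact hasFDerivAt_continuousMap_comp
        (fun x => (hf.differentiable (by simp) x).hasFDerivAt) w

end Composition

/-! ### The inverse function theorem on open sets -/

/-- The inverse function theorem for smooth maps. The source is shrunk so that the derivative is
invertible on all of it, which makes the inverse smooth on the whole target. -/
lemma exists_smooth_localInverse {E F : Type*} [NormedAddCommGroup E] [NormedSpace ℝ E]
    [CompleteSpace E] [NormedAddCommGroup F] [NormedSpace ℝ F] [CompleteSpace F] {f : E → F}
    {N : Set E} (hN : IsOpen N) (hf : ContDiffOn ℝ ∞ f N) {a : E} (ha : a ∈ N) (f' : E ≃L[ℝ] F)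
    (hf' : HasFDerivAt f (f' : E →L[ℝ] F) a) :
    ∃ Φ : OpenPartialHomeomorph E F, (Φ : E → F) = f ∧ a ∈ Φ.source ∧ Φ.source ⊆ N ∧
      ContDiffOn ℝ ∞ Φ Φ.source ∧ ContDiffOn ℝ ∞ Φ.symm Φ.target := by
  have hfa : ContDiffAt ℝ ∞ f a := hf.contDiffAt (hN.mem_nhds ha)
  let Φ₀ := hfa.toOpenPartialHomeomorph f hf' (by simp)
  let R : Set (E →L[ℝ] F) := Set.range ((↑) : (E ≃L[ℝ] F) → E →L[ℝ] F)
  have hR : IsOpen R := ContinuousLinearEquiv.isOpen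
  have hcont : ContinuousOn (fderiv ℝ f) N := hf.continuousOn_fderiv_of_isOpen hN (by simp)
  let N' := N ∩ fderiv ℝ f ⁻¹' R
  have hN' : IsOpen N' := hcont.isOpen_inter_preimage hN hR
  have haN' : a ∈ N' := ⟨ha, by rw [Set.mem_preimage, hf'.fderiv]; exact ⟨f', rfl⟩⟩
  let Φ := Φ₀.restrOpen N' hN'
  have hΦf : (Φ : E → F) = f := rfl
  have hsub : Φ.source ⊆ N' := fun x hx => hx.2
  refine ⟨Φ, hΦf, ⟨hfa.mem_toOpenPartialHomeomorph_source hf' (by simp), haN'⟩,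
    fun x hx => (hsub hx).1, ?_, ?_⟩
  · rw [hΦf]
    exact hf.mono fun x hx => (hsub hx).1
  · intro y hy
    have hx := Φ.map_target hy
    obtain ⟨g, hg⟩ := (hsub hx).2
    have hx' := hf.contDiffAt (hN.mem_nhds (hsub hx).1)
    refine (Φ.contDiffAt_symm (f₀' := g) hy ?_ hx').contDiffWithinAt
    rw [hg]
    exact (hx'.differentiableAt (by simp)).hasFDerivAt

/-! ### Smooth dependence of radial differential equations on parameters -/

/-- Solutions of the fixed point equation `w = H (q, w)` depend smoothly on the parameter `q` near
a parameter `q₀` for which `H (q₀, ·)` is constant. -/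
lemma exists_smooth_fixedPoint {E C : Type*} [NormedAddCommGroup E] [NormedSpace ℝ E]
    [CompleteSpace E] [NormedAddCommGroup C] [NormedSpace ℝ C] [CompleteSpace C] {H : E × C → C}
    (hH : ContDiff ℝ ∞ H) {q₀ : E} (h₀ : ∀ w, H (q₀, w) = H (q₀, 0)) :
    ∃ (W : E → C) (N : Set E), IsOpen N ∧ q₀ ∈ N ∧ ContDiffOn ℝ ∞ W N ∧
      ∀ q ∈ N, W q = H (q, W q) := by
  set w₀ := H (q₀, 0) with hw₀
  let D : E × C →L[ℝ] C := fderiv ℝ H (q₀, w₀)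
  have hD : HasFDerivAt H D (q₀, w₀) := (hH.differentiable (by simp) _).hasFDerivAt
  have hD0 : ∀ k : C, D (0, k) = 0 := by
    intro k
    have h1 : HasFDerivAt (fun w : C => H (q₀, w)) (D.comp (ContinuousLinearMap.inr ℝ E C)) w₀ :=
      hD.comp w₀ (hasFDerivAt_prodMk_right q₀ w₀)
    have h2 : HasFDerivAt (fun w : C => H (q₀, w)) (0 : C →L[ℝ] C) w₀ := by
      simp_rw [h₀]
      exact hasFDerivAt_const _ _
    simpa using congrArg (fun L => L k) (h1.unique h2)
  let Ψ : E × C → E × C := fun p => (p.1, p.2 - H p)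
  let L : (E × C) ≃L[ℝ] (E × C) :=
    (ContinuousLinearEquiv.refl ℝ E).skewProd (ContinuousLinearEquiv.refl ℝ C)
      (-(D.comp (ContinuousLinearMap.inl ℝ E C)))
  have hΨ' : HasFDerivAt Ψ (L : E × C →L[ℝ] E × C) (q₀, w₀) := by
    have h1 : HasFDerivAt Ψ ((ContinuousLinearMap.fst ℝ E C).prod
        (ContinuousLinearMap.snd ℝ E C - D)) (q₀, w₀) :=
      hasFDerivAt_fst.prodMk (hasFDerivAt_snd.sub hD)
    convert h1 using 1
    ext k
    · simp [L]
    · simp [L]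
    · simp [L]
    · simp [L, hD0]
  obtain ⟨Φ, hΦ, ha, -, -, hs⟩ := exists_smooth_localInverse isOpen_univ
    (f := Ψ) (by fun_prop) (Set.mem_univ _) L hΨ'
  have hcont : Continuous fun q : E => (q, (0 : C)) := by fun_prop
  refine ⟨fun q => (Φ.symm (q, 0)).2, (fun q : E => (q, (0 : C))) ⁻¹' Φ.target,
    Φ.open_target.preimage hcont, ?_, ?_, ?_⟩
  · have := Φ.map_source ha
    rw [hΦ] at this
    simpa [Ψ, h₀ w₀] using this
  · refine contDiff_snd.comp_contDiffOn (hs.comp (t := Φ.target) ?_ fun q hq => hq)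
    exact (contDiff_id.prodMk contDiff_const).contDiffOn
  · intro q hq
    have h1 := Φ.right_inv hq
    rw [hΦ] at h1
    have h2 : (Φ.symm (q, 0)).1 = q := congrArg Prod.fst h1
    have h3 : (Φ.symm (q, 0)).2 - H (Φ.symm (q, 0)) = 0 := congrArg Prod.snd h1
    have h4 : Φ.symm (q, 0) = (q, (Φ.symm (q, 0)).2) := Prod.ext h2 rfl
    rw [← h4]
    exact sub_eq_zero.1 h3

section Radial

variable {P Q : Type} [NormedAddCommGroup P] [NormedSpace ℝ P] [NormedAddCommGroup Q]
  [NormedSpace ℝ Q]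

/-- The projection of the real line onto the unit interval. -/
abbrev clampUnit (s : ℝ) : unitInterval := Set.projIcc 0 1 zero_le_one s

lemma continuous_clampUnit : Continuous clampUnit := continuous_projIcc

/-- The operator `h ↦ (t ↦ ∫₀ᵗ h)` on `C([0,1], Q)`. -/
def primitiveCLM (Q : Type) [NormedAddCommGroup Q] [NormedSpace ℝ Q] :
    C(unitInterval, Q) →L[ℝ] C(unitInterval, Q) :=
  have hc : ∀ h : C(unitInterval, Q), Continuous fun s => h (clampUnit s) := fun h =>
    h.continuous.comp continuous_clampUnit
  LinearMap.mkContinuous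
    { toFun := fun h =>
        ⟨fun t => ∫ s in (0 : ℝ)..t, h (clampUnit s),
          (intervalIntegral.continuous_primitive
            (fun a b => (hc h).intervalIntegrable a b) 0).comp continuous_subtype_val⟩
      map_add' := fun h k => by
        ext t
        exact intervalIntegral.integral_add ((hc h).intervalIntegrable _ _)
          ((hc k).intervalIntegrable _ _)
      map_smul' := fun c h => by
        ext t
        exact intervalIntegral.integral_smul c _ } 1
    (fun h => by
      refine (ContinuousMap.norm_le _ (by positivity)).2 fun t => ?_
      have := intervalIntegral.norm_integral_le_of_norm_le_const (a := 0) (b := t)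
        (f := fun s => h (clampUnit s)) (C := ‖h‖) fun s _ => h.norm_coe_le_norm _
      refine this.trans ?_
      rw [sub_zero, abs_of_nonneg t.2.1, one_mul]
      exact mul_le_of_le_one_right (norm_nonneg _) t.2.2)

lemma primitiveCLM_apply (h : C(unitInterval, Q)) (t : unitInterval) :
    primitiveCLM Q h t = ∫ s in (0 : ℝ)..t, h (clampUnit s) := rfl

/-- The linear part of `radialLift`. -/
def radialLiftLinear (P Q : Type) [NormedAddCommGroup P] [NormedSpace ℝ P]
    [NormedAddCommGroup Q] [NormedSpace ℝ Q] :
    ((P × Q) × C(unitInterval, Q)) →L[ℝ] C(unitInterval, (P × Q) × P) :=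
  LinearMap.mkContinuous
    { toFun := fun z => ⟨fun t => (((t : ℝ) • z.1.1, z.2 t), z.1.1), by fun_prop⟩
      map_add' := fun z z' => by ext t <;> simp
      map_smul' := fun c z => by ext t <;> simp [smul_comm c] } 1
    (fun z => by
      refine (ContinuousMap.norm_le _ (by positivity)).2 fun t => ?_
      have h1 : ‖z.1.1‖ ≤ ‖z‖ := (norm_fst_le z.1).trans (norm_fst_le z)
      have h2 : ‖(t : ℝ) • z.1.1‖ ≤ ‖z‖ := by
        rw [norm_smul, Real.norm_of_nonneg t.2.1]
        exact (mul_le_of_le_one_left (norm_nonneg _) t.2.2).trans h1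
      have h3 : ‖z.2 t‖ ≤ ‖z‖ := (z.2.norm_coe_le_norm t).trans (norm_snd_le z)
      rw [one_mul]
      exact norm_prod_le_iff.2 ⟨norm_prod_le_iff.2 ⟨h2, h3⟩, h1⟩)

@[simp] lemma radialLiftLinear_apply (z : (P × Q) × C(unitInterval, Q)) (t : unitInterval) :
    radialLiftLinear P Q z t = (((t : ℝ) • z.1.1, z.2 t), z.1.1) := rfl

/-- The curve `t ↦ ((p₀ + t x, w t), x)` attached to `((x, c), w)`. -/
def radialLift (p₀ : P) (z : (P × Q) × C(unitInterval, Q)) : C(unitInterval, (P × Q) × P) :=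
  ContinuousMap.const _ ((p₀, 0), 0) + radialLiftLinear P Q z

@[simp] lemma radialLift_apply (p₀ : P) (z : (P × Q) × C(unitInterval, Q)) (t : unitInterval) :
    radialLift p₀ z t = ((p₀ + (t : ℝ) • z.1.1, z.2 t), z.1.1) := by
  simp [radialLift]

/-- The solution `W (x, c)` of the radial equation `w' = F (p₀ + t x, w) x`, `w 0 = c`, on `[0,1]`,
exists and depends smoothly on `(x, c)` near `x = 0`; its derivative with respect to `x` solves the
linearized equation. -/
lemma exists_radialSolution [CompleteSpace P] [CompleteSpace Q] {F : P × Q → P →L[ℝ] Q}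
    (hF : ContDiff ℝ ∞ F) (p₀ : P) (c₀ : Q) :
    ∃ (W : P × Q → C(unitInterval, Q)) (N : Set (P × Q)), IsOpen N ∧ (0, c₀) ∈ N ∧
      ContDiffOn ℝ ∞ W N ∧
      (∀ q ∈ N, ∀ t, W q t = q.2 + ∫ s in (0 : ℝ)..t,
        F (p₀ + (clampUnit s : ℝ) • q.1, W q (clampUnit s)) q.1) ∧
      ∀ q ∈ N, ∀ b : P, ∀ t, fderiv ℝ W q (b, 0) t = ∫ s in (0 : ℝ)..t,
        (fderiv ℝ F (p₀ + (clampUnit s : ℝ) • q.1, W q (clampUnit s))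
            ((clampUnit s : ℝ) • b, fderiv ℝ W q (b, 0) (clampUnit s)) q.1 +
          F (p₀ + (clampUnit s : ℝ) • q.1, W q (clampUnit s)) b) := by
  have hf : ContDiff ℝ ∞ (fun z : (P × Q) × P => F z.1 z.2) :=
    (hF.comp contDiff_fst).clm_apply contDiff_snd
  let f : C((P × Q) × P, Q) := ⟨fun z => F z.1 z.2, hf.continuous⟩
  have hf' : ∀ z z', fderiv ℝ f z z' = fderiv ℝ F z.1 z'.1 z.2 + F z.1 z'.2 := by
    intro z z'
    have h1 : HasFDerivAt F (fderiv ℝ F z.1) z.1 :=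
      (hF.differentiable (by simp) _).hasFDerivAt
    have h2 := (h1.comp z hasFDerivAt_fst).clm_apply hasFDerivAt_snd
    have h3 : fderiv ℝ f z = _ := h2.fderiv
    rw [h3]
    simp [add_comm]
  let f' : C((P × Q) × P, ((P × Q) × P) →L[ℝ] Q) :=
    ⟨fderiv ℝ f, (hf.fderiv_right (m := ∞) (by simp)).continuous⟩
  let ι : Q →L[ℝ] C(unitInterval, Q) := ContinuousLinearMap.const ℝ unitInterval
  let H : (P × Q) × C(unitInterval, Q) → C(unitInterval, Q) := fun z =>
    ι z.1.2 + primitiveCLM Q (f.comp (radialLift p₀ z))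
  have hlift : ContDiff ℝ ∞ (radialLift (Q := Q) p₀) :=
    contDiff_const.add (radialLiftLinear P Q).contDiff
  have hH : ContDiff ℝ ∞ H :=
    (ι.contDiff.comp (contDiff_snd.comp contDiff_fst)).add
      ((primitiveCLM Q).contDiff.comp ((contDiff_continuousMap_comp (f := f) hf).comp hlift))
  have hH0 : ∀ w, H ((0, c₀), w) = ι c₀ := by
    intro w
    have : f.comp (radialLift p₀ ((0, c₀), w)) = 0 := by
      ext t
      simp [f]
    simp [H, this]
  obtain ⟨W, N, hN, h0, hW, hfix⟩ := exists_smooth_fixedPoint hH (q₀ := (0, c₀))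
    fun w => by rw [hH0, hH0]
  refine ⟨W, N, hN, h0, hW, fun q hq t => ?_, fun q hq b t => ?_⟩
  · conv_lhs => rw [hfix q hq]
    simp [H, ι, primitiveCLM_apply, f]
  · have hWq : HasFDerivAt W (fderiv ℝ W q) q :=
      ((hW.contDiffAt (hN.mem_nhds hq)).differentiableAt (by simp)).hasFDerivAt
    have hpair := (hasFDerivAt_id q).prodMk hWq
    have hl : HasFDerivAt (radialLift (Q := Q) p₀) (radialLiftLinear P Q) (q, W q) :=
      (radialLiftLinear P Q).hasFDerivAt.const_add _
    have hcomp := hasFDerivAt_continuousMap_comp (f := f) (f' := f')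
      (fun x => (hf.differentiable (by simp) x).hasFDerivAt) (radialLift p₀ (q, W q))
    have h1 := (ι.hasFDerivAt.comp q hasFDerivAt_snd).add ((primitiveCLM Q).hasFDerivAt.comp q
      ((hcomp.comp (q, W q) hl).comp q hpair))
    have h2 : HasFDerivAt W _ q := h1.congr_of_eventuallyEq
      (Filter.eventually_of_mem (hN.mem_nhds hq) hfix)
    have h3 := congrArg (fun L => L (b, 0) t) h2.fderiv
    refine h3.trans ?_
    simp [primitiveCLM_apply, f', hf', ι]

end Radial

/-! ### Integration of graph distributions -/

section Graph

variable {P Q : Type} [NormedAddCommGroup P] [NormedSpace ℝ P] [NormedAddCommGroup Q]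
  [NormedSpace ℝ Q]

/-- Along a solution `w` of the radial equation for `F`, if the distribution of the graphs of `F`
is integrable, then the solution `η` of the linearized equation is `t F(p_t) b`, where
`p_t = (p₀ + t x, w t)`: the difference of both sides solves a homogeneous linear equation. -/
lemma linearized_radialSolution_eq [CompleteSpace Q] {F : P × Q → P →L[ℝ] Q}
    (hF : ContDiff ℝ ∞ F) {Ω : Set (P × Q)}
    (hΩ : ∀ p ∈ Ω, ∀ a b, fderiv ℝ F p (a, F p a) b = fderiv ℝ F p (b, F p b) a)
    {p₀ x b : P} {c : Q} {w η : C(unitInterval, Q)}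
    (hmem : ∀ t : unitInterval, (p₀ + (t : ℝ) • x, w t) ∈ Ω)
    (hw : ∀ t : unitInterval, w t = c + ∫ s in (0 : ℝ)..t,
      F (p₀ + (clampUnit s : ℝ) • x, w (clampUnit s)) x)
    (hη : ∀ t : unitInterval, η t = ∫ s in (0 : ℝ)..t,
      (fderiv ℝ F (p₀ + (clampUnit s : ℝ) • x, w (clampUnit s))
          ((clampUnit s : ℝ) • b, η (clampUnit s)) x +
        F (p₀ + (clampUnit s : ℝ) • x, w (clampUnit s)) b)) (t : unitInterval) :
    η t = (t : ℝ) • F (p₀ + (t : ℝ) • x, w t) b := by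
  have hF' : Continuous (fderiv ℝ F) := hF.continuous_fderiv (by simp)
  have hσ := continuous_clampUnit
  have hp : Continuous fun t : ℝ => (p₀ + (clampUnit t : ℝ) • x, w (clampUnit t)) := by
    fun_prop
  have hFp := hF.continuous.comp hp
  have hFp' := hF'.comp hp
  let w₁ : ℝ → Q := fun t => c + ∫ s in (0 : ℝ)..t,
    F (p₀ + (clampUnit s : ℝ) • x, w (clampUnit s)) x
  let η₁ : ℝ → Q := fun t => ∫ s in (0 : ℝ)..t,
      (fderiv ℝ F (p₀ + (clampUnit s : ℝ) • x, w (clampUnit s))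
          ((clampUnit s : ℝ) • b, η (clampUnit s)) x +
        F (p₀ + (clampUnit s : ℝ) • x, w (clampUnit s)) b)
  have hw₁ : ∀ t, HasDerivAt w₁ (F (p₀ + (clampUnit t : ℝ) • x, w (clampUnit t)) x) t := by
    intro t
    have hc : Continuous fun s : ℝ => F (p₀ + (clampUnit s : ℝ) • x, w (clampUnit s)) x :=
      hFp.clm_apply continuous_const
    exact (hc.integral_hasStrictDerivAt 0 t).hasDerivAt.const_add c
  have hη₁ : ∀ t, HasDerivAt η₁ (fderiv ℝ F (p₀ + (clampUnit t : ℝ) • x, w (clampUnit t))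
      ((clampUnit t : ℝ) • b, η (clampUnit t)) x +
        F (p₀ + (clampUnit t : ℝ) • x, w (clampUnit t)) b) t := by
    intro t
    have hv : Continuous fun s : ℝ => ((clampUnit s : ℝ) • b, η (clampUnit s)) := by fun_prop
    have hc := ((hFp'.clm_apply hv).clm_apply (continuous_const (y := x))).add
      (hFp.clm_apply (continuous_const (y := b)))
    exact (hc.integral_hasStrictDerivAt 0 t).hasDerivAt
  have hclamp : ∀ t (ht : t ∈ Set.Icc (0 : ℝ) 1), clampUnit t = ⟨t, ht⟩ := fun t ht =>
    Set.projIcc_of_mem _ ht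
  have hw₂ : ∀ t ∈ Set.Icc (0 : ℝ) 1, w (clampUnit t) = w₁ t := by
    intro t ht
    rw [hclamp t ht, hw]
  have hη₂ : ∀ t ∈ Set.Icc (0 : ℝ) 1, η (clampUnit t) = η₁ t := by
    intro t ht
    rw [hclamp t ht, hη]
  let ρ : ℝ → Q := fun t => η₁ t - t • F (p₀ + t • x, w₁ t) b
  obtain ⟨K, hK⟩ := (isCompact_Icc (a := (0 : ℝ)) (b := 1)).exists_bound_of_continuousOn
    (E := P × Q →L[ℝ] P →L[ℝ] Q) hFp'.continuousOn
  have hρ : ∀ t ∈ Set.Icc (0 : ℝ) 1,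
      HasDerivAt ρ (fderiv ℝ F (p₀ + t • x, w₁ t) (0, ρ t) x) t := by
    intro t ht
    have h1 := hη₁ t
    have h2 := hw₁ t
    rw [hw₂ t ht, hclamp t ht] at h1 h2
    have hηt := hη₂ t ht
    rw [hclamp t ht] at hηt
    rw [hηt] at h1
    have hm := hmem ⟨t, ht⟩
    have hwt := hw₂ t ht
    rw [hclamp t ht] at hwt
    rw [hwt] at hm
    simp only at h1 h2 hm
    have h3 : HasDerivAt (fun t : ℝ => p₀ + t • x) x t := by
      simpa using ((hasDerivAt_id t).smul_const x).const_add p₀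
    have h4 := ((hF.differentiable (by simp) _).hasFDerivAt.comp_hasDerivAt t
      (h3.prodMk h2)).clm_apply (hasDerivAt_const t b)
    have h5 := h1.sub ((hasDerivAt_id t).smul h4)
    refine h5.congr_deriv ?_
    have h6 := hΩ _ hm x b
    have h7 : ((0 : P), ρ t) = (t • b, η₁ t) - t • (b, F (p₀ + t • x, w₁ t) b) := by
      simp [ρ]
    rw [h7, map_sub, map_smul, sub_apply, smul_apply,
      ← h6]
    simp
  have hzero := eq_zero_of_abs_deriv_le_mul_abs_self_of_eq_zero_right (f := ρ)
    (f' := fun t => fderiv ℝ F (p₀ + t • x, w₁ t) (0, ρ t) x) (K := K * ‖x‖) (a := 0) (b := 1)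
    (fun t ht => (hρ t ht).continuousAt.continuousWithinAt)
    (fun t ht => (hρ t (Set.Ico_subset_Icc_self ht)).hasDerivWithinAt) (by simp [ρ, η₁])
    (fun t ht => by
      have ht' := Set.Ico_subset_Icc_self ht
      have h1 : ‖fderiv ℝ F (p₀ + t • x, w₁ t)‖ ≤ K := by
        have := hK t ht'
        rwa [Function.comp_apply, hw₂ t ht', hclamp t ht'] at this
      calc _ ≤ ‖fderiv ℝ F (p₀ + t • x, w₁ t) (0, ρ t)‖ * ‖x‖ := ContinuousLinearMap.le_opNorm _ _
        _ ≤ (‖fderiv ℝ F (p₀ + t • x, w₁ t)‖ * ‖((0 : P), ρ t)‖) * ‖x‖ := by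
          gcongr
          exact ContinuousLinearMap.le_opNorm _ _
        _ ≤ (K * ‖((0 : P), ρ t)‖) * ‖x‖ := by gcongr
        _ = K * ‖x‖ * ‖ρ t‖ := by
          simp [Prod.norm_def]
          ring)
  have := hzero t t.2
  simp only [ρ] at this
  rw [← hη₂ t t.2, ← hw₂ t t.2, hclamp t t.2] at this
  exact sub_eq_zero.1 this

/-- A map that is smooth on a neighbourhood of `p₀` agrees near `p₀` with a globally smooth map. -/
lemma exists_contDiff_eqOn_ball {E G : Type*} [NormedAddCommGroup E] [NormedSpace ℝ E]
    [FiniteDimensional ℝ E] [NormedAddCommGroup G] [NormedSpace ℝ G] {f : E → G} {Ω : Set E}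
    (hΩ : IsOpen Ω) (hf : ContDiffOn ℝ ∞ f Ω) {p₀ : E} (hp₀ : p₀ ∈ Ω) :
    ∃ g : E → G, ContDiff ℝ ∞ g ∧ ∃ r > 0, Metric.ball p₀ r ⊆ Ω ∧
      ∀ p ∈ Metric.ball p₀ r, g p = f p := by
  obtain ⟨r, hr, hrΩ⟩ := Metric.nhds_basis_closedBall.mem_iff.1 (hΩ.mem_nhds hp₀)
  let χ : ContDiffBump p₀ := ⟨r / 2, r, by positivity, by linarith⟩
  refine ⟨fun p => χ p • f p, contDiff_iff_contDiffAt.2 fun p => ?_, r / 2, by positivity, ?_, ?_⟩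
  · by_cases hp : p ∈ Ω
    · exact χ.contDiff.contDiffAt.smul (hf.contDiffAt (hΩ.mem_nhds hp))
    · have h1 : p ∉ tsupport χ := by
        rw [χ.tsupport_eq]
        exact fun h => hp (hrΩ h)
      have h2 : (fun p => χ p • f p) =ᶠ[nhds p] fun _ => 0 := by
        filter_upwards [notMem_tsupport_iff_eventuallyEq.1 h1] with y hy
        simp [hy]
      exact contDiffAt_const.congr_of_eventuallyEq h2
  · exact (Metric.ball_subset_closedBall.trans (Metric.closedBall_subset_closedBall
      (by linarith))).trans hrΩ
  · intro p hp
    simp [χ.one_of_mem_closedBall (Metric.ball_subset_closedBall hp)]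

/-- Frobenius' theorem for a distribution on a product that consists of the graphs of linear maps
`F p : P → Q` and whose integrability condition is the symmetry of `DF(a, F a) b` in `a` and `b`:
there are coordinates in which it is the first factor. They are given by the solutions of the
radial equations. -/
lemma exists_straightening_graph [FiniteDimensional ℝ P] [FiniteDimensional ℝ Q]
    {F : P × Q → P →L[ℝ] Q} {Ω : Set (P × Q)} (hΩo : IsOpen Ω) (hF : ContDiffOn ℝ ∞ F Ω)
    (hΩ : ∀ p ∈ Ω, ∀ a b, fderiv ℝ F p (a, F p a) b = fderiv ℝ F p (b, F p b) a)
    {p₀ : P × Q} (hp₀ : p₀ ∈ Ω) :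
    ∃ h : OpenPartialHomeomorph (P × Q) (P × Q), p₀ ∈ h.source ∧ h.source ⊆ Ω ∧
      ContDiffOn ℝ ∞ h h.source ∧ ContDiffOn ℝ ∞ h.symm h.target ∧
      ∀ p ∈ h.source, ∀ a, fderiv ℝ h p (a, F p a) = (a, 0) := by
  have := FiniteDimensional.complete ℝ P
  have := FiniteDimensional.complete ℝ Q
  obtain ⟨F₁, hF₁, r, hr, hball, heq⟩ := exists_contDiff_eqOn_ball hΩo hF hp₀
  have hint : ∀ p ∈ Metric.ball p₀ r, ∀ a b,
      fderiv ℝ F₁ p (a, F₁ p a) b = fderiv ℝ F₁ p (b, F₁ p b) a := by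
    intro p hp a b
    have h1 : F₁ =ᶠ[nhds p] F := Filter.eventually_of_mem (Metric.isOpen_ball.mem_nhds hp) heq
    rw [h1.fderiv_eq, heq p hp]
    exact hΩ p (hball hp) a b
  obtain ⟨W, N, hN, h0, hW, hsol, hlin⟩ := exists_radialSolution hF₁ p₀.1 p₀.2
  have hW0 : ∀ c t, (0, c) ∈ N → W (0, c) t = c := by
    intro c t hc
    rw [hsol _ hc]
    simp
  let path : P × Q → C(unitInterval, (P × Q) × P) := fun q => radialLift p₀.1 (q, W q)
  have hpath : ContinuousOn path N := by
    have h1 : Continuous (radialLift (Q := Q) p₀.1) :=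
      continuous_const.add (radialLiftLinear P Q).continuous
    exact h1.comp_continuousOn (continuousOn_id.prodMk hW.continuousOn)
  let N' := N ∩ path ⁻¹' {g | Set.MapsTo g Set.univ (Metric.ball p₀ r ×ˢ Set.univ)}
  have hN' : IsOpen N' := hpath.isOpen_inter_preimage hN
    (ContinuousMap.isOpen_setOfPred_mapsTo isCompact_univ (Metric.isOpen_ball.prod isOpen_univ))
  have h0' : ((0 : P), p₀.2) ∈ N' := by
    refine ⟨h0, fun t _ => ?_⟩
    simp [path, hW0 _ _ h0, hr]
  have hmem : ∀ q ∈ N', ∀ t : unitInterval, (p₀.1 + (t : ℝ) • q.1, W q t) ∈ Metric.ball p₀ r := by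
    intro q hq t
    have := (hq.2 (Set.mem_univ t)).1
    simpa [path] using this
  let ev : C(unitInterval, Q) →L[ℝ] Q := ContinuousMap.evalCLM ℝ 1
  let f : P × Q → P × Q := fun q => (p₀.1 + q.1, ev (W q))
  have hf : ContDiffOn ℝ ∞ f N' := by
    refine ContDiffOn.prodMk (by fun_prop) ?_
    exact ev.contDiff.comp_contDiffOn (hW.mono Set.inter_subset_left)
  have hf' : ∀ q ∈ N', HasFDerivAt f ((ContinuousLinearMap.fst ℝ P Q).prod
      (ev.comp (fderiv ℝ W q))) q := by
    intro q hq
    have hWq : HasFDerivAt W (fderiv ℝ W q) q :=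
      ((hW.contDiffAt (hN.mem_nhds hq.1)).differentiableAt (by simp)).hasFDerivAt
    exact (hasFDerivAt_fst.const_add _).prodMk (ev.hasFDerivAt.comp q hWq)
  have hfball : ∀ q ∈ N', f q ∈ Metric.ball p₀ r := by
    intro q hq
    have := hmem q hq 1
    simpa [f, ev] using this
  have hpart : ∀ q ∈ N', ∀ b, fderiv ℝ W q (b, 0) 1 = F (f q) b := by
    intro q hq b
    have h1 := linearized_radialSolution_eq hF₁ hint (hmem q hq) (hsol q hq.1) (hlin q hq.1 b) 1
    rw [← heq _ (hfball q hq)]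
    simpa [f, ev] using h1
  let L : (P × Q) ≃L[ℝ] (P × Q) :=
    (ContinuousLinearEquiv.refl ℝ P).skewProd (ContinuousLinearEquiv.refl ℝ Q) (F p₀)
  have hf0 : f (0, p₀.2) = p₀ := by
    simp [f, ev, hW0 _ _ h0]
  have hL : HasFDerivAt f (L : P × Q →L[ℝ] P × Q) (0, p₀.2) := by
    have h1 := hf' _ h0'
    convert h1 using 1
    have h2 : ∀ k : Q, ev (fderiv ℝ W (0, p₀.2) (0, k)) = k := by
      intro k
      have h3 : HasFDerivAt (fun c => ev (W ((0 : P), c)))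
          ((ev.comp (fderiv ℝ W (0, p₀.2))).comp (ContinuousLinearMap.inr ℝ P Q)) p₀.2 := by
        have hWq : HasFDerivAt W (fderiv ℝ W (0, p₀.2)) (0, p₀.2) :=
          ((hW.contDiffAt (hN.mem_nhds h0)).differentiableAt (by simp)).hasFDerivAt
        exact (ev.hasFDerivAt.comp _ hWq).comp p₀.2 (hasFDerivAt_prodMk_right (0 : P) p₀.2)
      have h4 : (fun c => ev (W ((0 : P), c))) =ᶠ[nhds p₀.2] id := by
        have hc : Continuous fun c : Q => ((0 : P), c) := by fun_prop
        filter_upwards [(hN.preimage hc).mem_nhds h0] with c hcN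
        exact hW0 _ _ hcN
      have h5 := (h3.congr_of_eventuallyEq h4.symm).unique (hasFDerivAt_id p₀.2)
      simpa using congrArg (fun L => L k) h5
    have h6 := hpart _ h0'
    rw [hf0] at h6
    have h7 : ∀ b, ev (fderiv ℝ W (0, p₀.2) (b, 0)) = F p₀ b := h6
    ext k
    · simp [L]
    · simp [L, h7]
    · simp [L]
    · simp [L, h2]
  obtain ⟨Φ, hΦ, ha, hsub, hs, hsymm⟩ := exists_smooth_localInverse hN' hf h0' L hL
  refine ⟨Φ.symm, ?_, ?_, hsymm, hs, ?_⟩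
  · have := Φ.map_source ha
    rwa [hΦ, hf0] at this
  · intro p hp
    have h1 := hfball _ (hsub (Φ.map_target hp))
    rw [← hΦ, Φ.right_inv hp] at h1
    exact hball h1
  · intro p hp a
    have hp' : p ∈ Φ.target := hp
    have hq := Φ.map_target hp'
    set q := Φ.symm p with hqdef
    have hfq : f q = p := by
      rw [← hΦ]
      exact Φ.right_inv hp'
    have hd : HasFDerivAt Φ.symm (fderiv ℝ Φ.symm p) (f q) := by
      rw [hfq]
      exact ((hsymm.contDiffAt (Φ.open_target.mem_nhds hp')).differentiableAt
        (by simp)).hasFDerivAt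
    have hcomp := hd.comp q (hf' q (hsub hq))
    have hid : (Φ.symm ∘ f) =ᶠ[nhds q] id := by
      filter_upwards [Φ.open_source.mem_nhds hq] with y hy
      rw [Function.comp_apply, ← hΦ]
      exact Φ.left_inv hy
    have h5 := (hcomp.congr_of_eventuallyEq hid.symm).unique (hasFDerivAt_id q)
    have h6 := congrArg (fun L => L (a, (0 : Q))) h5
    have h7 : ev (fderiv ℝ W q (a, 0)) = F p a := by
      have := hpart q (hsub hq) a
      rwa [hfq] at this
    simpa [h7] using h6

end Graph

/-! ### Frobenius' theorem in a vector space -/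

/-- The splitting of `ℝ^{2m}` into the first `m` and the last `m` coordinates. -/
def splitModel (m : ℕ) : Model m ≃L[ℝ] (Fin m → ℝ) × (Fin m → ℝ) :=
  ((WithLp.linearEquiv 2 ℝ (Fin (2 * m) → ℝ)).trans
    ((LinearEquiv.funCongrLeft ℝ ℝ (finSumFinEquiv.trans (finCongr (two_mul m).symm))).trans
      (LinearEquiv.sumArrowLequivProdArrow (Fin m) (Fin m) ℝ ℝ))).toContinuousLinearEquiv

lemma splitModel_snd_apply {m : ℕ} (u : Model m) (k : Fin m) :
    (splitModel m u).2 k = u ⟨m + k, by omega⟩ := rfl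

lemma splitModel_snd_eq_zero_iff {m : ℕ} {u : Model m} :
    (splitModel m u).2 = 0 ↔ ∀ i : Fin (2 * m), m ≤ (i : ℕ) → u i = 0 := by
  constructor
  · intro h i hi
    have := congrFun h ⟨i - m, by omega⟩
    rw [splitModel_snd_apply, Pi.zero_apply] at this
    convert this using 2
    ext
    simp
    omega
  · intro h
    ext k
    rw [splitModel_snd_apply]
    exact h _ (by simp)

section Straightening

variable {E P Q : Type} [NormedAddCommGroup E] [NormedSpace ℝ E] [FiniteDimensional ℝ E]
  [NormedAddCommGroup P] [NormedSpace ℝ P] [FiniteDimensional ℝ P]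
  [NormedAddCommGroup Q] [NormedSpace ℝ Q] [FiniteDimensional ℝ Q]

/-- Frobenius' theorem for the distribution `z ↦ range (A z)` of constant rank. Near `z₀` the
distribution consists of the graphs of maps `G z : P → Q`, and its sections `a ↦ (a, G z a)`
commute because their brackets are sections with vanishing first component. -/
lemma exists_straightening_range {A : E → E →L[ℝ] E} {Ω : Set E} (hΩ : IsOpen Ω)
    (hA : ContDiffOn ℝ ∞ A Ω)
    (hrank : ∀ z ∈ Ω, Module.finrank ℝ (A z).range = Module.finrank ℝ P)
    (hinv : ∀ U ⊆ Ω, IsOpen U → ∀ f g : E → E, ContDiffOn ℝ ∞ f U → ContDiffOn ℝ ∞ g U →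
      ∀ z ∈ U, VectorField.lieBracket ℝ (fun z => A z (f z)) (fun z => A z (g z)) z ∈
        (A z).range)
    {z₀ : E} (hz₀ : z₀ ∈ Ω) (L : E ≃L[ℝ] P × Q) (hL : ∀ a, L.symm (a, 0) ∈ (A z₀).range) :
    ∃ h : OpenPartialHomeomorph E (P × Q), z₀ ∈ h.source ∧ h.source ⊆ Ω ∧
      ContDiffOn ℝ ∞ h h.source ∧ ContDiffOn ℝ ∞ h.symm h.target ∧
      ∀ z ∈ h.source, ∀ u, u ∈ (A z).range ↔ (fderiv ℝ h z u).2 = 0 := by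
  have := FiniteDimensional.complete ℝ P
  -- `σ` parametrizes the distribution at `z₀` by `P`
  obtain ⟨τ, hτ⟩ := (A z₀).toLinearMap.rangeRestrict.exists_rightInverse_of_surjective
    (LinearMap.range_rangeRestrict _)
  let σ₀ : P →ₗ[ℝ] E := τ ∘ₗ ((L.symm.toLinearMap ∘ₗ LinearMap.inl ℝ P Q).codRestrict _ hL)
  let σ : P →L[ℝ] E := σ₀.toContinuousLinearMap
  have hσ : ∀ a, A z₀ (σ a) = L.symm (a, 0) := by
    intro a
    have h1 := congrArg (fun f => f ⟨L.symm (a, 0), hL a⟩) hτ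
    exact congrArg Subtype.val h1
  let L₁ : E →L[ℝ] P := (ContinuousLinearMap.fst ℝ P Q).comp (L : E →L[ℝ] P × Q)
  let L₂ : E →L[ℝ] Q := (ContinuousLinearMap.snd ℝ P Q).comp (L : E →L[ℝ] P × Q)
  let B : E → P →L[ℝ] P := fun z => L₁.comp ((A z).comp σ)
  have hB : ContDiffOn ℝ ∞ B Ω :=
    contDiffOn_const.clm_comp (hA.clm_comp contDiffOn_const)
  have hB₀ : B z₀ = ContinuousLinearMap.id ℝ P := by
    ext a
    simp [B, hσ, L₁]
  let R : Set (P →L[ℝ] P) := Set.range ((↑) : (P ≃L[ℝ] P) → P →L[ℝ] P)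
  have hR : IsOpen R := ContinuousLinearEquiv.isOpen
  let Ω' := Ω ∩ B ⁻¹' R
  have hΩ' : IsOpen Ω' := hB.continuousOn.isOpen_inter_preimage hΩ hR
  have hz₀' : z₀ ∈ Ω' := ⟨hz₀, by
    rw [Set.mem_preimage, hB₀]
    exact ⟨ContinuousLinearEquiv.refl ℝ P, rfl⟩⟩
  let C : E → P →L[ℝ] P := fun z => (B z).inverse
  have hC : ContDiffOn ℝ ∞ C Ω' := by
    rintro z ⟨hz, g, hg⟩
    refine ContDiffAt.contDiffWithinAt ?_
    have h1 : ContDiffAt ℝ ∞ ContinuousLinearMap.inverse (B z) := by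
      rw [← hg]
      exact contDiffAt_map_inverse g
    exact h1.comp z (hB.contDiffAt (hΩ.mem_nhds hz))
  have hBC : ∀ z ∈ Ω', ∀ a, B z (C z a) = a := by
    rintro z ⟨-, g, hg⟩ a
    simp [C, ← hg]
  let s : P → E → E := fun a z => σ (C z a)
  have hs : ∀ a, ContDiffOn ℝ ∞ (s a) Ω' := fun a =>
    σ.contDiff.comp_contDiffOn (hC.clm_apply contDiffOn_const)
  let X : P → E → E := fun a z => A z (s a z)
  have hX : ∀ a, ContDiffOn ℝ ∞ (X a) Ω' := fun a =>
    (hA.mono Set.inter_subset_left).clm_apply (hs a)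
  let G : E → P →L[ℝ] Q := fun z => L₂.comp ((A z).comp (σ.comp (C z)))
  have hG : ContDiffOn ℝ ∞ G Ω' :=
    contDiffOn_const.clm_comp ((hA.mono Set.inter_subset_left).clm_comp
      (contDiffOn_const.clm_comp hC))
  have hXG : ∀ z ∈ Ω', ∀ a, L (X a z) = (a, G z a) := fun z hz a =>
    Prod.ext (hBC z hz a) rfl
  have hXlin : ∀ z a, X a z = (A z).comp (σ.comp (C z)) a := fun _ _ => rfl
  have hrange : ∀ z ∈ Ω', ∀ u, u ∈ (A z).range ↔ u = X (L u).1 z := by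
    intro z hz u
    have hinj : Function.Injective ((A z).comp (σ.comp (C z))) := by
      intro a b hab
      have h1 := hXG z hz a
      rw [hXlin, hab, ← hXlin, hXG z hz b] at h1
      exact (congrArg Prod.fst h1).symm
    have hle : ((A z).comp (σ.comp (C z))).range ≤ (A z).range := by
      rintro _ ⟨a, rfl⟩
      exact ⟨_, rfl⟩
    have heq := Submodule.eq_of_le_of_finrank_eq hle (by
      rw [hrank z hz.1]
      exact LinearMap.finrank_range_of_inj hinj)
    rw [← heq]
    constructor
    · rintro ⟨a, rfl⟩
      have h1 : L (((A z).comp (σ.comp (C z))) a) = (a, G z a) := hXG z hz a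
      change _ = X (L (((A z).comp (σ.comp (C z))) a)).1 z
      rw [h1]
      rfl
    · intro h
      exact ⟨(L u).1, h.symm⟩
  have hcomm : ∀ z ∈ Ω', ∀ a b, fderiv ℝ G z (X a z) b = fderiv ℝ G z (X b z) a := by
    intro z hz a b
    have hmem := hinv Ω' Set.inter_subset_left hΩ' _ _ (hs a) (hs b) z hz
    have hd : ∀ a, HasFDerivAt (X a) (fderiv ℝ (X a) z) z := fun a =>
      (((hX a).contDiffAt (hΩ'.mem_nhds hz)).differentiableAt (by simp)).hasFDerivAt
    have hdG : HasFDerivAt G (fderiv ℝ G z) z :=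
      ((hG.contDiffAt (hΩ'.mem_nhds hz)).differentiableAt (by simp)).hasFDerivAt
    have hLX : ∀ a v, L (fderiv ℝ (X a) z v) = (0, fderiv ℝ G z v a) := by
      intro a v
      have h1 : HasFDerivAt (fun z => L (X a z)) ((L : E →L[ℝ] P × Q).comp (fderiv ℝ (X a) z)) z :=
        (L : E →L[ℝ] P × Q).hasFDerivAt.comp z (hd a)
      have h2 : HasFDerivAt (fun z => (a, G z a)) _ z :=
        (hasFDerivAt_const a z).prodMk (hdG.clm_apply (hasFDerivAt_const a z))
      have h3 := h1.unique (h2.congr_of_eventuallyEq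
        (Filter.eventually_of_mem (hΩ'.mem_nhds hz) fun y hy => hXG y hy a))
      simpa using congrArg (fun f => f v) h3
    have h1 := (hrange z hz _).1 hmem
    have h2 : L (VectorField.lieBracket ℝ (X a) (X b) z) =
        (0, fderiv ℝ G z (X a z) b - fderiv ℝ G z (X b z) a) := by
      rw [VectorField.lieBracket, map_sub, hLX, hLX]
      simp
    have h3 : VectorField.lieBracket ℝ (X a) (X b) z = 0 := by
      have h4 : VectorField.lieBracket ℝ (X a) (X b) z =
        X (L (VectorField.lieBracket ℝ (X a) (X b) z)).1 z := h1
      rw [h2] at h4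
      rw [h4, hXlin, map_zero]
    rw [h3, map_zero] at h2
    exact sub_eq_zero.1 (congrArg Prod.snd h2).symm
  -- transport to `P × Q` along `L`
  let F : P × Q → P →L[ℝ] Q := fun p => G (L.symm p)
  have hF : ContDiffOn ℝ ∞ F (L.symm ⁻¹' Ω') :=
    hG.comp L.symm.contDiff.contDiffOn fun p hp => hp
  have hFint : ∀ p ∈ L.symm ⁻¹' Ω', ∀ a b,
      fderiv ℝ F p (a, F p a) b = fderiv ℝ F p (b, F p b) a := by
    intro p hp a b
    have hdG : HasFDerivAt G (fderiv ℝ G (L.symm p)) (L.symm p) :=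
      ((hG.contDiffAt (hΩ'.mem_nhds hp)).differentiableAt (by simp)).hasFDerivAt
    have h1 : fderiv ℝ F p = (fderiv ℝ G (L.symm p)).comp (L.symm : P × Q →L[ℝ] E) :=
      (hdG.comp p L.symm.hasFDerivAt).fderiv
    have h2 : ∀ a, L.symm (a, F p a) = X a (L.symm p) := by
      intro a
      rw [← hXG _ hp, L.symm_apply_apply]
    rw [h1]
    change fderiv ℝ G (L.symm p) (L.symm (a, F p a)) b = fderiv ℝ G (L.symm p) (L.symm (b, F p b)) a
    rw [h2, h2]
    exact hcomm _ hp a b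
  obtain ⟨h, hp₀, hsub, hh, hhs, hder⟩ := exists_straightening_graph
    (hΩ'.preimage L.symm.continuous) hF hFint (p₀ := L z₀) (by simpa using hz₀')
  refine ⟨L.toHomeomorph.toOpenPartialHomeomorph.trans h, by simpa using hp₀, ?_, ?_, ?_, ?_⟩
  · intro z hz
    have := hsub hz.2
    simpa using this.1
  · exact hh.comp L.contDiff.contDiffOn fun z hz => hz.2
  · exact L.symm.contDiff.comp_contDiffOn (hhs.mono fun p hp => hp.1)
  · intro z hz u
    have hz' : L z ∈ h.source := hz.2
    have hzΩ : z ∈ Ω' := by simpa using hsub hz'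
    have hd : HasFDerivAt h (fderiv ℝ h (L z)) (L z) :=
      ((hh.contDiffAt (h.open_source.mem_nhds hz')).differentiableAt (by simp)).hasFDerivAt
    have h1 : fderiv ℝ (L.toHomeomorph.toOpenPartialHomeomorph.trans h) z =
        (fderiv ℝ h (L z)).comp (L : E →L[ℝ] P × Q) := (hd.comp z L.hasFDerivAt).fderiv
    have h2 : ∀ a, fderiv ℝ h (L z) (L (X a z)) = (a, 0) := by
      intro a
      have h3 := hder _ hz' a
      rw [hXG z hzΩ]
      simpa [F] using h3
    rw [h1, hrange z hzΩ]
    change _ ↔ (fderiv ℝ h (L z) (L u)).2 = 0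
    constructor
    · intro h4
      rw [h4, h2]
    · intro h4
      have hinj : Function.Injective (fderiv ℝ h (L z)) := by
        have hds : HasFDerivAt h.symm (fderiv ℝ h.symm (h (L z))) (h (L z)) :=
          ((hhs.contDiffAt (h.open_target.mem_nhds (h.map_source hz'))).differentiableAt
            (by simp)).hasFDerivAt
        have hid : (h.symm ∘ h) =ᶠ[nhds (L z)] id :=
          Filter.eventually_of_mem (h.open_source.mem_nhds hz') fun y hy => h.left_inv hy
        have h5 := ((hds.comp (L z) hd).congr_of_eventuallyEq hid.symm).unique
          (hasFDerivAt_id (L z))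
        intro v w hvw
        have h6 := congrArg (fun f => f v) h5
        have h7 := congrArg (fun f => f w) h5
        simp only [ContinuousLinearMap.comp_apply, ContinuousLinearMap.id_apply] at h6 h7
        rw [← h6, ← h7, hvw]
      have h5 : fderiv ℝ h (L z) (L u) =
          fderiv ℝ h (L z) (L (X (fderiv ℝ h (L z) (L u)).1 z)) := by
        rw [h2]
        exact Prod.ext rfl h4
      have h6 := L.injective (hinj h5)
      have h7 : (fderiv ℝ h (L z) (L u)).1 = (L u).1 := by
        conv_rhs => rw [h6, hXG z hzΩ]
      rwa [h7] at h6

end Straightening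

/-- Frobenius' theorem in `ℝ^{2m}`: an involutive distribution of rank `m`, given as the field of
ranges of a smooth field of endomorphisms, is tangent to the slices of a coordinate system. -/
lemma exists_slice_straightening {m : ℕ} {A : Model m → Model m →L[ℝ] Model m}
    {Ω : Set (Model m)} (hΩ : IsOpen Ω) (hA : ContDiffOn ℝ ∞ A Ω)
    (hrank : ∀ z ∈ Ω, Module.finrank ℝ (A z).range = m)
    (hinv : ∀ U ⊆ Ω, IsOpen U → ∀ f g : Model m → Model m, ContDiffOn ℝ ∞ f U →
      ContDiffOn ℝ ∞ g U → ∀ z ∈ U,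
        VectorField.lieBracket ℝ (fun z => A z (f z)) (fun z => A z (g z)) z ∈ (A z).range)
    {z₀ : Model m} (hz₀ : z₀ ∈ Ω) :
    ∃ h : OpenPartialHomeomorph (Model m) (Model m), z₀ ∈ h.source ∧ h.source ⊆ Ω ∧
      ContDiffOn ℝ ∞ h h.source ∧ ContDiffOn ℝ ∞ h.symm h.target ∧
      ∀ z ∈ h.source, ∀ u, u ∈ (A z).range ↔
        ∀ i : Fin (2 * m), m ≤ (i : ℕ) → fderiv ℝ h z u i = 0 := by
  obtain ⟨D', hD'⟩ := (A z₀).range.exists_isCompl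
  have hfin : Module.finrank ℝ (Fin m → ℝ) = m := by simp
  have hD : Module.finrank ℝ (A z₀).range = m := hrank z₀ hz₀
  have hfD' : Module.finrank ℝ D' = m := by
    have h1 := Submodule.finrank_add_eq_of_isCompl hD'
    have h2 : Module.finrank ℝ (Model m) = 2 * m := by simp
    omega
  let e₁ : (A z₀).range ≃ₗ[ℝ] (Fin m → ℝ) := LinearEquiv.ofFinrankEq _ _ (by rw [hD, hfin])
  let e₂ : D' ≃ₗ[ℝ] (Fin m → ℝ) := LinearEquiv.ofFinrankEq _ _ (by rw [hfD', hfin])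
  let L : Model m ≃L[ℝ] (Fin m → ℝ) × (Fin m → ℝ) :=
    ((Submodule.prodEquivOfIsCompl _ _ hD').symm.trans
      (e₁.prodCongr e₂)).toContinuousLinearEquiv
  obtain ⟨h, h1, h2, h3, h4, h5⟩ := exists_straightening_range hΩ hA
    (fun z hz => by rw [hrank z hz, hfin]) hinv hz₀ L (fun a => by
      have : L.symm (a, 0) = e₁.symm a := by
        rw [ContinuousLinearEquiv.symm_apply_eq]
        simp [L]
      rw [this]
      exact (e₁.symm a).2)
  let S := splitModel m
  refine ⟨h.trans S.symm.toHomeomorph.toOpenPartialHomeomorph, by simpa using h1, ?_, ?_, ?_, ?_⟩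
  · intro z hz
    exact h2 hz.1
  · exact S.symm.contDiff.comp_contDiffOn (h3.mono fun z hz => hz.1)
  · refine h4.comp S.contDiff.contDiffOn fun z hz => ?_
    exact hz.2
  · intro z hz u
    have hd : HasFDerivAt h (fderiv ℝ h z) z :=
      ((h3.contDiffAt (h.open_source.mem_nhds hz.1)).differentiableAt (by simp)).hasFDerivAt
    have hd' : fderiv ℝ (h.trans S.symm.toHomeomorph.toOpenPartialHomeomorph) z =
        (S.symm : _ →L[ℝ] Model m).comp (fderiv ℝ h z) :=
      (S.symm.hasFDerivAt.comp z hd).fderiv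
    rw [h5 z hz.1, hd', ← splitModel_snd_eq_zero_iff]
    simp [S]

/-! ### Vector fields and endomorphism fields in charts -/

section Charts

variable {m : ℕ} {M : Type*} [TopologicalSpace M] [ChartedSpace (Model m) M]
  [IsManifold (𝓡 (2 * m)) ∞ M]

/-- The vector field `X` is smooth at the point `x`. -/
def SmoothFieldAt (X : ∀ x : M, Tan m x) (x : M) : Prop :=
  ContMDiffAt (𝓡 (2 * m)) (𝓡 (2 * m)).tangent ∞
    (fun x => (⟨x, X x⟩ : TangentBundle (𝓡 (2 * m)) M)) x

lemma SmoothField.smoothFieldAt {X : ∀ x : M, Tan m x} (hX : SmoothField m X) (x : M) :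
    SmoothFieldAt X x :=
  ContMDiffOn.contMDiffAt hX Filter.univ_mem

lemma smoothField_iff {X : ∀ x : M, Tan m x} : SmoothField m X ↔ ∀ x, SmoothFieldAt X x :=
  contMDiffOn_univ

lemma SmoothFieldAt.congr {X Y : ∀ x : M, Tan m x} {x : M} (hX : SmoothFieldAt X x)
    (h : Y =ᶠ[nhds x] X) : SmoothFieldAt Y x := by
  refine ContMDiffAt.congr_of_eventuallyEq hX ?_
  filter_upwards [h] with y hy
  rw [hy]

lemma SmoothFieldAt.mdifferentiableAt {X : ∀ x : M, Tan m x} {x : M} (hX : SmoothFieldAt X x) :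
    MDifferentiableAt (𝓡 (2 * m)) (𝓡 (2 * m)).tangent
      (fun x => (⟨x, X x⟩ : TangentBundle (𝓡 (2 * m)) M)) x :=
  ContMDiffAt.mdifferentiableAt hX (by simp)

lemma SmoothFieldAt.add {X Y : ∀ x : M, Tan m x} {x : M} (hX : SmoothFieldAt X x)
    (hY : SmoothFieldAt Y x) : SmoothFieldAt (fun y => X y + Y y) x :=
  ContMDiffAt.add_section hX hY

lemma SmoothFieldAt.const_smul {X : ∀ x : M, Tan m x} {x : M} (hX : SmoothFieldAt X x) (c : ℝ) :
    SmoothFieldAt (fun y => c • X y) x :=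
  ContMDiffAt.const_smul_section hX

variable (m) in
/-- The smooth charts of `M`. -/
abbrev SmoothChart (e : OpenPartialHomeomorph M (Model m)) : Prop :=
  e ∈ IsManifold.maximalAtlas (𝓡 (2 * m)) ∞ M

variable {e : OpenPartialHomeomorph M (Model m)}

lemma SmoothChart.mdifferentiable (he : SmoothChart m e) :
    e.MDifferentiable (𝓡 (2 * m)) (𝓡 (2 * m)) :=
  ⟨(contMDiffOn_of_mem_maximalAtlas he).mdifferentiableOn (by simp),
    (contMDiffOn_symm_of_mem_maximalAtlas he).mdifferentiableOn (by simp)⟩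

lemma SmoothChart.isInvertible (he : SmoothChart m e) {y : M} (hy : y ∈ e.source) :
    (mfderiv (𝓡 (2 * m)) (𝓡 (2 * m)) e y).IsInvertible :=
  ⟨he.mdifferentiable.mfderiv hy, rfl⟩

lemma SmoothChart.isInvertible_symm (he : SmoothChart m e) {z : Model m} (hz : z ∈ e.target) :
    (mfderiv (𝓡 (2 * m)) (𝓡 (2 * m)) e.symm z).IsInvertible :=
  ⟨he.mdifferentiable.symm.mfderiv hz, rfl⟩

lemma SmoothChart.inverse_mfderiv_symm (he : SmoothChart m e) {z : Model m} (hz : z ∈ e.target) :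
    (mfderiv (𝓡 (2 * m)) (𝓡 (2 * m)) e.symm z).inverse =
      mfderiv (𝓡 (2 * m)) (𝓡 (2 * m)) e (e.symm z) := by
  have h1 := he.mdifferentiable.comp_symm_deriv hz
  obtain ⟨g, hg⟩ := he.isInvertible_symm hz
  rw [← hg] at h1 ⊢
  rw [ContinuousLinearMap.inverse_equiv]
  ext v
  have := congrArg (fun f => f (g.symm v)) h1
  exact ((ContinuousLinearMap.comp_apply _ _ _).symm.trans this).symm.trans (congrArg _
    (g.apply_symm_apply v))

/-- The differential of a smooth chart as a linear equivalence. -/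
def SmoothChart.diffEquiv (he : SmoothChart m e) {y : M} (hy : y ∈ e.source) :
    Tan m y ≃ₗ[ℝ] Model m :=
  (he.mdifferentiable.mfderiv hy).toLinearEquiv

lemma SmoothChart.diffEquiv_apply (he : SmoothChart m e) {y : M} (hy : y ∈ e.source)
    (u : Tan m y) : he.diffEquiv hy u = chartDiff m e y u := rfl

lemma SmoothChart.inverse_apply (he : SmoothChart m e) {y : M} (hy : y ∈ e.source) (v : Model m) :
    (mfderiv (𝓡 (2 * m)) (𝓡 (2 * m)) e y).inverse v = (he.diffEquiv hy).symm v := by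
  have : mfderiv (𝓡 (2 * m)) (𝓡 (2 * m)) e y = (he.mdifferentiable.mfderiv hy : _ →L[ℝ] _) := rfl
  rw [this, ContinuousLinearMap.inverse_equiv]
  rfl

/-- The vector field `X` in the chart `e`. -/
def rep (e : OpenPartialHomeomorph M (Model m)) (X : ∀ x : M, Tan m x) : Model m → Model m :=
  fun z => chartDiff m e (e.symm z) (X (e.symm z))

/-- The vector field on `M` given in the chart `e` by `v`. -/
def liftField (e : OpenPartialHomeomorph M (Model m)) (v : Model m → Model m) (x : M) : Tan m x :=
  (mfderiv (𝓡 (2 * m)) (𝓡 (2 * m)) e x).inverse (v (e x))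

lemma rep_apply {X : ∀ x : M, Tan m x} {y : M} (hy : y ∈ e.source) :
    rep e X (e y) = chartDiff m e y (X y) := by
  rw [rep, e.left_inv hy]

lemma SmoothChart.liftField_apply (he : SmoothChart m e) {y : M} (hy : y ∈ e.source)
    (v : Model m → Model m) : liftField e v y = (he.diffEquiv hy).symm (v (e y)) :=
  he.inverse_apply hy _

lemma SmoothChart.chartDiff_liftField (he : SmoothChart m e) {y : M} (hy : y ∈ e.source)
    (v : Model m → Model m) : chartDiff m e y (liftField e v y) = v (e y) := by
  rw [he.liftField_apply hy, ← he.diffEquiv_apply hy, LinearEquiv.apply_symm_apply]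

lemma SmoothChart.rep_liftField (he : SmoothChart m e) {z : Model m} (hz : z ∈ e.target)
    (v : Model m → Model m) : rep e (liftField e v) z = v z := by
  rw [rep, he.chartDiff_liftField (e.map_target hz), e.right_inv hz]

lemma SmoothChart.rep_eq_mpullback (he : SmoothChart m e) {z : Model m} (hz : z ∈ e.target)
    (X : ∀ x : M, Tan m x) :
    VectorField.mpullback (𝓡 (2 * m)) (𝓡 (2 * m)) e.symm X z = rep e X z := by
  rw [VectorField.mpullback_apply, he.inverse_mfderiv_symm hz]
  rfl

lemma SmoothChart.liftField_rep (he : SmoothChart m e) {y : M} (hy : y ∈ e.source)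
    (X : ∀ x : M, Tan m x) : liftField e (rep e X) y = X y := by
  rw [he.liftField_apply hy, rep_apply hy, ← he.diffEquiv_apply hy, LinearEquiv.symm_apply_apply]

lemma SmoothChart.smoothFieldAt_liftField (he : SmoothChart m e) {y : M} (hy : y ∈ e.source)
    {v : Model m → Model m} (hv : ContDiffAt ℝ ∞ v (e y)) : SmoothFieldAt (liftField e v) y := by
  have h1 : ContMDiffAt (𝓡 (2 * m)) (𝓡 (2 * m)).tangent ∞
      (fun z => (⟨z, v z⟩ : TangentBundle (𝓡 (2 * m)) (Model m))) (e y) :=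
    contMDiffAt_vectorSpace_iff_contDiffAt.2 hv
  exact ContMDiffAt.mpullback_vectorField_preimage h1
    (contMDiffAt_of_mem_maximalAtlas he hy) (he.isInvertible hy) (by simp)

lemma SmoothChart.smoothFieldAt_iff (he : SmoothChart m e) {y : M} (hy : y ∈ e.source)
    {X : ∀ x : M, Tan m x} : SmoothFieldAt X y ↔ ContDiffAt ℝ ∞ (rep e X) (e y) := by
  constructor
  · intro hX
    have hz := e.map_source hy
    have hX' : SmoothFieldAt X (e.symm (e y)) := by rwa [e.left_inv hy]
    have h1 := ContMDiffAt.mpullback_vectorField_preimage hX'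
      (contMDiffAt_symm_of_mem_maximalAtlas he hz) (he.isInvertible_symm hz) (m := ∞) (by simp)
    have h2 := contMDiffAt_vectorSpace_iff_contDiffAt.1 h1
    exact h2.congr_of_eventuallyEq (Filter.eventually_of_mem (e.open_target.mem_nhds hz)
      fun z hz => (he.rep_eq_mpullback hz X).symm)
  · intro h
    exact (he.smoothFieldAt_liftField hy h).congr
      (Filter.eventually_of_mem (e.open_source.mem_nhds hy)
        fun z hz => (he.liftField_rep hz X).symm)

lemma mlieBracket_eq_lieBracket {E : Type*} [NormedAddCommGroup E] [NormedSpace ℝ E]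
    (V W : ∀ x : E, TangentSpace 𝓘(ℝ, E) x) (x : E) :
    VectorField.mlieBracket 𝓘(ℝ, E) V W x = VectorField.lieBracket ℝ V W x := by
  have := congrFun (VectorField.mlieBracketWithin_eq_lieBracketWithin (𝕜 := ℝ) (V := V) (W := W)
    (s := Set.univ)) x
  rw [VectorField.mlieBracketWithin_univ] at this
  exact this.trans (congrFun (VectorField.lieBracketWithin_univ (𝕜 := ℝ) (V := V) (W := W)) x)

lemma SmoothChart.rep_bracket (he : SmoothChart m e) {z : Model m} (hz : z ∈ e.target)
    {X Y : ∀ x : M, Tan m x} (hX : SmoothFieldAt X (e.symm z)) (hY : SmoothFieldAt Y (e.symm z)) :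
    rep e (bracket m X Y) z = VectorField.lieBracket ℝ (rep e X) (rep e Y) z := by
  have : IsManifold (𝓡 (2 * m)) (minSmoothness ℝ 2) M := by
    rw [minSmoothness_of_isRCLikeNormedField]
    infer_instance
  have : IsManifold (𝓡 (2 * m)) (minSmoothness ℝ 2) (Model m) := by
    rw [minSmoothness_of_isRCLikeNormedField]
    infer_instance
  have h1 := VectorField.mpullback_mlieBracket hX.mdifferentiableAt hY.mdifferentiableAt
    (contMDiffAt_symm_of_mem_maximalAtlas he hz) (n := ∞)
    (by rw [minSmoothness_of_isRCLikeNormedField]; exact ENat.LEInfty.out)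
  have hev : ∀ X : ∀ x : M, Tan m x,
      VectorField.mpullback (𝓡 (2 * m)) (𝓡 (2 * m)) e.symm X =ᶠ[nhds z] rep e X := fun X =>
    Filter.eventually_of_mem (e.open_target.mem_nhds hz) fun z hz => he.rep_eq_mpullback hz X
  rw [(hev X).mlieBracket_vectorField_eq (hev Y), he.rep_eq_mpullback hz] at h1
  have h2 : VectorField.mlieBracket (𝓡 (2 * m)) (rep e X) (rep e Y) z =
      VectorField.lieBracket ℝ (rep e X) (rep e Y) z := mlieBracket_eq_lieBracket _ _ z
  exact h1.trans h2

/-- A vector field that is smooth near `x` agrees near `x` with a smooth vector field. -/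
lemma exists_smoothField_eventuallyEq [T2Space M] {X : ∀ x : M, Tan m x} {U : Set M}
    (hU : IsOpen U) (hX : ∀ y ∈ U, SmoothFieldAt X y) {x : M} (hx : x ∈ U) :
    ∃ Y : ∀ x : M, Tan m x, SmoothField m Y ∧ Y =ᶠ[nhds x] X := by
  obtain ⟨f, -, hf⟩ := (SmoothBumpFunction.nhds_basis_tsupport (I := 𝓡 (2 * m)) x).mem_iff.1
    (hU.mem_nhds hx)
  refine ⟨fun y => f y • X y, smoothField_iff.2 fun y => ?_, ?_⟩
  · by_cases hy : y ∈ U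
    · exact ContMDiffAt.smul_section f.contMDiffAt (hX y hy)
    · have h0 : SmoothFieldAt (fun y : M => (0 : Tan m y)) y :=
        (Bundle.contMDiff_zeroSection ℝ (fun y : M => Tan m y)).contMDiffAt
      refine h0.congr ?_
      filter_upwards [notMem_tsupport_iff_eventuallyEq.1 fun h => hy (hf h)] with z hz
      rw [hz]
      exact zero_smul ℝ (X z)
  · filter_upwards [f.eventuallyEq_one] with y hy
    rw [hy]
    exact one_smul ℝ (X y)

lemma SmoothChart.exists_smoothField_rep [T2Space M] (he : SmoothChart m e)
    {U : Set (Model m)} (hU : IsOpen U) (hUe : U ⊆ e.target) {v : Model m → Model m}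
    (hv : ContDiffOn ℝ ∞ v U) {z : Model m} (hz : z ∈ U) :
    ∃ X : ∀ x : M, Tan m x, SmoothField m X ∧ rep e X =ᶠ[nhds z] v := by
  have hV : IsOpen (e.source ∩ e ⁻¹' U) := e.isOpen_inter_preimage hU
  obtain ⟨X, hX, hXe⟩ := exists_smoothField_eventuallyEq hV (X := liftField e v)
    (fun y hy => he.smoothFieldAt_liftField hy.1 (hv.contDiffAt (hU.mem_nhds hy.2)))
    (x := e.symm z) ⟨e.map_target (hUe hz), by simpa [e.right_inv (hUe hz)] using hz⟩
  refine ⟨X, hX, ?_⟩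
  have hc : Filter.Tendsto e.symm (nhds z) (nhds (e.symm z)) :=
    e.symm.continuousAt (hUe hz)
  filter_upwards [hc.eventually hXe, hU.mem_nhds hz] with y hy hyU
  rw [rep, hy]
  exact he.rep_liftField (hUe hyU) v

/-- The endomorphism field `A` in the chart `e`. -/
def repEnd (e : OpenPartialHomeomorph M (Model m)) (A : ∀ x : M, Module.End ℝ (Tan m x))
    (z : Model m) : Model m →L[ℝ] Model m :=
  LinearMap.toContinuousLinearMap (chartDiff m e (e.symm z) ∘ₗ A (e.symm z) ∘ₗ
    (mfderiv (𝓡 (2 * m)) (𝓡 (2 * m)) e (e.symm z)).inverse.toLinearMap)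

lemma SmoothChart.repEnd_apply (he : SmoothChart m e) {z : Model m} (hz : z ∈ e.target)
    (A : ∀ x : M, Module.End ℝ (Tan m x)) (v : Model m) :
    repEnd e A z v = he.diffEquiv (e.map_target hz)
      (A (e.symm z) ((he.diffEquiv (e.map_target hz)).symm v)) := by
  rw [← he.inverse_apply]
  rfl

lemma SmoothChart.rep_apply_end (he : SmoothChart m e) {z : Model m} (hz : z ∈ e.target)
    (A : ∀ x : M, Module.End ℝ (Tan m x)) (X : ∀ x : M, Tan m x) :
    rep e (fun x => A x (X x)) z = repEnd e A z (rep e X z) := by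
  rw [he.repEnd_apply hz, rep, rep, ← he.diffEquiv_apply (e.map_target hz),
    ← he.diffEquiv_apply (e.map_target hz), LinearEquiv.symm_apply_apply]

lemma SmoothChart.contDiffOn_repEnd [T2Space M] (he : SmoothChart m e)
    {A : ∀ x : M, Module.End ℝ (Tan m x)} (hA : SmoothEnd A) :
    ContDiffOn ℝ ∞ (repEnd e A) e.target := by
  refine contDiffOn_clm_apply.2 fun v z hz => ContDiffAt.contDiffWithinAt ?_
  obtain ⟨X, hX, hXv⟩ := he.exists_smoothField_rep e.open_target subset_rfl
    (contDiffOn_const (c := v)) hz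
  have h1 := (he.smoothFieldAt_iff (e.map_target hz)).1 ((hA X hX).smoothFieldAt _)
  rw [e.right_inv hz] at h1
  refine h1.congr_of_eventuallyEq ?_
  filter_upwards [hXv, e.open_target.mem_nhds hz] with y hy hyt
  rw [he.rep_apply_end hyt, hy]

lemma SmoothChart.smoothFieldAt_end (he : SmoothChart m e) {y : M} (hy : y ∈ e.source)
    {A : ∀ x : M, Module.End ℝ (Tan m x)} (hA : ContDiffAt ℝ ∞ (repEnd e A) (e y))
    {X : ∀ x : M, Tan m x} (hX : SmoothFieldAt X y) : SmoothFieldAt (fun x => A x (X x)) y := by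
  rw [he.smoothFieldAt_iff hy] at hX ⊢
  refine (hA.clm_apply hX).congr_of_eventuallyEq ?_
  filter_upwards [e.open_target.mem_nhds (e.map_source hy)] with z hz
  exact he.rep_apply_end hz A X

lemma smoothChart_chartAt (x : M) : SmoothChart m (chartAt (Model m) x) :=
  IsManifold.chart_mem_maximalAtlas x

/-- A smooth field of endomorphisms maps locally smooth fields to locally smooth fields. -/
lemma SmoothEnd.smoothFieldAt [T2Space M] {A : ∀ x : M, Module.End ℝ (Tan m x)}
    (hA : SmoothEnd A) {X : ∀ x : M, Tan m x} {y : M} (hX : SmoothFieldAt X y) :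
    SmoothFieldAt (fun x => A x (X x)) y := by
  have he := smoothChart_chartAt (m := m) y
  have hy := mem_chart_source (Model m) y
  exact he.smoothFieldAt_end hy ((he.contDiffOn_repEnd hA).contDiffAt
    ((chartAt (Model m) y).open_target.mem_nhds ((chartAt (Model m) y).map_source hy))) hX

lemma smoothEnd_of_charts {A : ∀ x : M, Module.End ℝ (Tan m x)}
    (hA : ∀ x : M, ∃ e : OpenPartialHomeomorph M (Model m), SmoothChart m e ∧ x ∈ e.source ∧
      ContDiffAt ℝ ∞ (repEnd e A) (e x)) : SmoothEnd A := by
  intro X hX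
  refine smoothField_iff.2 fun x => ?_
  obtain ⟨e, he, hx, hA⟩ := hA x
  exact he.smoothFieldAt_end hx hA (hX.smoothFieldAt x)

end Charts

/-! ### Foliations and involutive distributions -/

section Foliations

variable {m : ℕ} {M : Type*} [TopologicalSpace M] [ChartedSpace (Model m) M]
  [IsManifold (𝓡 (2 * m)) ∞ M]

lemma mem_sliceSpace_iff {e : OpenPartialHomeomorph M (Model m)} {x : M} {u : Tan m x} :
    u ∈ sliceSpace m e x ↔ (splitModel m (chartDiff m e x u)).2 = 0 :=
  splitModel_snd_eq_zero_iff.symm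

lemma mem_contDiffGroupoid_of_contDiffOn {h : OpenPartialHomeomorph (Model m) (Model m)}
    (h₁ : ContDiffOn ℝ ∞ h h.source) (h₂ : ContDiffOn ℝ ∞ h.symm h.target) :
    h ∈ contDiffGroupoid ∞ (𝓡 (2 * m)) := by
  rw [contDiffGroupoid, mem_groupoid_of_pregroupoid]
  simpa [contDiffPregroupoid] using And.intro h₁ h₂

lemma SmoothChart.trans {e : OpenPartialHomeomorph M (Model m)} (he : SmoothChart m e)
    {h : OpenPartialHomeomorph (Model m) (Model m)}
    (h₁ : ContDiffOn ℝ ∞ h h.source) (h₂ : ContDiffOn ℝ ∞ h.symm h.target) :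
    SmoothChart m (e.trans h) := by
  intro e' he'
  have hh := mem_contDiffGroupoid_of_contDiffOn h₁ h₂
  have hG := he e' he'
  constructor
  · rw [OpenPartialHomeomorph.trans_symm_eq_symm_trans_symm, OpenPartialHomeomorph.trans_assoc]
    exact StructureGroupoid.trans _ (StructureGroupoid.symm _ hh) hG.1
  · rw [← OpenPartialHomeomorph.trans_assoc]
    exact StructureGroupoid.trans _ hG.2 hh

lemma SmoothChart.contDiffOn_symm_trans {e e' : OpenPartialHomeomorph M (Model m)}
    (he : SmoothChart m e) (he' : SmoothChart m e') :
    ContDiffOn ℝ ∞ (e' ∘ e.symm) (e.symm.trans e').source := by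
  have h1 := StructureGroupoid.compatible_of_mem_maximalAtlas he he'
  rw [contDiffGroupoid, mem_groupoid_of_pregroupoid] at h1
  simpa [contDiffPregroupoid] using h1.1

lemma SmoothChart.chartDiff_symm_trans {e e' : OpenPartialHomeomorph M (Model m)}
    (he : SmoothChart m e) (he' : SmoothChart m e') {y : M} (hy : y ∈ e.source)
    (hy' : y ∈ e'.source) (u : Tan m y) :
    fderiv ℝ (e' ∘ e.symm) (e y) (chartDiff m e y u) = chartDiff m e' y u := by
  have hz : e y ∈ (e.symm.trans e').source := by
    rw [OpenPartialHomeomorph.trans_source]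
    exact ⟨e.map_source hy, by simpa [e.left_inv hy] using hy'⟩
  have h1 : MDifferentiableAt (𝓡 (2 * m)) (𝓡 (2 * m)) (e' ∘ e.symm) (e y) :=
    (((he.contDiffOn_symm_trans he').contDiffAt ((e.symm.trans e').open_source.mem_nhds
      hz)).differentiableAt (by simp)).mdifferentiableAt
  have h2 := mfderiv_comp y h1 (he.mdifferentiable.mdifferentiableAt hy)
  rw [mfderiv_eq_fderiv] at h2
  have h3 : mfderiv (𝓡 (2 * m)) (𝓡 (2 * m)) ((e' ∘ e.symm) ∘ e) y =
      mfderiv (𝓡 (2 * m)) (𝓡 (2 * m)) e' y := by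
    refine Filter.EventuallyEq.mfderiv_eq
      (Filter.eventually_of_mem (e.open_source.mem_nhds hy) fun x hx => ?_)
    simp [e.left_inv hx]
  have h4 := congrArg (fun f => f u) (h2.symm.trans h3)
  exact h4

lemma SmoothChart.chartDiff_trans {e : OpenPartialHomeomorph M (Model m)} (he : SmoothChart m e)
    {h : OpenPartialHomeomorph (Model m) (Model m)} (h₁ : ContDiffOn ℝ ∞ h h.source) {y : M}
    (hy : y ∈ (e.trans h).source) (u : Tan m y) :
    chartDiff m (e.trans h) y u = fderiv ℝ h (e y) (chartDiff m e y u) := by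
  rw [OpenPartialHomeomorph.trans_source] at hy
  have h1 : MDifferentiableAt (𝓡 (2 * m)) (𝓡 (2 * m)) h (e y) :=
    ((h₁.contDiffAt (h.open_source.mem_nhds hy.2)).differentiableAt (by simp)).mdifferentiableAt
  have h2 := mfderiv_comp y h1 (he.mdifferentiable.mdifferentiableAt hy.1)
  rw [mfderiv_eq_fderiv] at h2
  exact congrArg (fun f => f u) h2

/-- Frobenius' theorem: if the ranges of a smooth field `A` of endomorphisms form an involutive
distribution of rank `m`, then this distribution is a foliation. -/
theorem exists_foliation_tangent_eq_range [T2Space M] {A : ∀ x : M, Module.End ℝ (Tan m x)}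
    (hA : SmoothEnd A) (hrank : ∀ x, Module.finrank ℝ (A x).range = m)
    (hinv : ∀ X Y : ∀ x : M, Tan m x, SmoothField m X → SmoothField m Y → ∀ x : M,
      bracket m (fun y => A y (X y)) (fun y => A y (Y y)) x ∈ (A x).range) :
    ∃ F : WebFoliation m M, ∀ x, F.tangent x = (A x).range := by
  refine ⟨⟨fun x => (A x).range, fun x => ?_⟩, fun x => rfl⟩
  set e := chartAt (Model m) x
  have he : SmoothChart m e := smoothChart_chartAt x
  have hx : x ∈ e.source := mem_chart_source _ x
  have hmem : ∀ z (hz : z ∈ e.target), ∀ u : Tan m (e.symm z),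
      he.diffEquiv (e.map_target hz) u ∈ (repEnd e A z).range ↔ u ∈ (A (e.symm z)).range := by
    intro z hz u
    constructor
    · rintro ⟨v, hv⟩
      have hv' : repEnd e A z v = he.diffEquiv (e.map_target hz) u := hv
      rw [he.repEnd_apply hz] at hv'
      exact ⟨_, (he.diffEquiv (e.map_target hz)).injective hv'⟩
    · rintro ⟨v, rfl⟩
      refine ⟨he.diffEquiv (e.map_target hz) v, ?_⟩
      change repEnd e A z _ = _
      rw [he.repEnd_apply hz, LinearEquiv.symm_apply_apply]
  obtain ⟨h, hx₀, hsub, h₁, h₂, hker⟩ := exists_slice_straightening e.open_target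
    (he.contDiffOn_repEnd hA) (fun z hz => by
      refine Eq.trans ?_ (hrank (e.symm z))
      have : (repEnd e A z).range =
          (A (e.symm z)).range.map (he.diffEquiv (e.map_target hz)).toLinearMap := by
        ext v
        obtain ⟨u, rfl⟩ := (he.diffEquiv (e.map_target hz)).surjective v
        rw [hmem z hz]
        simp
      rw [this]
      exact LinearEquiv.finrank_map_eq _ _)
    (fun U hU hUo f g hf hg z hz => by
      obtain ⟨X, hX, hXf⟩ := he.exists_smoothField_rep hUo hU hf hz
      obtain ⟨Y, hY, hYg⟩ := he.exists_smoothField_rep hUo hU hg hz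
      have hzt := hU hz
      have hev : ∀ {X : ∀ x : M, Tan m x} {f : Model m → Model m}, rep e X =ᶠ[nhds z] f →
          (fun z => repEnd e A z (f z)) =ᶠ[nhds z] rep e (fun x => A x (X x)) := by
        intro X f hXf
        filter_upwards [hXf, e.open_target.mem_nhds hzt] with y hy hyt
        rw [he.rep_apply_end hyt, hy]
      rw [Filter.EventuallyEq.lieBracket_vectorField_eq (hev hXf) (hev hYg),
        ← he.rep_bracket hzt ((hA X hX).smoothFieldAt _) ((hA Y hY).smoothFieldAt _)]
      exact (hmem z hzt _).2 (hinv X Y hX hY _))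
    (e.map_source hx)
  refine ⟨e.trans h, he.trans h₁ h₂, ⟨hx, hx₀⟩, fun y hy => ?_⟩
  have hy' : y ∈ e.source ∧ e y ∈ h.source := by
    simpa [OpenPartialHomeomorph.trans_source] using hy
  ext u
  have h3 := hker (e y) hy'.2 (chartDiff m e y u)
  have h4 : chartDiff m e y u ∈ (repEnd e A (e y)).range ↔ u ∈ (A y).range := by
    have h5 := hmem (e y) (e.map_source hy'.1)
    have key : ∀ y' (hy' : y' = y), (∀ u : Tan m y', chartDiff m e y' u ∈
        (repEnd e A (e y)).range ↔ u ∈ (A y').range) → ∀ u : Tan m y, chartDiff m e y u ∈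
        (repEnd e A (e y)).range ↔ u ∈ (A y).range := by
      rintro y' rfl h
      exact h
    exact key _ (e.left_inv hy'.1) h5 u
  rw [← h4, h3]
  change _ ↔ ∀ i : Fin (2 * m), m ≤ (i : ℕ) → chartDiff m (e.trans h) y u i = 0
  rw [he.chartDiff_trans h₁ hy]

/-- The tangent distribution of a foliation is involutive. -/
lemma WebFoliation.bracket_mem (F : WebFoliation m M) {X Y : ∀ x : M, Tan m x}
    (hX : SmoothField m X) (hY : SmoothField m Y) (hXF : ∀ x, X x ∈ F.tangent x)
    (hYF : ∀ x, Y x ∈ F.tangent x) (x : M) : bracket m X Y x ∈ F.tangent x := by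
  obtain ⟨e, he, hx, htan⟩ := F.exists_chart x
  have he : SmoothChart m e := he
  have hz := e.map_source hx
  -- in a slice chart the last coordinates of both fields vanish identically
  let p : Model m →L[ℝ] (Fin m → ℝ) :=
    (ContinuousLinearMap.snd ℝ (Fin m → ℝ) (Fin m → ℝ)).comp (splitModel m : Model m →L[ℝ] _)
  have hp : ∀ y ∈ e.source, ∀ u : Tan m y, u ∈ F.tangent y ↔ p (chartDiff m e y u) = 0 := by
    intro y hy u
    rw [htan y hy]
    exact mem_sliceSpace_iff
  have hzero : ∀ {X : ∀ x : M, Tan m x}, SmoothField m X → (∀ x, X x ∈ F.tangent x) → ∀ v,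
      p (fderiv ℝ (rep e X) (e x) v) = 0 := by
    intro X hX hXF v
    have h1 : HasFDerivAt (rep e X) (fderiv ℝ (rep e X) (e x)) (e x) :=
      (((he.smoothFieldAt_iff hx).1 (hX.smoothFieldAt x)).differentiableAt (by simp)).hasFDerivAt
    have h2 := p.hasFDerivAt.comp (e x) h1
    have h3 : p ∘ rep e X =ᶠ[nhds (e x)] fun _ => 0 :=
      Filter.eventually_of_mem (e.open_target.mem_nhds hz) fun z hz =>
        (hp _ (e.map_target hz) _).1 (hXF _)
    have h4 := h2.unique ((hasFDerivAt_const (0 : Fin m → ℝ) (e x)).congr_of_eventuallyEq h3)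
    exact congrArg (fun f => f v) h4
  have hb := he.rep_bracket hz (X := X) (Y := Y) (hX.smoothFieldAt _) (hY.smoothFieldAt _)
  rw [rep_apply hx] at hb
  rw [hp x hx, hb, VectorField.lieBracket, map_sub, hzero hX hXF, hzero hY hYF, sub_zero]

/-- The projections defined by two transversal foliations are smooth: both tangent distributions
are kernels of differentials of coordinate functions. -/
lemma smoothEnd_projection [T2Space M] (F G : WebFoliation m M)
    (h : ∀ x, IsCompl (F.tangent x) (G.tangent x)) :
    SmoothEnd fun x => (F.tangent x).projection (G.tangent x) (h x) := by
  refine smoothEnd_of_charts fun x => ?_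
  obtain ⟨e, he, hx, hF⟩ := F.exists_chart x
  obtain ⟨e', he', hx', hG⟩ := G.exists_chart x
  have he : SmoothChart m e := he
  have he' : SmoothChart m e' := he'
  refine ⟨e, he, hx, ?_⟩
  let V := Fin m → ℝ
  let p : Model m →L[ℝ] V := (ContinuousLinearMap.snd ℝ V V).comp (splitModel m : Model m →L[ℝ] _)
  let Ψ : Model m → Model m →L[ℝ] V × V := fun z => p.prod (p.comp (fderiv ℝ (e' ∘ e.symm) z))
  let T := (e.symm.trans e').source
  have hT : IsOpen T := (e.symm.trans e').open_source
  have hxT : e x ∈ T := by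
    rw [show T = _ from OpenPartialHomeomorph.trans_source _ _]
    exact ⟨e.map_source hx, by simpa [e.left_inv hx] using hx'⟩
  have hΨ : ContDiffOn ℝ ∞ Ψ T := by
    have h1 : ContDiffOn ℝ ∞ (fderiv ℝ (e' ∘ e.symm)) T :=
      (he.contDiffOn_symm_trans he').fderiv_of_isOpen hT (by simp)
    have h2 : ContDiffOn ℝ ∞ (fun z => (ContinuousLinearMap.inl ℝ V V).comp p +
        (ContinuousLinearMap.inr ℝ V V).comp (p.comp (fderiv ℝ (e' ∘ e.symm) z))) T :=
      contDiffOn_const.add (contDiffOn_const.clm_comp (contDiffOn_const.clm_comp h1))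
    refine h2.congr fun z hz => ?_
    ext1 v
    simp [Ψ]
  have hTt : ∀ z ∈ T, z ∈ e.target ∧ e.symm z ∈ e'.source := by
    intro z hz
    rw [show T = _ from OpenPartialHomeomorph.trans_source _ _] at hz
    exact hz
  have hΨe : ∀ z ∈ T, ∀ u : Tan m (e.symm z), Ψ z (chartDiff m e (e.symm z) u) =
      (p (chartDiff m e (e.symm z) u), p (chartDiff m e' (e.symm z) u)) := by
    intro z hz u
    have h1 := he.chartDiff_symm_trans he' (e.map_target (hTt z hz).1) (hTt z hz).2 u
    rw [e.right_inv (hTt z hz).1] at h1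
    rw [← h1]
    rfl
  have hFm : ∀ z ∈ T, ∀ u : Tan m (e.symm z), u ∈ F.tangent (e.symm z) ↔
      p (chartDiff m e (e.symm z) u) = 0 := by
    intro z hz u
    rw [hF _ (e.map_target (hTt z hz).1)]
    exact mem_sliceSpace_iff
  have hGm : ∀ z ∈ T, ∀ u : Tan m (e.symm z), u ∈ G.tangent (e.symm z) ↔
      p (chartDiff m e' (e.symm z) u) = 0 := by
    intro z hz u
    rw [hG _ (hTt z hz).2]
    exact mem_sliceSpace_iff
  have hinj : ∀ z ∈ T, Function.Injective (Ψ z) := by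
    intro z hz
    rw [injective_iff_map_eq_zero]
    intro v hv
    obtain ⟨u, rfl⟩ := (he.diffEquiv (e.map_target (hTt z hz).1)).surjective v
    rw [he.diffEquiv_apply, hΨe z hz] at hv
    have h1 := (hFm z hz u).2 (congrArg Prod.fst hv)
    have h2 := (hGm z hz u).2 (congrArg Prod.snd hv)
    have h3 : u = 0 := (Submodule.disjoint_def.1 (h (e.symm z)).disjoint) u h1 h2
    rw [h3, map_zero]
  have hequiv : ∀ z ∈ T, ∃ g : Model m ≃L[ℝ] V × V, (g : Model m →L[ℝ] V × V) = Ψ z := by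
    intro z hz
    have hfr : Module.finrank ℝ (Model m) = Module.finrank ℝ (V × V) :=
      (splitModel m).toLinearEquiv.finrank_eq
    exact ⟨(LinearEquiv.ofInjectiveOfFinrankEq (Ψ z).toLinearMap (hinj z hz)
      hfr).toContinuousLinearEquiv, by ext <;> rfl⟩
  have hinv : ContDiffAt ℝ ∞ (fun z => (Ψ z).inverse) (e x) := by
    obtain ⟨g, hg⟩ := hequiv _ hxT
    have h1 : ContDiffAt ℝ ∞ ContinuousLinearMap.inverse (Ψ (e x)) := by
      rw [← hg]
      exact contDiffAt_map_inverse g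
    exact h1.comp _ (hΨ.contDiffAt (hT.mem_nhds hxT))
  let q : V × V →L[ℝ] V × V :=
    (ContinuousLinearMap.inr ℝ V V).comp (ContinuousLinearMap.snd ℝ V V)
  have hsm : ContDiffAt ℝ ∞ (fun z => (Ψ z).inverse.comp (q.comp (Ψ z))) (e x) :=
    hinv.clm_comp (contDiffAt_const.clm_comp (hΨ.contDiffAt (hT.mem_nhds hxT)))
  refine hsm.congr_of_eventuallyEq (Filter.eventually_of_mem (hT.mem_nhds hxT) fun z hz => ?_)
  obtain ⟨g, hg⟩ := hequiv z hz
  ext1 v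
  obtain ⟨u, rfl⟩ := (he.diffEquiv (e.map_target (hTt z hz).1)).surjective v
  rw [he.repEnd_apply (hTt z hz).1, LinearEquiv.symm_apply_apply]
  set w := (F.tangent (e.symm z)).projection (G.tangent (e.symm z)) (h (e.symm z)) u with hw
  have hwF : w ∈ F.tangent (e.symm z) := Submodule.projection_apply_mem _ u
  have hwG : w - u ∈ G.tangent (e.symm z) := by
    refine (Submodule.projection_apply_eq_zero_iff (h (e.symm z))).1 ?_
    rw [map_sub, sub_eq_zero]
    exact Submodule.projection_apply_of_mem_left _ hwF
  have h1 : Ψ z (he.diffEquiv (e.map_target (hTt z hz).1) w) =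
      q (Ψ z (he.diffEquiv (e.map_target (hTt z hz).1) u)) := by
    rw [he.diffEquiv_apply, he.diffEquiv_apply, hΨe z hz, hΨe z hz, (hFm z hz w).1 hwF]
    have h2 := (hGm z hz _).1 hwG
    rw [map_sub, map_sub, sub_eq_zero] at h2
    rw [h2]
    rfl
  simp only [ContinuousLinearMap.comp_apply]
  rw [← h1, ← hg, ContinuousLinearMap.inverse_equiv]
  exact (g.symm_apply_apply _).symm

end Foliations

/-! ### The algebra of a 3-web -/

/-- The algebraic structure that a 3-web defines on the space `V` of vector fields: the bracket,
the projections `v`, `h` onto the fields tangent to the first and to the second foliation, and the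
involution `j` that exchanges these two kinds of fields. Only the antisymmetry of the bracket and
the involutivity of the two distributions are used. -/
structure WebAlgebra (V : Type*) [AddCommGroup V] [Module ℝ V] where
  /-- the bracket -/
  br : V →ₗ[ℝ] V →ₗ[ℝ] V
  /-- the projection onto the fields tangent to the first foliation -/
  v : V →ₗ[ℝ] V
  /-- the projection onto the fields tangent to the second foliation -/
  h : V →ₗ[ℝ] V
  /-- the exchange of the first two foliations along the third one -/
  j : V →ₗ[ℝ] V
  br_swap : ∀ X Y, br X Y = -br Y X
  v_add_h : ∀ X, v X + h X = X
  v_v : ∀ X, v (v X) = v X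
  j_j : ∀ X, j (j X) = X
  j_v : ∀ X, j (v X) = h (j X)
  h_br_v : ∀ X Y, v X = X → v Y = Y → h (br X Y) = 0
  v_br_h : ∀ X Y, h X = X → h Y = Y → v (br X Y) = 0

/-- The Nijenhuis expression `[AX, AY] - A[AX, Y] - A[X, AY] + A²[X, Y]`. -/
def nijenhuis {V : Type*} [AddCommGroup V] [Module ℝ V] (br : V →ₗ[ℝ] V →ₗ[ℝ] V) (A : V →ₗ[ℝ] V)
    (X Y : V) : V :=
  br (A X) (A Y) - A (br (A X) Y) - A (br X (A Y)) + A (A (br X Y))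

section Nijenhuis

variable {V : Type*} [AddCommGroup V] [Module ℝ V] (br : V →ₗ[ℝ] V →ₗ[ℝ] V) (A : V →ₗ[ℝ] V)

lemma nijenhuis_add_left (X X' Y : V) :
    nijenhuis br A (X + X') Y = nijenhuis br A X Y + nijenhuis br A X' Y := by
  simp only [nijenhuis, map_add, LinearMap.add_apply]
  abel

lemma nijenhuis_add_right (X Y Y' : V) :
    nijenhuis br A X (Y + Y') = nijenhuis br A X Y + nijenhuis br A X Y' := by
  simp only [nijenhuis, map_add]
  abel

lemma nijenhuis_neg (X Y : V) : nijenhuis br (-A) X Y = nijenhuis br A X Y := by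
  simp [nijenhuis]

lemma nijenhuis_apply_right {ε : ℝ} (hA : ∀ X, A (A X) = ε • X) (X Y : V) :
    nijenhuis br A X (A Y) = -A (nijenhuis br A X Y) := by
  simp only [nijenhuis, hA, map_add, map_sub, map_smul]
  abel

lemma nijenhuis_apply_left {ε : ℝ} (hA : ∀ X, A (A X) = ε • X) (X Y : V) :
    nijenhuis br A (A X) Y = -A (nijenhuis br A X Y) := by
  simp only [nijenhuis, hA, map_add, map_sub, map_smul, LinearMap.smul_apply]
  abel

end Nijenhuis

namespace WebAlgebra

variable {V : Type*} [AddCommGroup V] [Module ℝ V] (W : WebAlgebra V)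

lemma h_eq_zero_iff {X : V} : W.h X = 0 ↔ W.v X = X := by
  have := W.v_add_h X
  constructor
  · intro h
    rwa [h, add_zero] at this
  · intro h
    rwa [h, add_eq_left] at this

lemma v_eq_zero_iff {X : V} : W.v X = 0 ↔ W.h X = X := by
  have := W.v_add_h X
  constructor
  · intro h
    rwa [h, zero_add] at this
  · intro h
    rwa [h, add_eq_right] at this

lemma h_v (X : V) : W.h (W.v X) = 0 := W.h_eq_zero_iff.2 (W.v_v X)

lemma v_h (X : V) : W.v (W.h X) = 0 := by
  have h1 := congrArg W.v (W.v_add_h X)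
  rwa [map_add, W.v_v, add_eq_left] at h1

lemma h_h (X : V) : W.h (W.h X) = W.h X := W.v_eq_zero_iff.1 (W.v_h X)

lemma j_h (X : V) : W.j (W.h X) = W.v (W.j X) := by
  have h1 := congrArg W.j (W.v_add_h X)
  rw [map_add, W.j_v] at h1
  have h2 := W.v_add_h (W.j X)
  rw [add_comm] at h2
  exact add_left_cancel (h1.trans h2.symm)

lemma h_j_of_v {a : V} (ha : W.v a = a) : W.h (W.j a) = W.j a := by
  rw [← W.j_v, ha]

/-- Every field is the sum of a field `a` and a field `j c` with `a`, `c` tangent to the first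
foliation. -/
lemma exists_eq_add_j (X : V) : ∃ a c, W.v a = a ∧ W.v c = c ∧ X = a + W.j c := by
  refine ⟨W.v X, W.j (W.h X), W.v_v X, ?_, ?_⟩
  · rw [W.j_h, W.v_v]
  · rw [W.j_j, W.v_add_h]

/-- The symmetric mixed bracket `[a, j b] + [j a, b]`. -/
def mixed (a b : V) : V := W.br a (W.j b) + W.br (W.j a) b

/-- The two components of the vanishing of the torsion, on pairs of fields tangent to the first
and to the second foliation respectively. On mixed pairs the torsion always vanishes. -/
def Flat : Prop :=
  ∀ a b, W.v a = a → W.v b = b →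
    W.br a b = W.j (W.h (W.mixed a b)) ∧ W.br (W.j a) (W.j b) = W.j (W.v (W.mixed a b))

/-- The Chern connection. -/
def chern (X Y : V) : V :=
  W.h (W.j (W.br (W.h X) (W.j (W.h Y))) + W.br (W.v X) (W.h Y)) +
    W.v (W.j (W.br (W.v X) (W.j (W.v Y))) + W.br (W.h X) (W.v Y))

lemma chern_sub_chern {a b c d : V} (ha : W.v a = a) (hb : W.v b = b) (hc : W.v c = c)
    (hd : W.v d = d) :
    W.chern (a + W.j c) (b + W.j d) - W.chern (b + W.j d) (a + W.j c) =
      W.j (W.v (W.mixed c d)) + W.j (W.h (W.mixed a b)) +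
        (W.br a (W.j d) + W.br (W.j c) b) := by
  have hv : ∀ {a c : V}, W.v a = a → W.v c = c → W.v (a + W.j c) = a := by
    intro a c ha hc
    rw [map_add, ha, W.v_eq_zero_iff.2 (W.h_j_of_v hc), add_zero]
  have hh : ∀ {a c : V}, W.v a = a → W.v c = c → W.h (a + W.j c) = W.j c := by
    intro a c ha hc
    rw [map_add, W.h_eq_zero_iff.2 ha, W.h_j_of_v hc, zero_add]
  have h1 : W.br a (W.j d) + W.br (W.j c) b =
      W.v (W.br a (W.j d)) + W.h (W.br a (W.j d)) + (W.v (W.br (W.j c) b) +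
        W.h (W.br (W.j c) b)) := by
    rw [W.v_add_h, W.v_add_h]
  rw [h1]
  simp only [chern, mixed, hv ha hc, hh ha hc, hv hb hd, hh hb hd, W.j_j, map_add, W.j_v, W.j_h]
  rw [W.br_swap b (W.j c), W.br_swap b (W.j a), W.br_swap (W.j d) a, W.br_swap (W.j d) c]
  simp only [map_neg]
  abel

lemma torsion_eq_zero_iff :
    (∀ X Y, W.chern X Y - W.chern Y X - W.br X Y = 0) ↔ W.Flat := by
  constructor
  · intro hT a b ha hb
    constructor
    · have h1 := hT (a + W.j 0) (b + W.j 0)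
      rw [W.chern_sub_chern ha hb (map_zero _) (map_zero _), sub_eq_zero] at h1
      simpa [mixed] using h1.symm
    · have h1 := hT (0 + W.j a) (0 + W.j b)
      rw [W.chern_sub_chern (map_zero _) (map_zero _) ha hb, sub_eq_zero] at h1
      simpa [mixed] using h1.symm
  · intro hF X Y
    obtain ⟨a, c, ha, hc, rfl⟩ := W.exists_eq_add_j X
    obtain ⟨b, d, hb, hd, rfl⟩ := W.exists_eq_add_j Y
    rw [W.chern_sub_chern ha hb hc hd, ← (hF a b ha hb).1, ← (hF c d hc hd).2]
    simp only [map_add, LinearMap.add_apply]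
    abel

lemma Flat.j_mixed {W : WebAlgebra V} (hW : W.Flat) {a b : V} (ha : W.v a = a) (hb : W.v b = b) :
    W.j (W.mixed a b) = W.br a b + W.br (W.j a) (W.j b) := by
  rw [(hW a b ha hb).1, (hW a b ha hb).2, ← map_add, add_comm (W.h _), W.v_add_h]

/-- An endomorphism `A` with `A² = ε`, `A a = j a` for `a` tangent to the first foliation, has
vanishing Nijenhuis tensor as soon as it vanishes on fields tangent to the first foliation. -/
lemma nijenhuis_eq_zero_of_v {A : V →ₗ[ℝ] V} {ε : ℝ} (hA : ∀ X, A (A X) = ε • X)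
    (hAj : ∀ a, W.v a = a → A a = W.j a)
    (h0 : ∀ a b, W.v a = a → W.v b = b → nijenhuis W.br A a b = 0) (X Y : V) :
    nijenhuis W.br A X Y = 0 := by
  obtain ⟨a, c, ha, hc, rfl⟩ := W.exists_eq_add_j X
  obtain ⟨b, d, hb, hd, rfl⟩ := W.exists_eq_add_j Y
  rw [← hAj c hc, ← hAj d hd, nijenhuis_add_left, nijenhuis_add_right, nijenhuis_add_right,
    nijenhuis_apply_right _ _ hA, nijenhuis_apply_right _ _ hA, nijenhuis_apply_left _ _ hA,
    nijenhuis_apply_left _ _ hA, h0 a b ha hb, h0 a d ha hd, h0 c b hc hb, h0 c d hc hd]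
  simp

lemma Flat.nijenhuis_j {W : WebAlgebra V} (hW : W.Flat) (X Y : V) :
    nijenhuis W.br W.j X Y = 0 := by
  refine W.nijenhuis_eq_zero_of_v (ε := 1) (fun X => by rw [W.j_j, one_smul]) (fun _ _ => rfl)
    (fun a b ha hb => ?_) X Y
  have h1 := hW.j_mixed ha hb
  rw [mixed, map_add] at h1
  rw [nijenhuis, W.j_j, sub_sub, add_comm (W.j (W.br (W.j a) b)), h1]
  abel

lemma flat_of_nijenhuis_j (hN : ∀ X Y, nijenhuis W.br W.j X Y = 0) : W.Flat := by
  intro a b ha hb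
  have h1 : W.j (W.mixed a b) = W.br a b + W.br (W.j a) (W.j b) := by
    have h2 := hN a b
    rw [nijenhuis, W.j_j, sub_sub, ← map_add, add_comm (W.br (W.j a) b)] at h2
    rw [mixed, ← sub_eq_zero, ← neg_eq_zero, ← h2]
    abel
  have hab := W.h_br_v a b ha hb
  have hjab := W.v_br_h _ _ (W.h_j_of_v ha) (W.h_j_of_v hb)
  constructor
  · rw [W.j_h, h1, map_add, hjab, add_zero, W.h_eq_zero_iff.1 hab]
  · rw [W.j_v, h1, map_add, hab, zero_add, W.v_eq_zero_iff.1 hjab]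

/-- The complex structure `J = -I j`, that is `j` on the fields tangent to the first foliation and
`-j` on those tangent to the second one, is integrable. -/
lemma Flat.nijenhuis_complex {W : WebAlgebra V} (hW : W.Flat) (X Y : V) :
    nijenhuis W.br (W.j ∘ₗ (W.v - W.h)) X Y = 0 := by
  set J := W.j ∘ₗ (W.v - W.h)
  have hJ : ∀ X, J X = W.j (W.v X) - W.j (W.h X) := fun X => by simp [J]
  have hJv : ∀ a, W.v a = a → J a = W.j a := by
    intro a ha
    rw [hJ, ha, W.h_eq_zero_iff.2 ha]
    simp
  have hJJ : ∀ X, J (J X) = (-1 : ℝ) • X := by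
    intro X
    rw [hJ (J X), hJ X]
    simp only [map_sub, ← W.j_h, ← W.j_v, W.h_h, W.v_v, W.v_h, W.h_v, W.j_j, map_zero]
    rw [zero_sub, sub_zero, ← neg_add', neg_smul, one_smul, add_comm, W.v_add_h]
  refine W.nijenhuis_eq_zero_of_v hJJ hJv (fun a b ha hb => ?_) X Y
  obtain ⟨h1, h2⟩ := hW a b ha hb
  have h3 : J (W.br (W.j a) b) + J (W.br a (W.j b)) = W.br (W.j a) (W.j b) - W.br a b := by
    rw [← map_add, add_comm (W.br (W.j a) b), ← mixed, hJ, ← h1, ← h2]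
  rw [nijenhuis, hJJ, hJv a ha, hJv b hb, sub_sub, h3]
  simp

lemma nijenhuis_v_sub_h (X Y : V) : nijenhuis W.br (W.v - W.h) X Y = 0 := by
  set I := W.v - W.h
  have hI : ∀ X, I X = W.v X - W.h X := fun X => by simp [I]
  have hIv : ∀ a, W.v a = a → I a = a := by
    intro a ha
    rw [hI, ha, W.h_eq_zero_iff.2 ha, sub_zero]
  have hIh : ∀ a, W.h a = a → I a = -a := by
    intro a ha
    rw [hI, ha, W.v_eq_zero_iff.2 ha, zero_sub]
  have hII : ∀ X, I (I X) = X := by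
    intro X
    rw [hI X, map_sub, hIv _ (W.v_v X), hIh _ (W.h_h X), sub_neg_eq_add, W.v_add_h]
  rw [← W.v_add_h X, ← W.v_add_h Y, nijenhuis_add_left, nijenhuis_add_right, nijenhuis_add_right]
  have hvv := W.h_br_v _ _ (W.v_v X) (W.v_v Y)
  have hhh := W.v_br_h _ _ (W.h_h X) (W.h_h Y)
  simp only [nijenhuis, hII, hIv _ (W.v_v X), hIv _ (W.v_v Y), hIh _ (W.h_h X), hIh _ (W.h_h Y),
    map_neg, LinearMap.neg_apply, hIv _ (W.h_eq_zero_iff.1 hvv), hIh _ (W.v_eq_zero_iff.1 hhh)]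
  abel

/-- The brackets of fields `s a + t j a` with `a` tangent to the first foliation are again of this
form. -/
lemma Flat.br_range {W : WebAlgebra V} (hW : W.Flat) (s t : ℝ) {a b : V} (ha : W.v a = a)
    (hb : W.v b = b) : ∃ c, W.v c = c ∧
      W.br (s • a + t • W.j a) (s • b + t • W.j b) = s • c + t • W.j c := by
  obtain ⟨h1, h2⟩ := hW a b ha hb
  have hab := W.h_eq_zero_iff.1 (W.h_br_v a b ha hb)
  have hjab := W.v_eq_zero_iff.1 (W.v_br_h _ _ (W.h_j_of_v ha) (W.h_j_of_v hb))
  refine ⟨s • W.br a b + t • W.j (W.br (W.j a) (W.j b)), ?_, ?_⟩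
  · rw [map_add, map_smul, map_smul, hab, ← W.j_h, hjab]
  · have h3 : W.br a (W.j b) + W.br (W.j a) b = W.j (W.br (W.j a) (W.j b)) + W.j (W.br a b) := by
      rw [h1, h2, W.j_j, W.j_j, W.v_add_h, mixed]
    have h4 : W.br a (W.j b) = W.j (W.br (W.j a) (W.j b)) + W.j (W.br a b) - W.br (W.j a) b :=
      eq_sub_of_add_eq h3
    simp only [map_add, map_smul, LinearMap.add_apply, LinearMap.smul_apply, W.j_j, h4]
    module

end WebAlgebra

/-! ### The algebra of smooth vector fields -/

section SmoothFields

variable {m : ℕ} {M : Type*} [TopologicalSpace M] [ChartedSpace (Model m) M]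
  [IsManifold (𝓡 (2 * m)) ∞ M]

variable (m M) in
/-- The space of smooth vector fields. -/
def smoothFields : Submodule ℝ (∀ x : M, Tan m x) where
  carrier := {X | SmoothField m X}
  add_mem' hX hY := smoothField_iff.2 fun x => (hX.smoothFieldAt x).add (hY.smoothFieldAt x)
  zero_mem' := smoothField_iff.2 fun _ =>
    (Bundle.contMDiff_zeroSection ℝ (fun y : M => Tan m y)).contMDiffAt
  smul_mem' c _ hX := smoothField_iff.2 fun x => (hX.smoothFieldAt x).const_smul c

lemma SmoothField.bracket {X Y : ∀ x : M, Tan m x} (hX : SmoothField m X)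
    (hY : SmoothField m Y) : SmoothField m (bracket m X Y) := by
  refine smoothField_iff.2 fun x => ?_
  have : IsManifold (𝓡 (2 * m)) (minSmoothness ℝ 2) M := by
    rw [minSmoothness_of_isRCLikeNormedField]
    infer_instance
  have : IsManifold (𝓡 (2 * m)) (((⊤ : ℕ∞) : WithTop ℕ∞) + 1) M :=
    inferInstanceAs (IsManifold (𝓡 (2 * m)) ∞ M)
  exact ContMDiffAt.mlieBracket_vectorField (m := ⊤) (n := ⊤) (hX.smoothFieldAt x)
    (hY.smoothFieldAt x) (by rw [minSmoothness_of_isRCLikeNormedField]; rfl)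

variable (m M) in
/-- The Lie bracket on the space of smooth vector fields. -/
def fieldBracket : smoothFields m M →ₗ[ℝ] smoothFields m M →ₗ[ℝ] smoothFields m M :=
  have hd : ∀ (X : smoothFields m M) (x : M), MDifferentiableAt (𝓡 (2 * m)) (𝓡 (2 * m)).tangent
      (fun x => (⟨x, X.1 x⟩ : TangentBundle (𝓡 (2 * m)) M)) x := fun X x =>
    (SmoothField.smoothFieldAt X.2 x).mdifferentiableAt
  LinearMap.mk₂ ℝ (fun X Y => ⟨bracket m X.1 Y.1, SmoothField.bracket X.2 Y.2⟩)
    (fun X X' _ => Subtype.ext (funext fun x =>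
      VectorField.mlieBracket_add_left (hd X x) (hd X' x)))
    (fun _ X _ => Subtype.ext (funext fun x =>
      VectorField.mlieBracket_const_smul_left (hd X x)))
    (fun _ Y Y' => Subtype.ext (funext fun x =>
      VectorField.mlieBracket_add_right (hd Y x) (hd Y' x)))
    (fun _ _ Y => Subtype.ext (funext fun x =>
      VectorField.mlieBracket_const_smul_right (hd Y x)))

lemma fieldBracket_swap (X Y : smoothFields m M) : fieldBracket m M X Y = -fieldBracket m M Y X :=
  Subtype.ext (funext fun _ => VectorField.mlieBracket_swap_apply)

/-- The action of a smooth field of endomorphisms on smooth vector fields. -/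
def SmoothEnd.toLinearMap {A : ∀ x : M, Module.End ℝ (Tan m x)} (hA : SmoothEnd A) :
    smoothFields m M →ₗ[ℝ] smoothFields m M where
  toFun X := ⟨fun x => A x (X.1 x), hA X.1 X.2⟩
  map_add' X Y := Subtype.ext (funext fun x => map_add (A x) (X.1 x) (Y.1 x))
  map_smul' c X := Subtype.ext (funext fun x => map_smul (A x) c (X.1 x))

lemma SmoothEnd.id : SmoothEnd fun x : M => (LinearMap.id : Module.End ℝ (Tan m x)) :=
  fun _ hX => hX

lemma SmoothEnd.add {A B : ∀ x : M, Module.End ℝ (Tan m x)} (hA : SmoothEnd A)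
    (hB : SmoothEnd B) : SmoothEnd fun x => A x + B x := fun X hX =>
  (smoothFields m M).add_mem (hA X hX) (hB X hX)

lemma SmoothEnd.smul {A : ∀ x : M, Module.End ℝ (Tan m x)} (hA : SmoothEnd A) (c : ℝ) :
    SmoothEnd fun x => c • A x := fun X hX =>
  (smoothFields m M).smul_mem c (hA X hX)

lemma SmoothEnd.neg {A : ∀ x : M, Module.End ℝ (Tan m x)} (hA : SmoothEnd A) :
    SmoothEnd fun x => -A x := fun X hX =>
  (smoothFields m M).neg_mem (hA X hX)

lemma SmoothEnd.sub {A B : ∀ x : M, Module.End ℝ (Tan m x)} (hA : SmoothEnd A)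
    (hB : SmoothEnd B) : SmoothEnd fun x => A x - B x := fun X hX =>
  (smoothFields m M).sub_mem (hA X hX) (hB X hX)

lemma SmoothEnd.comp {A B : ∀ x : M, Module.End ℝ (Tan m x)} (hA : SmoothEnd A)
    (hB : SmoothEnd B) : SmoothEnd fun x => A x ∘ₗ B x := fun X hX =>
  hA _ (hB X hX)

lemma SmoothEnd.nijenhuisZero_iff {A : ∀ x : M, Module.End ℝ (Tan m x)} (hA : SmoothEnd A) :
    NijenhuisZero A ↔ ∀ X Y, nijenhuis (fieldBracket m M) hA.toLinearMap X Y = 0 := by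
  constructor
  · intro h X Y
    exact Subtype.ext (funext fun x => h X.1 Y.1 X.2 Y.2 x)
  · intro h X Y hX hY x
    exact congrFun (congrArg Subtype.val (h ⟨X, hX⟩ ⟨Y, hY⟩)) x

end SmoothFields

/-! ### Dimensions -/

section Dimensions

variable {m : ℕ} {M : Type*} [TopologicalSpace M] [ChartedSpace (Model m) M]

lemma finrank_tan (x : M) : Module.finrank ℝ (Tan m x) = 2 * m :=
  finrank_euclideanSpace_fin

lemma finiteDimensional_tan (x : M) : FiniteDimensional ℝ (Tan m x) :=
  inferInstanceAs (FiniteDimensional ℝ (Model m))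

lemma isCompl_of_disjoint {T : Type*} [AddCommGroup T] [Module ℝ T] [FiniteDimensional ℝ T]
    {P Q : Submodule ℝ T} (h : Disjoint P Q)
    (hd : Module.finrank ℝ P + Module.finrank ℝ Q = Module.finrank ℝ T) : IsCompl P Q :=
  (Submodule.isCompl_iff_disjoint P Q hd.ge).2 h

lemma isCompl_eigenspace {T : Type*} [AddCommGroup T] [Module ℝ T] {A : Module.End ℝ T}
    (hA : A * A = 1) : IsCompl (A.eigenspace 1) (A.eigenspace (-1)) := by
  have hAA : ∀ u, A (A u) = u := fun u => congrArg (fun f => f u) hA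
  constructor
  · rw [Submodule.disjoint_def]
    intro u h1 h2
    rw [Module.End.mem_eigenspace_iff, one_smul] at h1
    rw [Module.End.mem_eigenspace_iff, h1, neg_smul, one_smul] at h2
    calc u = (1 / 2 : ℝ) • (u + u) := by module
      _ = (1 / 2 : ℝ) • (u + -u) := by rw [← h2]
      _ = 0 := by simp
  · rw [codisjoint_iff, eq_top_iff]
    intro u _
    have h1 : (1 / 2 : ℝ) • (u + A u) ∈ A.eigenspace 1 := by
      rw [Module.End.mem_eigenspace_iff, map_smul, map_add, hAA, one_smul, add_comm]
    have h2 : (1 / 2 : ℝ) • (u - A u) ∈ A.eigenspace (-1) := by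
      rw [Module.End.mem_eigenspace_iff, map_smul, map_sub, hAA, neg_smul, one_smul, ← smul_neg,
        neg_sub]
    have h3 : u = (1 / 2 : ℝ) • (u + A u) + (1 / 2 : ℝ) • (u - A u) := by module
    rw [h3]
    exact Submodule.add_mem_sup h1 h2

lemma range_id_add_eq_eigenspace {T : Type*} [AddCommGroup T] [Module ℝ T] {A : Module.End ℝ T}
    (hA : A * A = 1) : (LinearMap.id + A).range = A.eigenspace 1 := by
  have hAA : ∀ u, A (A u) = u := fun u => congrArg (fun f => f u) hA
  ext u
  rw [Module.End.mem_eigenspace_iff, one_smul]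
  constructor
  · rintro ⟨w, rfl⟩
    simp [hAA, add_comm]
  · intro h
    refine ⟨(1 / 2 : ℝ) • u, ?_⟩
    rw [LinearMap.add_apply, LinearMap.id_apply, map_smul, h]
    module

lemma WebFoliation.finrank_tangent [IsManifold (𝓡 (2 * m)) ∞ M] (F : WebFoliation m M) (x : M) :
    Module.finrank ℝ (F.tangent x) = m := by
  obtain ⟨e, he, hx, htan⟩ := F.exists_chart x
  have he : SmoothChart m e := he
  let L : Tan m x ≃ₗ[ℝ] (Fin m → ℝ) × (Fin m → ℝ) :=
    (he.diffEquiv hx).trans (splitModel m).toLinearEquiv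
  have h1 : F.tangent x = (LinearMap.inl ℝ (Fin m → ℝ) (Fin m → ℝ)).range.map
      L.symm.toLinearMap := by
    ext u
    rw [htan x hx, mem_sliceSpace_iff, Submodule.mem_map_equiv, LinearMap.range_inl]
    rfl
  rw [h1, LinearEquiv.finrank_map_eq, LinearMap.finrank_range_of_inj LinearMap.inl_injective]
  simp

end Dimensions

/-! ### The endomorphisms of a 3-web -/

namespace ThreeWeb

variable {m : ℕ} {M : Type*} [TopologicalSpace M] [ChartedSpace (Model m) M]
  [IsManifold (𝓡 (2 * m)) ∞ M] (W : ThreeWeb m M) {x : M} {u : Tan m x}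

lemma piV_eq_self_iff : W.piV x u = u ↔ u ∈ (W.F 0).tangent x :=
  Submodule.projection_eq_self_iff _ u

lemma piH_eq_self_iff : W.piH x u = u ↔ u ∈ (W.F 1).tangent x :=
  Submodule.projection_eq_self_iff _ u

lemma piV_eq_zero_iff : W.piV x u = 0 ↔ u ∈ (W.F 1).tangent x :=
  Submodule.projection_apply_eq_zero_iff _

lemma piH_eq_zero_iff : W.piH x u = 0 ↔ u ∈ (W.F 0).tangent x :=
  Submodule.projection_apply_eq_zero_iff _

lemma piV_mem (u : Tan m x) : W.piV x u ∈ (W.F 0).tangent x :=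
  Submodule.projection_apply_mem _ u

lemma piH_mem (u : Tan m x) : W.piH x u ∈ (W.F 1).tangent x :=
  Submodule.projection_apply_mem _ u

lemma piV_add_piH (u : Tan m x) : W.piV x u + W.piH x u = u := by
  have h1 : u - W.piV x u ∈ (W.F 1).tangent x := by
    rw [← W.piV_eq_zero_iff, map_sub, W.piV_eq_self_iff.2 (W.piV_mem u), sub_self]
  have h2 := W.piH_eq_self_iff.2 h1
  rw [map_sub, W.piH_eq_zero_iff.2 (W.piV_mem u), sub_zero] at h2
  rw [h2, add_sub_cancel]

lemma eq_zero_of_mem {i k : Fin 3} (h : i ≠ k) (hi : u ∈ (W.F i).tangent x)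
    (hk : u ∈ (W.F k).tangent x) : u = 0 :=
  Submodule.disjoint_def.1 (W.transversal i k h x).disjoint u hi hk

lemma j_mem_one (hu : u ∈ (W.F 0).tangent x) :
    W.j x u ∈ (W.F 1).tangent x ∧ W.j x u - u ∈ (W.F 2).tangent x := by
  have h := (((W.j_unique x (W.j x)).1 rfl) u).2
  rwa [W.piV_eq_self_iff.2 hu] at h

lemma j_mem_zero (hu : u ∈ (W.F 1).tangent x) :
    W.j x u ∈ (W.F 0).tangent x ∧ W.j x u - u ∈ (W.F 2).tangent x := by
  have h := (((W.j_unique x (W.j x)).1 rfl) u).1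
  rwa [W.piH_eq_self_iff.2 hu] at h

lemma j_eq_of_mem {w : Tan m x} (hu : u ∈ (W.F 0).tangent x) (hw : w ∈ (W.F 1).tangent x)
    (hwu : w - u ∈ (W.F 2).tangent x) : W.j x u = w := by
  obtain ⟨h1, h2⟩ := W.j_mem_one hu
  refine sub_eq_zero.1 (W.eq_zero_of_mem (i := 1) (k := 2) (by decide) (sub_mem h1 hw) ?_)
  have h3 := sub_mem h2 hwu
  rwa [sub_sub_sub_cancel_right] at h3

lemma j_j (u : Tan m x) : W.j x (W.j x u) = u := by
  have key : ∀ {i k : Fin 3}, i ≠ 2 → ∀ {u : Tan m x}, u ∈ (W.F i).tangent x →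
      W.j x u - u ∈ (W.F 2).tangent x → W.j x (W.j x u) ∈ (W.F i).tangent x →
      W.j x (W.j x u) - W.j x u ∈ (W.F 2).tangent x → W.j x (W.j x u) = u := by
    intro i _ hi u hu h1 h2 h3
    refine sub_eq_zero.1 (W.eq_zero_of_mem hi (sub_mem h2 hu) ?_)
    have h4 := add_mem h3 h1
    rwa [sub_add_sub_cancel] at h4
  have h0 : W.j x (W.j x (W.piV x u)) = W.piV x u := by
    obtain ⟨h1, h2⟩ := W.j_mem_one (W.piV_mem u)
    obtain ⟨h3, h4⟩ := W.j_mem_zero h1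
    exact key (k := 1) (by decide) (W.piV_mem u) h2 h3 h4
  have h1 : W.j x (W.j x (W.piH x u)) = W.piH x u := by
    obtain ⟨h1, h2⟩ := W.j_mem_zero (W.piH_mem u)
    obtain ⟨h3, h4⟩ := W.j_mem_one h1
    exact key (k := 1) (by decide) (W.piH_mem u) h2 h3 h4
  rw [← W.piV_add_piH u, map_add, map_add, h0, h1]

lemma j_piV (u : Tan m x) : W.j x (W.piV x u) = W.piH x (W.j x u) := by
  conv_rhs => rw [← W.piV_add_piH u, map_add, map_add]
  rw [W.piH_eq_self_iff.2 (W.j_mem_one (W.piV_mem u)).1,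
    W.piH_eq_zero_iff.2 (W.j_mem_zero (W.piH_mem u)).1, add_zero]

lemma j_piH (u : Tan m x) : W.j x (W.piH x u) = W.piV x (W.j x u) := by
  conv_rhs => rw [← W.piV_add_piH u, map_add, map_add]
  rw [W.piV_eq_self_iff.2 (W.j_mem_zero (W.piH_mem u)).1,
    W.piV_eq_zero_iff.2 (W.j_mem_one (W.piV_mem u)).1, zero_add]

/-- The third foliation is the `-1`-eigendistribution of `j`. -/
lemma j_eq_neg_iff : W.j x u = -u ↔ u ∈ (W.F 2).tangent x := by
  have hV := W.j_mem_one (W.piV_mem u)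
  have hsum := W.piV_add_piH u
  constructor
  · intro h
    have h1 := hV.2
    rw [W.j_piV, h, map_neg, ← neg_add', add_comm, hsum] at h1
    exact neg_mem_iff.1 h1
  · intro hu
    have h1 : W.piH x u + W.j x (W.piV x u) = 0 := by
      refine W.eq_zero_of_mem (i := 1) (k := 2) (by decide) (add_mem (W.piH_mem u) hV.1) ?_
      have h2 := add_mem hu hV.2
      nth_rw 1 [← hsum] at h2
      convert h2 using 1
      abel
    have h2 : W.j x (W.piV x u) = -W.piH x u := by
      rw [add_comm] at h1
      exact eq_neg_of_add_eq_zero_left h1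
    have h3 := congrArg (W.j x) h2
    rw [W.j_j, map_neg] at h3
    conv_lhs => rw [← hsum, map_add, h2]
    conv_rhs => rw [← hsum, h3]
    abel

lemma eigenspace_j_one :
    Module.End.eigenspace (W.j x) 1 = ((W.F 0).tangent x).map (LinearMap.id + W.j x) := by
  ext u
  rw [Module.End.mem_eigenspace_iff, one_smul]
  constructor
  · intro h
    refine ⟨W.piV x u, W.piV_mem u, ?_⟩
    rw [LinearMap.add_apply, LinearMap.id_apply, W.j_piV, h, W.piV_add_piH]
  · rintro ⟨a, -, rfl⟩
    simp [W.j_j, add_comm]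

lemma smoothEnd_proj [T2Space M] (i k : Fin 3) (h : i ≠ k) : SmoothEnd (W.proj i k h) :=
  smoothEnd_projection (W.F i) (W.F k) (W.transversal i k h)

lemma smoothEnd_piV [T2Space M] : SmoothEnd W.piV := W.smoothEnd_proj 0 1 (by decide)

lemma smoothEnd_piH [T2Space M] : SmoothEnd W.piH := W.smoothEnd_proj 1 0 (by decide)

lemma smoothEnd_j [T2Space M] : SmoothEnd W.j :=
  ((W.smoothEnd_proj 0 2 (by decide)).comp W.smoothEnd_piH).add
    ((W.smoothEnd_proj 1 2 (by decide)).comp W.smoothEnd_piV)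

/-- The algebraic structure on the space of smooth vector fields defined by a 3-web. -/
def algebra [T2Space M] : WebAlgebra (smoothFields m M) where
  br := fieldBracket m M
  v := W.smoothEnd_piV.toLinearMap
  h := W.smoothEnd_piH.toLinearMap
  j := W.smoothEnd_j.toLinearMap
  br_swap := fieldBracket_swap
  v_add_h X := Subtype.ext (funext fun x => W.piV_add_piH (X.1 x))
  v_v X := Subtype.ext (funext fun x => W.piV_eq_self_iff.2 (W.piV_mem (X.1 x)))
  j_j X := Subtype.ext (funext fun x => W.j_j (X.1 x))
  j_v X := Subtype.ext (funext fun x => W.j_piV (X.1 x))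
  h_br_v X Y hX hY := Subtype.ext (funext fun x => W.piH_eq_zero_iff.2
    ((W.F 0).bracket_mem X.2 Y.2
      (fun y => W.piV_eq_self_iff.1 (congrFun (congrArg Subtype.val hX) y))
      (fun y => W.piV_eq_self_iff.1 (congrFun (congrArg Subtype.val hY) y)) x))
  v_br_h X Y hX hY := Subtype.ext (funext fun x => W.piV_eq_zero_iff.2
    ((W.F 1).bracket_mem X.2 Y.2
      (fun y => W.piH_eq_self_iff.1 (congrFun (congrArg Subtype.val hX) y))
      (fun y => W.piH_eq_self_iff.1 (congrFun (congrArg Subtype.val hY) y)) x))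

lemma torsionFree_iff_flat [T2Space M] : W.TorsionFree ↔ W.algebra.Flat := by
  rw [← W.algebra.torsion_eq_zero_iff]
  constructor
  · intro h X Y
    exact Subtype.ext (funext fun x => h X.1 Y.1 X.2 Y.2 x)
  · intro h X Y hX hY x
    exact congrFun (congrArg Subtype.val (h ⟨X, hX⟩ ⟨Y, hY⟩)) x

lemma torsionFree_of_nijenhuisZero_j [T2Space M] (h : NijenhuisZero W.j) : W.TorsionFree :=
  W.torsionFree_iff_flat.2
    (W.algebra.flat_of_nijenhuis_j (W.smoothEnd_j.nijenhuisZero_iff.1 h))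

lemma eigenspace_I_one : Module.End.eigenspace (W.piV x - W.piH x) 1 = (W.F 0).tangent x := by
  ext u
  rw [Module.End.mem_eigenspace_iff, one_smul, LinearMap.sub_apply, ← W.piH_eq_zero_iff]
  have h1 := W.piV_add_piH u
  constructor
  · intro h
    have h2 : W.piH x u = (1 / 2 : ℝ) • ((W.piV x u + W.piH x u) - (W.piV x u - W.piH x u)) := by
      module
    rw [h2, h1, h, sub_self, smul_zero]
  · intro h
    rw [h, add_zero] at h1
    rw [h1, h, sub_zero]

lemma eigenspace_I_neg_one :
    Module.End.eigenspace (W.piV x - W.piH x) (-1) = (W.F 1).tangent x := by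
  ext u
  rw [Module.End.mem_eigenspace_iff, neg_smul, one_smul, LinearMap.sub_apply,
    ← W.piV_eq_zero_iff]
  have h1 := W.piV_add_piH u
  constructor
  · intro h
    have h2 : W.piV x u = (1 / 2 : ℝ) • ((W.piV x u + W.piH x u) + (W.piV x u - W.piH x u)) := by
      module
    rw [h2, h1, h, add_neg_cancel, smul_zero]
  · intro h
    rw [h, zero_add] at h1
    rw [h, h1, zero_sub]

lemma I_mul_I : (W.piV x - W.piH x) * (W.piV x - W.piH x) = 1 := by
  ext1 u
  simp only [Module.End.mul_apply, LinearMap.sub_apply, map_sub, Module.End.one_apply]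
  rw [W.piV_eq_self_iff.2 (W.piV_mem u), W.piH_eq_self_iff.2 (W.piH_mem u),
    W.piV_eq_zero_iff.2 (W.piH_mem u), W.piH_eq_zero_iff.2 (W.piV_mem u), sub_zero, zero_sub,
    sub_neg_eq_add, W.piV_add_piH]

lemma eigenspace_neg_j_one : Module.End.eigenspace (-W.j x) 1 = (W.F 2).tangent x := by
  ext u
  rw [Module.End.mem_eigenspace_iff, one_smul, LinearMap.neg_apply, neg_eq_iff_eq_neg,
    W.j_eq_neg_iff]

lemma eigenspace_neg_j_neg_one :
    Module.End.eigenspace (-W.j x) (-1) = ((W.F 0).tangent x).map (LinearMap.id + W.j x) := by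
  rw [← W.eigenspace_j_one]
  ext u
  rw [Module.End.mem_eigenspace_iff, Module.End.mem_eigenspace_iff, LinearMap.neg_apply, neg_smul,
    neg_inj]

lemma neg_j_mul_neg_j : -W.j x * -W.j x = 1 := by
  ext1 u
  simp [W.j_j]

lemma I_mul_j (u : Tan m x) : (W.piV x - W.piH x) (W.j x u) =
    -W.j x ((W.piV x - W.piH x) u) := by
  rw [LinearMap.sub_apply, LinearMap.sub_apply, map_sub, W.j_piV, W.j_piH]
  abel

/-- The hyper-para-complex structure `I = π_v - π_h`, `K = -j`, `J = I K = j I` defined by a 3-web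
with torsion-free Chern connection. -/
def TorsionFree.hyperParaComplex [T2Space M] {W : ThreeWeb m M} (hW : W.TorsionFree) :
    HyperParaComplex m M where
  I x := W.piV x - W.piH x
  K x := -W.j x
  J x := W.j x ∘ₗ (W.piV x - W.piH x)
  paraI :=
    { smooth := W.smoothEnd_piV.sub W.smoothEnd_piH
      sq := fun x => W.I_mul_I
      rank_eq := fun x => by
        rw [W.eigenspace_I_one, W.eigenspace_I_neg_one, WebFoliation.finrank_tangent,
          WebFoliation.finrank_tangent]
      integrable := (W.smoothEnd_piV.sub W.smoothEnd_piH).nijenhuisZero_iff.2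
        W.algebra.nijenhuis_v_sub_h }
  paraK :=
    { smooth := W.smoothEnd_j.neg
      sq := fun x => W.neg_j_mul_neg_j
      rank_eq := fun x => by
        have := finiteDimensional_tan (m := m) x
        have h1 := Submodule.finrank_add_eq_of_isCompl
          (isCompl_eigenspace (W.neg_j_mul_neg_j (x := x)))
        rw [W.eigenspace_neg_j_one, WebFoliation.finrank_tangent, finrank_tan] at h1
        rw [W.eigenspace_neg_j_one, WebFoliation.finrank_tangent]
        omega
      integrable := W.smoothEnd_j.neg.nijenhuisZero_iff.2 fun X Y =>
        (nijenhuis_neg _ W.smoothEnd_j.toLinearMap X Y).trans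
          ((W.torsionFree_iff_flat.1 hW).nijenhuis_j X Y) }
  complexJ :=
    { smooth := W.smoothEnd_j.comp (W.smoothEnd_piV.sub W.smoothEnd_piH)
      sq := fun x => by
        ext1 u
        have h1 := congrArg (fun f => f u) (W.I_mul_I (x := x))
        simp only [Module.End.mul_apply, Module.End.one_apply] at h1
        rw [Module.End.mul_apply, LinearMap.comp_apply, LinearMap.comp_apply, W.I_mul_j, map_neg,
          W.j_j, h1]
        rfl
      integrable := (W.smoothEnd_j.comp
        (W.smoothEnd_piV.sub W.smoothEnd_piH)).nijenhuisZero_iff.2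
          (W.torsionFree_iff_flat.1 hW).nijenhuis_complex }
  mul_IK x := by
    ext1 u
    rw [Module.End.mul_apply, LinearMap.neg_apply, map_neg, W.I_mul_j, neg_neg]
    rfl
  mul_KI x := rfl

lemma TorsionFree.induces [T2Space M] {W : ThreeWeb m M} (hW : W.TorsionFree) :
    W.Induces hW.hyperParaComplex := fun _ =>
  ⟨W.eigenspace_I_one, W.eigenspace_I_neg_one, W.eigenspace_neg_j_one,
    W.eigenspace_neg_j_neg_one⟩

/-! ### The pencil of distributions spanned by a 3-web -/

/-- The field of endomorphisms `(s + t j) π_v`. -/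
def pencilEnd (s t : ℝ) (x : M) : Module.End ℝ (Tan m x) :=
  (s • LinearMap.id + t • W.j x) ∘ₗ W.piV x

/-- The subspace `{s a + t j a | a ∈ T_xℱ₁}`. -/
def pencil (s t : ℝ) (x : M) : Submodule ℝ (Tan m x) := (W.pencilEnd s t x).range

lemma mem_pencil_iff {s t : ℝ} :
    u ∈ W.pencil s t x ↔ ∃ a ∈ (W.F 0).tangent x, u = s • a + t • W.j x a := by
  constructor
  · rintro ⟨w, rfl⟩
    exact ⟨_, W.piV_mem w, rfl⟩
  · rintro ⟨a, ha, rfl⟩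
    refine ⟨a, ?_⟩
    simp [pencilEnd, W.piV_eq_self_iff.2 ha]

lemma smul_add_smul_j_eq_zero {s t : ℝ} (hst : (s, t) ≠ 0) {a : Tan m x}
    (ha : a ∈ (W.F 0).tangent x) (h : s • a + t • W.j x a = 0) : a = 0 := by
  have h1 := congrArg (W.piV x) h
  have h2 := congrArg (W.piH x) h
  have hj := (W.j_mem_one ha).1
  rw [map_add, map_smul, map_smul, map_zero, W.piV_eq_self_iff.2 ha, W.piV_eq_zero_iff.2 hj,
    smul_zero, add_zero] at h1
  rw [map_add, map_smul, map_smul, map_zero, W.piH_eq_zero_iff.2 ha, W.piH_eq_self_iff.2 hj,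
    smul_zero, zero_add] at h2
  by_cases hs : s = 0
  · have ht : t ≠ 0 := fun ht => hst (by rw [hs, ht]; rfl)
    have h3 := (smul_eq_zero.1 h2).resolve_left ht
    rw [← W.j_j a, h3, map_zero]
  · exact (smul_eq_zero.1 h1).resolve_left hs

lemma finrank_pencil {s t : ℝ} (hst : (s, t) ≠ 0) (x : M) :
    Module.finrank ℝ (W.pencil s t x) = m := by
  let g : (W.F 0).tangent x →ₗ[ℝ] Tan m x :=
    (s • LinearMap.id + t • W.j x) ∘ₗ ((W.F 0).tangent x).subtype
  have hg : g.range = W.pencil s t x := by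
    ext u
    rw [mem_pencil_iff]
    constructor
    · rintro ⟨a, rfl⟩
      exact ⟨a, a.2, rfl⟩
    · rintro ⟨a, ha, rfl⟩
      exact ⟨⟨a, ha⟩, rfl⟩
  have hinj : Function.Injective g := by
    rw [injective_iff_map_eq_zero]
    intro a ha
    exact Subtype.ext (W.smul_add_smul_j_eq_zero hst a.2 ha)
  rw [← hg, LinearMap.finrank_range_of_inj hinj, WebFoliation.finrank_tangent]

/-- If the torsion of the Chern connection vanishes, every distribution of the pencil is a
foliation. -/
lemma TorsionFree.exists_foliation_pencil [T2Space M] {W : ThreeWeb m M} (hW : W.TorsionFree)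
    {s t : ℝ} (hst : (s, t) ≠ 0) :
    ∃ F : WebFoliation m M, ∀ x, F.tangent x = W.pencil s t x := by
  have hs : SmoothEnd (W.pencilEnd s t) :=
    ((SmoothEnd.id.smul s).add (W.smoothEnd_j.smul t)).comp W.smoothEnd_piV
  refine exists_foliation_tangent_eq_range hs (W.finrank_pencil hst) fun X Y hX hY x => ?_
  obtain ⟨c, hc, hbr⟩ := (W.torsionFree_iff_flat.1 hW).br_range s t
    (W.algebra.v_v ⟨X, hX⟩) (W.algebra.v_v ⟨Y, hY⟩)
  refine (W.mem_pencil_iff (s := s) (t := t)).2 ⟨c.1 x, ?_, ?_⟩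
  · exact W.piV_eq_self_iff.1 (congrFun (congrArg Subtype.val hc) x)
  · exact congrFun (congrArg Subtype.val hbr) x

end ThreeWeb

/-! ### The Segre structure of a 3-web -/

section SegreModel

variable {m : ℕ}

lemma mem_segreCone_iff {A : Matrix (Fin m) (Fin 2) ℝ} :
    A ∈ segreCone m ↔ A ≠ 0 ∧ ∃ v : Fin 2 → ℝ, v ≠ 0 ∧ A ∈ alphaModel m v := by
  change A.rank = 1 ↔ _
  constructor
  · intro h
    refine ⟨fun h0 => by simp [h0, Matrix.rank_zero] at h, ?_⟩
    rw [Matrix.rank_eq_finrank_span_row, finrank_eq_one_iff'] at h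
    obtain ⟨v, hv, hall⟩ := h
    choose w hw using fun i => hall ⟨A.row i, Submodule.subset_span ⟨i, rfl⟩⟩
    refine ⟨v.1, fun h0 => hv (Subtype.ext h0), w, ?_⟩
    ext i k
    have h1 := congrFun (congrArg Subtype.val (hw i)) k
    simpa [Matrix.vecMulVec_apply] using h1.symm
  · rintro ⟨h0, v, hv, w, rfl⟩
    refine le_antisymm (Matrix.rank_vecMulVec_le w v) (Nat.one_le_iff_ne_zero.2 fun h => h0 ?_)
    rw [Matrix.rank_eq_finrank_span_row, Submodule.finrank_eq_zero] at h
    ext i k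
    have h1 : (Matrix.vecMulVec w v).row i ∈ Submodule.span ℝ
        (Set.range (Matrix.vecMulVec w v).row) := Submodule.subset_span ⟨i, rfl⟩
    rw [h, Submodule.mem_bot] at h1
    exact congrFun h1 k

lemma mem_image_segreCone_iff {T : Type*} [AddCommGroup T] [Module ℝ T]
    (φ : Matrix (Fin m) (Fin 2) ℝ ≃ₗ[ℝ] T) {u : T} :
    u ∈ φ '' segreCone m ↔
      u ≠ 0 ∧ ∃ v : Fin 2 → ℝ, v ≠ 0 ∧ u ∈ (alphaModel m v).map φ.toLinearMap := by
  constructor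
  · rintro ⟨A, hA, rfl⟩
    obtain ⟨h0, v, hv, hAv⟩ := mem_segreCone_iff.1 hA
    exact ⟨fun h => h0 (φ.injective (by rw [h, map_zero])), v, hv, A, hAv, rfl⟩
  · rintro ⟨h0, v, hv, A, hAv, rfl⟩
    exact ⟨A, mem_segreCone_iff.2 ⟨fun h => h0 (by rw [h, map_zero]), v, hv, hAv⟩, rfl⟩

lemma alphaModel_smul {c : ℝ} (hc : c ≠ 0) (v : Fin 2 → ℝ) :
    alphaModel m (c • v) = alphaModel m v := by
  ext A
  constructor
  · rintro ⟨w, rfl⟩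
    exact ⟨c • w, by rw [Matrix.vecMulVec_smul, Matrix.smul_vecMulVec]⟩
  · rintro ⟨w, rfl⟩
    refine ⟨c⁻¹ • w, ?_⟩
    rw [Matrix.vecMulVec_smul, Matrix.smul_vecMulVec, smul_smul, mul_inv_cancel₀ hc, one_smul]

/-- If `R` is an involution of the plane with trace zero, that is `R ≠ ±1`, then the `1`-eigenspace
of `1 ⊗ R` has the form `ℝ^m ⊗ v`. -/
lemma exists_eigenspace_eq_alphaModel {T : Type*} [AddCommGroup T] [Module ℝ T]
    (φ : Matrix (Fin m) (Fin 2) ℝ ≃ₗ[ℝ] T) {A : Module.End ℝ T} {R : Matrix (Fin 2) (Fin 2) ℝ}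
    (hA : ∀ B, A (φ B) = φ (B * R)) (hR : R * R = 1) (htr : R.trace = 0) :
    ∃ v : Fin 2 → ℝ, v ≠ 0 ∧ A.eigenspace 1 = (alphaModel m v).map φ.toLinearMap := by
  have e00 := congrFun (congrFun hR 0) 0
  rw [Matrix.mul_apply, Fin.sum_univ_two, Matrix.one_apply_eq] at e00
  rw [Matrix.trace_fin_two] at htr
  -- The fixed row vectors of `R` are the multiples of one vector.
  obtain ⟨v, hv, hfix⟩ : ∃ v : Fin 2 → ℝ, v ≠ 0 ∧ ∀ r : Fin 2 → ℝ,
      (r 0 * R 0 0 + r 1 * R 1 0 = r 0 ∧ r 0 * R 0 1 + r 1 * R 1 1 = r 1) ↔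
        ∃ c : ℝ, r = c • v := by
    have hd : R 1 1 = -R 0 0 := by linear_combination htr
    rw [hd]
    by_cases ha : R 0 0 + 1 = 0
    · have ha' : R 0 0 = -1 := by linear_combination ha
      have hbc : R 0 1 * R 1 0 = 0 := by
        rw [ha'] at e00
        linear_combination e00
      refine ⟨![R 1 0, 2], fun h => two_ne_zero (congrFun h 1), fun r => ⟨?_, ?_⟩⟩
      · rintro ⟨h0, -⟩
        rw [ha'] at h0
        refine ⟨r 1 / 2, ?_⟩
        ext k
        fin_cases k
        · simp only [Fin.zero_eta, Pi.smul_apply, Matrix.cons_val_zero, smul_eq_mul]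
          linear_combination -h0 / 2
        · simp
      · rintro ⟨c, rfl⟩
        simp only [Pi.smul_apply, Matrix.cons_val_zero, Matrix.cons_val_one, smul_eq_mul, ha']
        constructor
        · ring
        · linear_combination c * hbc
    · refine ⟨![R 0 0 + 1, R 0 1], fun h => ha (congrFun h 0), fun r => ⟨?_, ?_⟩⟩
      · rintro ⟨-, h1⟩
        refine ⟨r 0 / (R 0 0 + 1), ?_⟩
        ext k
        fin_cases k
        · simp [ha]
        · change r 1 = r 0 / (R 0 0 + 1) * R 0 1
          rw [div_mul_eq_mul_div, eq_div_iff ha]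
          linear_combination -h1
      · rintro ⟨c, rfl⟩
        simp only [Pi.smul_apply, Matrix.cons_val_zero, Matrix.cons_val_one, smul_eq_mul]
        constructor
        · linear_combination c * e00
        · ring
  refine ⟨v, hv, ?_⟩
  ext u
  obtain ⟨B, rfl⟩ := φ.surjective u
  rw [Module.End.mem_eigenspace_iff, one_smul, hA, φ.injective.eq_iff]
  have h1 : φ B ∈ (alphaModel m v).map φ.toLinearMap ↔ B ∈ alphaModel m v := by
    constructor
    · rintro ⟨B', h, hB⟩
      rwa [← φ.injective hB]
    · exact fun h => ⟨B, h, rfl⟩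
  rw [h1]
  have h2 : B * R = B ↔ ∀ i, ∃ c : ℝ, B i = c • v := by
    simp only [← hfix]
    rw [← Matrix.ext_iff]
    refine forall_congr' fun i => ?_
    rw [Fin.forall_fin_two, Matrix.mul_apply, Matrix.mul_apply, Fin.sum_univ_two,
      Fin.sum_univ_two]
  rw [h2]
  constructor
  · intro h
    choose w hw using h
    refine ⟨w, ?_⟩
    ext i k
    rw [hw i]
    rfl
  · rintro ⟨w, rfl⟩ i
    exact ⟨w i, rfl⟩

end SegreModel

section Segre

variable {m : ℕ} {M : Type*} [TopologicalSpace M] [ChartedSpace (Model m) M]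
  [IsManifold (𝓡 (2 * m)) ∞ M]

/-- The identification `φ` of `T_x M` with `ℝ^m ⊗ ℝ^2` is adapted to `S`. -/
def SegreStructure.IsAdapted (S : SegreStructure m M) {x : M}
    (φ : Matrix (Fin m) (Fin 2) ℝ ≃ₗ[ℝ] Tan m x) : Prop :=
  S.cone x = φ '' segreCone m ∧
    S.alphaPlanes x = {P | ∃ v : Fin 2 → ℝ, v ≠ 0 ∧ P = (alphaModel m v).map φ.toLinearMap}

lemma SegreStructure.exists_isAdapted (S : SegreStructure m M) (x : M) :
    ∃ φ : Matrix (Fin m) (Fin 2) ℝ ≃ₗ[ℝ] Tan m x, S.IsAdapted φ := by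
  obtain ⟨U, -, hx, φ, -, h⟩ := S.smooth x
  exact ⟨φ x, h x hx⟩

/-- The cones are determined by the `α`-planes. -/
lemma SegreStructure.mem_cone_iff (S : SegreStructure m M) {x : M} {u : Tan m x} :
    u ∈ S.cone x ↔ u ≠ 0 ∧ ∃ P ∈ S.alphaPlanes x, u ∈ P := by
  obtain ⟨φ, h1, h2⟩ := S.exists_isAdapted x
  rw [h1, h2, mem_image_segreCone_iff]
  refine and_congr_right fun _ => ⟨?_, ?_⟩
  · rintro ⟨v, hv, hu⟩
    exact ⟨_, ⟨v, hv, rfl⟩, hu⟩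
  · rintro ⟨_, ⟨v, hv, rfl⟩, hu⟩
    exact ⟨v, hv, hu⟩

lemma subsingleton_tan (hm : m = 0) (x : M) : Subsingleton (Tan m x) := by
  have := finiteDimensional_tan (m := m) x
  exact Module.finrank_zero_iff.1 (by rw [finrank_tan, hm])

namespace ThreeWeb

variable (W : ThreeWeb m M) {x : M}

/-- The `α`-planes of a Segre structure determined by a web are the members of the pencil spanned
by the tangent spaces of the web. In an adapted identification these tangent spaces are
`ℝ^m ⊗ v₀`, `ℝ^m ⊗ v₁` and `ℝ^m ⊗ v₂`, where `v₀`, `v₁` form a basis and `v₂ = p v₀ + q v₁` with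
`p, q ≠ 0`; hence `j (w ⊗ v₀) = -(q / p) w ⊗ v₁`. -/
lemma HasSegre.alphaPlanes_eq {W : ThreeWeb m M} {S : SegreStructure m M} (hS : W.HasSegre S)
    (x : M) : S.alphaPlanes x = {P | ∃ s t : ℝ, (s, t) ≠ 0 ∧ P = W.pencil s t x} := by
  obtain ⟨φ, -, hα⟩ := S.exists_isAdapted x
  by_cases hm : m = 0
  · have := subsingleton_tan (m := m) hm x
    ext P
    rw [hα]
    constructor
    · intro _
      exact ⟨1, 0, by simp, Subsingleton.elim _ _⟩
    · intro _
      exact ⟨fun _ => 1, fun h => one_ne_zero (congrFun h 0), Subsingleton.elim _ _⟩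
  have hne : ∀ i k : Fin 3, i ≠ k → (W.F i).tangent x ≠ (W.F k).tangent x := by
    intro i k hik h
    have h1 := W.transversal i k hik x
    have := finiteDimensional_tan (m := m) x
    rw [← h, isCompl_iff, disjoint_self, codisjoint_self] at h1
    have h2 := finrank_tan (m := m) x
    rw [← finrank_top ℝ (Tan m x), ← h1.2, h1.1, finrank_bot] at h2
    omega
  have hF := fun i => hS i x
  rw [hα] at hF
  choose v hv hvF using hF
  have hmem : ∀ i w, φ (Matrix.vecMulVec w (v i)) ∈ (W.F i).tangent x := by
    intro i w
    rw [hvF i]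
    exact ⟨_, ⟨w, rfl⟩, rfl⟩
  have hprop : ∀ i k : Fin 3, i ≠ k → ∀ c : ℝ, v k ≠ c • v i := by
    intro i k hik c h
    have hc : c ≠ 0 := by
      rintro rfl
      exact hv k (by rw [h, zero_smul])
    refine hne i k hik ?_
    rw [hvF i, hvF k, h, alphaModel_smul hc]
  -- Cramer's rule
  set d := v 0 0 * v 1 1 - v 0 1 * v 1 0 with hd
  have hd0 : d ≠ 0 := by
    intro h0
    by_cases h1 : v 0 0 = 0
    · have h2 : v 0 1 ≠ 0 := fun h2 => hv 0 (by ext k; fin_cases k <;> simp [h1, h2])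
      refine hprop 0 1 (by decide) (v 1 1 / v 0 1) ?_
      have h3 : v 1 0 = 0 := by
        rw [hd, h1, zero_mul, zero_sub, neg_eq_zero] at h0
        exact (mul_eq_zero.1 h0).resolve_left h2
      ext k
      fin_cases k
      · simp [h1, h3]
      · simp [h2]
    · refine hprop 0 1 (by decide) (v 1 0 / v 0 0) ?_
      ext k
      fin_cases k
      · simp [h1]
      · simp only [Fin.mk_one, Pi.smul_apply, smul_eq_mul]
        field_simp
        linarith
  have hcramer : ∀ z : Fin 2 → ℝ, z = ((z 0 * v 1 1 - z 1 * v 1 0) / d) • v 0 +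
      ((v 0 0 * z 1 - v 0 1 * z 0) / d) • v 1 := by
    intro z
    ext k
    fin_cases k
    · simp only [Fin.zero_eta, Pi.add_apply, Pi.smul_apply, smul_eq_mul]
      field_simp
      rw [hd]
      ring
    · simp only [Fin.mk_one, Pi.add_apply, Pi.smul_apply, smul_eq_mul]
      field_simp
      rw [hd]
      ring
  have hzero : ∀ a b : ℝ, a • v 0 + b • v 1 = 0 → a = 0 ∧ b = 0 := by
    intro a b h
    have h0 := congrFun h 0
    have h1 := congrFun h 1
    simp only [Pi.add_apply, Pi.smul_apply, smul_eq_mul, Pi.zero_apply] at h0 h1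
    constructor
    · refine (mul_eq_zero.1 (?_ : a * d = 0)).resolve_right hd0
      linear_combination v 1 1 * h0 - v 1 0 * h1
    · refine (mul_eq_zero.1 (?_ : b * d = 0)).resolve_right hd0
      linear_combination v 0 0 * h1 - v 0 1 * h0
  obtain ⟨p, q, hpq⟩ : ∃ p q : ℝ, v 2 = p • v 0 + q • v 1 := ⟨_, _, hcramer (v 2)⟩
  have hp : p ≠ 0 := by
    rintro rfl
    exact hprop 1 2 (by decide) q (by rw [hpq, zero_smul, zero_add])
  have hq : q ≠ 0 := by
    rintro rfl
    exact hprop 0 2 (by decide) p (by rw [hpq, zero_smul, add_zero])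
  have hj : ∀ w, W.j x (φ (Matrix.vecMulVec w (v 0))) =
      φ (Matrix.vecMulVec w (-(q / p) • v 1)) := by
    intro w
    refine W.j_eq_of_mem (hmem 0 w) ?_ ?_
    · rw [Matrix.vecMulVec_smul, map_smul]
      exact Submodule.smul_mem _ _ (hmem 1 w)
    · have h1 : Matrix.vecMulVec w (-(q / p) • v 1) - Matrix.vecMulVec w (v 0) =
          (-p⁻¹) • Matrix.vecMulVec w (v 2) := by
        rw [hpq, ← Matrix.vecMulVec_sub, ← Matrix.vecMulVec_smul]
        congr 1
        rw [smul_add, smul_smul, smul_smul, neg_mul, inv_mul_cancel₀ hp, neg_mul,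
          div_eq_inv_mul]
        module
      rw [← map_sub, h1, map_smul]
      exact Submodule.smul_mem _ _ (hmem 2 w)
  have hpencil : ∀ s t : ℝ, W.pencil s t x =
      (alphaModel m (s • v 0 + (-(q / p) * t) • v 1)).map φ.toLinearMap := by
    intro s t
    have h1 : ∀ w, φ (Matrix.vecMulVec w (s • v 0 + (-(q / p) * t) • v 1)) =
        s • φ (Matrix.vecMulVec w (v 0)) + t • W.j x (φ (Matrix.vecMulVec w (v 0))) := by
      intro w
      rw [hj, ← map_smul, ← map_smul, ← map_add, ← Matrix.vecMulVec_smul,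
        ← Matrix.vecMulVec_smul, ← Matrix.vecMulVec_add, smul_smul, mul_comm t]
    ext u
    rw [W.mem_pencil_iff, hvF 0]
    constructor
    · rintro ⟨_, ⟨_, ⟨w, rfl⟩, rfl⟩, rfl⟩
      exact ⟨_, ⟨w, rfl⟩, h1 w⟩
    · rintro ⟨_, ⟨w, rfl⟩, rfl⟩
      exact ⟨_, ⟨_, ⟨w, rfl⟩, rfl⟩, h1 w⟩
  have hqp : -(q / p) ≠ 0 := neg_ne_zero.2 (div_ne_zero hq hp)
  rw [hα]
  ext P
  constructor
  · rintro ⟨z, hz, rfl⟩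
    obtain ⟨a, b, rfl⟩ : ∃ a b : ℝ, z = a • v 0 + b • v 1 := ⟨_, _, hcramer z⟩
    refine ⟨a, b / -(q / p), fun h => hz ?_, ?_⟩
    · rw [Prod.mk_eq_zero, div_eq_zero_iff, or_iff_left hqp] at h
      rw [h.1, h.2, zero_smul, zero_smul, add_zero]
    · rw [hpencil, mul_div_cancel₀ _ hqp]
  · rintro ⟨s, t, hst, rfl⟩
    refine ⟨_, fun h => hst ?_, hpencil s t⟩
    obtain ⟨h1, h2⟩ := hzero _ _ h
    rw [h1, (mul_eq_zero.1 h2).resolve_left hqp]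
    rfl

/-- The identification of `ℝ^m ⊗ ℝ^2` with `T_x M` given by a basis `f` of `T_xℱ₁`:
`w ⊗ e₀ ↦ f w` and `w ⊗ e₁ ↦ j (f w)`. -/
def frame (x : M) (f : (Fin m → ℝ) ≃ₗ[ℝ] (W.F 0).tangent x) :
    Matrix (Fin m) (Fin 2) ℝ ≃ₗ[ℝ] Tan m x :=
  have := finiteDimensional_tan (m := m) x
  LinearEquiv.ofInjectiveOfFinrankEq
    { toFun := fun A => (f (A.col 0) : Tan m x) + W.j x (f (A.col 1))
      map_add' := fun A B => by
        have h : ∀ k, (A + B).col k = A.col k + B.col k := fun _ => rfl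
        simp only [h, map_add, Submodule.coe_add]
        abel
      map_smul' := fun c A => by
        have h : ∀ k, (c • A).col k = c • A.col k := fun _ => rfl
        simp only [h, map_smul, Submodule.coe_smul, RingHom.id_apply, smul_add] }
    (by
      rw [injective_iff_map_eq_zero]
      intro A hA
      have hA' : (f (A.col 0) : Tan m x) + W.j x (f (A.col 1)) = 0 := hA
      have hj := (W.j_mem_one (f (A.col 1)).2).1
      have h1 := congrArg (W.piV x) hA'
      have h2 := congrArg (W.piH x) hA'
      rw [map_add, W.piV_eq_self_iff.2 (f (A.col 0)).2, W.piV_eq_zero_iff.2 hj, add_zero,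
        map_zero] at h1
      rw [map_add, W.piH_eq_zero_iff.2 (f (A.col 0)).2, W.piH_eq_self_iff.2 hj, zero_add,
        map_zero] at h2
      have h3 := congrArg (W.j x) h2
      rw [W.j_j, map_zero] at h3
      have h4 : A.col 0 = 0 := f.injective (Subtype.ext (by rw [h1, map_zero]; rfl))
      have h5 : A.col 1 = 0 := f.injective (Subtype.ext (by rw [h3, map_zero]; rfl))
      ext i k
      fin_cases k
      · exact congrFun h4 i
      · exact congrFun h5 i)
    (by
      rw [finrank_tan, Module.finrank_matrix]
      simp [mul_comm])

lemma frame_apply (f : (Fin m → ℝ) ≃ₗ[ℝ] (W.F 0).tangent x) (A : Matrix (Fin m) (Fin 2) ℝ) :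
    W.frame x f A = (f (A.col 0) : Tan m x) + W.j x (f (A.col 1)) := rfl

lemma map_alphaModel_frame (f : (Fin m → ℝ) ≃ₗ[ℝ] (W.F 0).tangent x) (v : Fin 2 → ℝ) :
    (alphaModel m v).map (W.frame x f).toLinearMap = W.pencil (v 0) (v 1) x := by
  have h1 : ∀ w, W.frame x f (Matrix.vecMulVec w v) =
      v 0 • (f w : Tan m x) + v 1 • W.j x (f w) := by
    intro w
    have h2 : ∀ k, (Matrix.vecMulVec w v).col k = v k • w := by
      intro k
      ext i
      exact mul_comm _ _
    rw [frame_apply, h2, h2, map_smul, map_smul, Submodule.coe_smul, Submodule.coe_smul, map_smul]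
  ext u
  rw [W.mem_pencil_iff]
  constructor
  · rintro ⟨_, ⟨w, rfl⟩, rfl⟩
    exact ⟨f w, (f w).2, h1 w⟩
  · rintro ⟨a, ha, rfl⟩
    refine ⟨_, ⟨f.symm ⟨a, ha⟩, rfl⟩, ?_⟩
    refine (h1 _).trans ?_
    rw [LinearEquiv.apply_symm_apply]

lemma setOf_map_alphaModel_frame (f : (Fin m → ℝ) ≃ₗ[ℝ] (W.F 0).tangent x) :
    {P | ∃ v : Fin 2 → ℝ, v ≠ 0 ∧ P = (alphaModel m v).map (W.frame x f).toLinearMap} =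
      {P | ∃ s t : ℝ, (s, t) ≠ 0 ∧ P = W.pencil s t x} := by
  ext P
  constructor
  · rintro ⟨v, hv, rfl⟩
    refine ⟨v 0, v 1, fun h => hv ?_, W.map_alphaModel_frame f v⟩
    rw [Prod.mk_eq_zero] at h
    ext k
    fin_cases k
    · exact h.1
    · exact h.2
  · rintro ⟨s, t, hst, rfl⟩
    refine ⟨![s, t], fun h => hst ?_, (W.map_alphaModel_frame f ![s, t]).symm⟩
    exact Prod.ext (congrFun h 0) (congrFun h 1)

/-- The frames of a web are adapted to every Segre structure that it determines. -/
lemma HasSegre.isAdapted_frame {W : ThreeWeb m M} {S : SegreStructure m M} (hS : W.HasSegre S)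
    (f : (Fin m → ℝ) ≃ₗ[ℝ] (W.F 0).tangent x) : S.IsAdapted (W.frame x f) := by
  have h1 : S.alphaPlanes x =
      {P | ∃ v : Fin 2 → ℝ, v ≠ 0 ∧ P = (alphaModel m v).map (W.frame x f).toLinearMap} := by
    rw [hS.alphaPlanes_eq x, W.setOf_map_alphaModel_frame f]
  refine ⟨?_, h1⟩
  ext u
  rw [S.mem_cone_iff, mem_image_segreCone_iff, h1]
  refine and_congr_right fun _ => ⟨?_, ?_⟩
  · rintro ⟨_, ⟨v, hv, rfl⟩, hu⟩
    exact ⟨v, hv, hu⟩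
  · rintro ⟨v, hv, hu⟩
    exact ⟨_, ⟨v, hv, rfl⟩, hu⟩

lemma pencil_one_zero : W.pencil 1 0 x = (W.F 0).tangent x := by
  ext u
  simp [W.mem_pencil_iff]

lemma pencil_zero_one : W.pencil 0 1 x = (W.F 1).tangent x := by
  ext u
  rw [W.mem_pencil_iff]
  constructor
  · rintro ⟨a, ha, rfl⟩
    simpa using (W.j_mem_one ha).1
  · intro hu
    exact ⟨W.j x u, (W.j_mem_zero hu).1, by simp [W.j_j]⟩

lemma pencil_one_neg_one : W.pencil 1 (-1) x = (W.F 2).tangent x := by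
  ext u
  rw [W.mem_pencil_iff, ← W.j_eq_neg_iff]
  constructor
  · rintro ⟨a, ha, rfl⟩
    simp [W.j_j]
  · intro hu
    refine ⟨W.piV x u, W.piV_mem u, ?_⟩
    rw [W.j_piV, hu, map_neg, neg_smul, smul_neg, neg_neg, one_smul, one_smul, W.piV_add_piH]

/-- The Segre structure of a web. Near a point the identification with `ℝ^m ⊗ ℝ^2` comes from the
coordinate fields of a slice chart of the first foliation. -/
def segre [T2Space M] : SegreStructure m M where
  cone x := {u | u ≠ 0 ∧ ∃ s t : ℝ, (s, t) ≠ 0 ∧ u ∈ W.pencil s t x}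
  alphaPlanes x := {P | ∃ s t : ℝ, (s, t) ≠ 0 ∧ P = W.pencil s t x}
  smooth := by
    intro x
    obtain ⟨e, he, hx, htan⟩ := (W.F 0).exists_chart x
    have he : SmoothChart m e := he
    let c : (Fin m → ℝ) →ₗ[ℝ] Model m :=
      (splitModel m).symm.toLinearMap ∘ₗ LinearMap.inl ℝ (Fin m → ℝ) (Fin m → ℝ)
    have hf : ∀ y ∈ e.source, ∃ f : (Fin m → ℝ) ≃ₗ[ℝ] (W.F 0).tangent y,
        ∀ w, (f w : Tan m y) = liftField e (fun _ => c w) y := by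
      intro y hy
      have := finiteDimensional_tan (m := m) y
      have hmem : ∀ w, (he.diffEquiv hy).symm (c w) ∈ (W.F 0).tangent y := by
        intro w
        rw [htan y hy, mem_sliceSpace_iff, ← he.diffEquiv_apply hy, LinearEquiv.apply_symm_apply]
        change (splitModel m ((splitModel m).symm (w, 0))).2 = 0
        rw [ContinuousLinearEquiv.apply_symm_apply]
      let g : (Fin m → ℝ) →ₗ[ℝ] (W.F 0).tangent y :=
        ((he.diffEquiv hy).symm.toLinearMap ∘ₗ c).codRestrict _ hmem
      have hg : Function.Injective g := by
        intro w w' h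
        have h1 := (he.diffEquiv hy).symm.injective (congrArg Subtype.val h)
        exact congrArg Prod.fst ((splitModel m).symm.injective h1)
      refine ⟨LinearEquiv.ofInjectiveOfFinrankEq g hg ?_, fun w => ?_⟩
      · rw [WebFoliation.finrank_tangent]
        simp
      · rw [he.liftField_apply hy]
        rfl
    have hne : ∀ y, Nonempty ((Fin m → ℝ) ≃ₗ[ℝ] (W.F 0).tangent y) := fun y => by
      have := finiteDimensional_tan (m := m) y
      exact ⟨LinearEquiv.ofFinrankEq _ _ (by rw [WebFoliation.finrank_tangent]; simp)⟩
    choose! f hf using hf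
    refine ⟨e.source, e.open_source, hx, fun y => W.frame y (f y), fun A => ?_, fun y hy => ?_⟩
    · intro y hy
      have hsm : ∀ w, SmoothFieldAt (liftField e fun _ => c w) y := fun w =>
        he.smoothFieldAt_liftField hy contDiffAt_const
      have h1 := (hsm (A.col 0)).add (W.smoothEnd_j.smoothFieldAt (hsm (A.col 1)))
      refine ContMDiffAt.contMDiffWithinAt (h1.congr ?_)
      filter_upwards [e.open_source.mem_nhds hy] with z hz
      rw [frame_apply, hf z hz, hf z hz]
    · refine ⟨?_, (W.setOf_map_alphaModel_frame (f y)).symm⟩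
      ext u
      rw [mem_image_segreCone_iff]
      refine and_congr_right fun _ => ⟨?_, ?_⟩
      · rintro ⟨s, t, hst, hu⟩
        refine ⟨![s, t], fun h => hst (Prod.ext (congrFun h 0) (congrFun h 1)), ?_⟩
        rw [W.map_alphaModel_frame]
        exact hu
      · rintro ⟨v, hv, hu⟩
        rw [W.map_alphaModel_frame] at hu
        refine ⟨v 0, v 1, fun h => hv ?_, hu⟩
        rw [Prod.mk_eq_zero] at h
        ext k
        fin_cases k
        · exact h.1
        · exact h.2

lemma hasSegre_segre [T2Space M] : W.HasSegre W.segre := by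
  intro i x
  fin_cases i
  · exact ⟨1, 0, by simp, W.pencil_one_zero.symm⟩
  · exact ⟨0, 1, by simp, W.pencil_zero_one.symm⟩
  · exact ⟨1, -1, by simp, W.pencil_one_neg_one.symm⟩

lemma HasSegre.unique {W : ThreeWeb m M} {S S' : SegreStructure m M} (hS : W.HasSegre S)
    (hS' : W.HasSegre S') : S = S' := by
  have h1 : S.alphaPlanes = S'.alphaPlanes := by
    ext x : 1
    rw [hS.alphaPlanes_eq, hS'.alphaPlanes_eq]
  have h2 : S.cone = S'.cone := by
    ext x u
    rw [S.mem_cone_iff, S'.mem_cone_iff, h1]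
  cases S
  cases S'
  cases h1
  cases h2
  rfl

/-- If the torsion of the Chern connection vanishes, the `α`-planes of the web are tangent to the
leaves of the foliations of the pencil. -/
lemma TorsionFree.alphaIntegrable [T2Space M] {W : ThreeWeb m M} (hW : W.TorsionFree)
    {S : SegreStructure m M} (hS : W.HasSegre S) : S.AlphaIntegrable := by
  intro x P hP
  rw [hS.alphaPlanes_eq x] at hP
  obtain ⟨s, t, hst, rfl⟩ := hP
  obtain ⟨F, hF⟩ := hW.exists_foliation_pencil hst
  obtain ⟨e, he, hx, htan⟩ := F.exists_chart x
  let N : Set M := {z | z ∈ e.source ∧ ∀ i : Fin (2 * m), m ≤ (i : ℕ) → e z i = e x i}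
  have hN : ∀ y ∈ N, HasTangentPlane m N y (W.pencil s t y) := by
    intro y hy
    refine ⟨e, ⟨he, hy.1, fun z hz => ?_⟩, ?_⟩
    · constructor
      · intro h i hi
        rw [h.2 i hi, hy.2 i hi]
      · intro h
        exact ⟨hz, fun i hi => by rw [h i hi, hy.2 i hi]⟩
    · rw [← hF, htan y hy.1]
  have hxN : x ∈ N := ⟨hx, fun _ _ => rfl⟩
  refine ⟨N, hxN, fun y hy => ⟨_, ?_, hN y hy⟩, hN x hxN⟩
  rw [hS.alphaPlanes_eq y]
  exact ⟨s, t, hst, rfl⟩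

end ThreeWeb

end Segre

/-! ### The 3-web of a hyper-para-complex structure -/

section HyperParaComplex

variable {m : ℕ} {M : Type*} [TopologicalSpace M] [ChartedSpace (Model m) M]
  [IsManifold (𝓡 (2 * m)) ∞ M]

/-- The `1`-eigendistribution of an integrable almost product structure is a foliation: for fields
`U`, `V` fixed by `A`, the Nijenhuis tensor is `2 (1 - A) [U, V]`. -/
lemma exists_foliation_tangent_eq_eigenspace [T2Space M] {A : ∀ x : M, Module.End ℝ (Tan m x)}
    (hA : SmoothEnd A) (hsq : ∀ x, A x * A x = 1)
    (hrank : ∀ x, Module.finrank ℝ ((A x).eigenspace 1) = m) (hN : NijenhuisZero A) :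
    ∃ F : WebFoliation m M, ∀ x, F.tangent x = (A x).eigenspace 1 := by
  let B : ∀ x : M, Module.End ℝ (Tan m x) := fun x => LinearMap.id + A x
  have hr : ∀ x, (B x).range = (A x).eigenspace 1 := fun x => range_id_add_eq_eigenspace (hsq x)
  have hsm : SmoothEnd B := SmoothEnd.id.add hA
  have hfix : ∀ (x : M) (u : Tan m x), A x (B x u) = B x u := by
    intro x u
    have h : B x u ∈ (A x).eigenspace 1 := hr x ▸ LinearMap.mem_range_self _ u
    rwa [Module.End.mem_eigenspace_iff, one_smul] at h
  refine (exists_foliation_tangent_eq_range hsm (fun x => by rw [hr, hrank])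
    fun X Y hX hY x => ?_).imp fun F hF x => (hF x).trans (hr x)
  have h1 := hN _ _ (hsm X hX) (hsm Y hY) x
  simp only [hfix] at h1
  have hAA : ∀ u, A x (A x u) = u := fun u => congrArg (fun f => f u) (hsq x)
  rw [hAA] at h1
  rw [hr, Module.End.mem_eigenspace_iff, one_smul]
  set b := bracket m (fun y => B y (X y)) (fun y => B y (Y y)) x
  have h2 : b - A x b = (1 / 2 : ℝ) • (b - A x b - A x b + b) := by module
  rw [h1, smul_zero, sub_eq_zero] at h2
  exact h2.symm

lemma IsParaComplexStructure.finrank_eigenspace {A : ∀ x : M, Module.End ℝ (Tan m x)}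
    (hA : IsParaComplexStructure A) (x : M) :
    Module.finrank ℝ ((A x).eigenspace 1) = m ∧ Module.finrank ℝ ((A x).eigenspace (-1)) = m := by
  have := finiteDimensional_tan (m := m) x
  have h1 := Submodule.finrank_add_eq_of_isCompl (isCompl_eigenspace (hA.sq x))
  rw [finrank_tan] at h1
  have h2 := hA.rank_eq x
  omega

lemma eigenspace_neg_one {T : Type*} [AddCommGroup T] [Module ℝ T] (A : Module.End ℝ T) :
    (-A).eigenspace 1 = A.eigenspace (-1) := by
  ext u
  rw [Module.End.mem_eigenspace_iff, Module.End.mem_eigenspace_iff, LinearMap.neg_apply, one_smul,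
    neg_smul, one_smul, neg_eq_iff_eq_neg]

lemma IsParaComplexStructure.neg {A : ∀ x : M, Module.End ℝ (Tan m x)}
    (hA : IsParaComplexStructure A) : IsParaComplexStructure fun x => -A x where
  smooth := hA.smooth.neg
  sq x := by rw [neg_mul_neg, hA.sq]
  rank_eq x := by
    have h := eigenspace_neg_one (-A x)
    rw [neg_neg] at h
    rw [eigenspace_neg_one, ← h, hA.rank_eq]
  integrable := hA.smooth.neg.nijenhuisZero_iff.2 fun X Y =>
    (nijenhuis_neg _ hA.smooth.toLinearMap X Y).trans
      (hA.smooth.nijenhuisZero_iff.1 hA.integrable X Y)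

lemma IsParaComplexStructure.exists_foliation [T2Space M]
    {A : ∀ x : M, Module.End ℝ (Tan m x)} (hA : IsParaComplexStructure A) :
    ∃ F : WebFoliation m M, ∀ x, F.tangent x = (A x).eigenspace 1 :=
  exists_foliation_tangent_eq_eigenspace hA.smooth hA.sq (fun x => (hA.finrank_eigenspace x).1)
    hA.integrable

namespace HyperParaComplex

variable (H : HyperParaComplex m M) {x : M} {u : Tan m x}

lemma I_I (u : Tan m x) : H.I x (H.I x u) = u := congrArg (fun f => f u) (H.paraI.sq x)

lemma K_K (u : Tan m x) : H.K x (H.K x u) = u := congrArg (fun f => f u) (H.paraK.sq x)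

lemma K_I (u : Tan m x) : H.K x (H.I x u) = -H.I x (H.K x u) := by
  have h1 := congrArg (fun f => f u) (H.mul_KI x)
  rw [← H.mul_IK] at h1
  exact h1

/-- Since `I` and `K` anti-commute, they have no common eigenvectors. -/
lemma disjoint_eigenspace {ε δ : ℝ} (hε : ε ≠ 0) (hδ : δ ≠ 0) :
    Disjoint ((H.I x).eigenspace ε) ((H.K x).eigenspace δ) := by
  rw [Submodule.disjoint_def]
  intro u h1 h2
  rw [Module.End.mem_eigenspace_iff] at h1 h2
  have h3 := H.K_I u
  rw [h1, h2, map_smul, map_smul, h1, h2, smul_comm δ ε, eq_neg_iff_add_eq_zero,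
    ← two_smul ℝ] at h3
  have h4 := (smul_eq_zero.1 h3).resolve_left two_ne_zero
  exact (smul_eq_zero.1 ((smul_eq_zero.1 h4).resolve_left hε)).resolve_left hδ

lemma exists_web [T2Space M] : ∃ W : ThreeWeb m M, ∀ x,
    (W.F 0).tangent x = (H.I x).eigenspace 1 ∧ (W.F 1).tangent x = (H.I x).eigenspace (-1) ∧
      (W.F 2).tangent x = (H.K x).eigenspace 1 := by
  obtain ⟨F₀, h₀⟩ := H.paraI.exists_foliation
  obtain ⟨F₁, h₁⟩ := H.paraI.neg.exists_foliation
  obtain ⟨F₂, h₂⟩ := H.paraK.exists_foliation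
  simp only [eigenspace_neg_one] at h₁
  have h01 : ∀ x, IsCompl (F₀.tangent x) (F₁.tangent x) := fun x => by
    rw [h₀, h₁]
    exact isCompl_eigenspace (H.paraI.sq x)
  have hcompl : ∀ (F : WebFoliation m M) (x : M), Disjoint (F.tangent x) (F₂.tangent x) →
      IsCompl (F.tangent x) (F₂.tangent x) := by
    intro F x h
    have := finiteDimensional_tan (m := m) x
    refine isCompl_of_disjoint h ?_
    rw [WebFoliation.finrank_tangent, WebFoliation.finrank_tangent, finrank_tan, two_mul]
  have h02 : ∀ x, IsCompl (F₀.tangent x) (F₂.tangent x) := fun x => hcompl F₀ x (by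
    rw [h₀, h₂]
    exact H.disjoint_eigenspace one_ne_zero one_ne_zero)
  have h12 : ∀ x, IsCompl (F₁.tangent x) (F₂.tangent x) := fun x => hcompl F₁ x (by
    rw [h₁, h₂]
    exact H.disjoint_eigenspace (neg_ne_zero.2 one_ne_zero) one_ne_zero)
  refine ⟨⟨![F₀, F₁, F₂], fun i k hik x => ?_⟩, fun x => ⟨h₀ x, h₁ x, h₂ x⟩⟩
  fin_cases i <;> fin_cases k
  · exact absurd rfl hik
  · exact h01 x
  · exact h02 x
  · exact (h01 x).symm
  · exact absurd rfl hik
  · exact h12 x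
  · exact (h02 x).symm
  · exact (h12 x).symm
  · exact absurd rfl hik

end HyperParaComplex

namespace ThreeWeb

variable {W : ThreeWeb m M} {H : HyperParaComplex m M}

/-- The endomorphism `-K` exchanges `Tℱ₁` and `Tℱ₂`, because `I` and `K` anti-commute, and
`-K u - u` is fixed by `K`. -/
lemma j_eq_neg_K {x : M} (h0 : (W.F 0).tangent x = (H.I x).eigenspace 1)
    (h1 : (W.F 1).tangent x = (H.I x).eigenspace (-1))
    (h2 : (W.F 2).tangent x = (H.K x).eigenspace 1) : W.j x = -H.K x := by
  have hmem : ∀ u : Tan m x, (-H.K x) u - u ∈ (W.F 2).tangent x := by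
    intro u
    rw [h2, Module.End.mem_eigenspace_iff, one_smul, LinearMap.neg_apply, map_sub, map_neg, H.K_K]
    abel
  refine ((W.j_unique x _).2 fun u => ⟨⟨?_, hmem _⟩, ⟨?_, hmem _⟩⟩).symm
  · have h3 := W.piH_mem u
    rw [h1, Module.End.mem_eigenspace_iff, neg_smul, one_smul] at h3
    have h4 := H.K_I (W.piH x u)
    rw [h3, map_neg, neg_inj] at h4
    rw [h0, Module.End.mem_eigenspace_iff, one_smul, LinearMap.neg_apply, map_neg, ← h4]
  · have h3 := W.piV_mem u
    rw [h0, Module.End.mem_eigenspace_iff, one_smul] at h3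
    have h4 := H.K_I (W.piV x u)
    rw [h3, eq_comm, neg_eq_iff_eq_neg] at h4
    rw [h1, Module.End.mem_eigenspace_iff, neg_smul, one_smul, LinearMap.neg_apply, map_neg,
      h4]

lemma I_eq_piV_sub_piH {x : M} (h0 : (W.F 0).tangent x = (H.I x).eigenspace 1)
    (h1 : (W.F 1).tangent x = (H.I x).eigenspace (-1)) : H.I x = W.piV x - W.piH x := by
  ext1 u
  have hv := W.piV_mem u
  have hh := W.piH_mem u
  rw [h0, Module.End.mem_eigenspace_iff, one_smul] at hv
  rw [h1, Module.End.mem_eigenspace_iff, neg_smul, one_smul] at hh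
  conv_lhs => rw [← W.piV_add_piH u, map_add, hv, hh]
  rw [LinearMap.sub_apply, sub_eq_add_neg]

/-! ### Compatibility with the Segre structure -/

/-- In terms of the decomposition `u = s a + t j a` with `a ∈ Tℱ₁`, the endomorphism `I` replaces
`(s, t)` by `(s, -t)` and `K` replaces it by `(-t, -s)`; hence both permute the `α`-planes. -/
lemma HasSegre.compatibleWith {S : SegreStructure m M} (hS : W.HasSegre S)
    (hI : ∀ x, H.I x = W.piV x - W.piH x) (hK : ∀ x, H.K x = -W.j x) : H.CompatibleWith S := by
  intro x
  have hcone : ∀ u : Tan m x, u ∈ S.cone x ↔ u ≠ 0 ∧ ∃ s t : ℝ, (s, t) ≠ 0 ∧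
      ∃ a ∈ (W.F 0).tangent x, u = s • a + t • W.j x a := by
    intro u
    rw [S.mem_cone_iff, hS.alphaPlanes_eq x]
    refine and_congr_right fun _ => ⟨?_, ?_⟩
    · rintro ⟨_, ⟨s, t, hst, rfl⟩, hu⟩
      exact ⟨s, t, hst, W.mem_pencil_iff.1 hu⟩
    · rintro ⟨s, t, hst, hu⟩
      exact ⟨_, ⟨s, t, hst, rfl⟩, W.mem_pencil_iff.2 hu⟩
  have himage : ∀ f : Tan m x → Tan m x, (∀ u, f (f u) = u) →
      (∀ u ∈ S.cone x, f u ∈ S.cone x) → f '' S.cone x = S.cone x := by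
    intro f hf h
    refine Set.Subset.antisymm (Set.image_subset_iff.2 h) fun u hu => ⟨f u, h u hu, hf u⟩
  have h1 : H.I x '' S.cone x = S.cone x := by
    refine himage _ H.I_I fun u hu => ?_
    obtain ⟨hu0, s, t, hst, a, ha, hua⟩ := (hcone u).1 hu
    refine (hcone _).2 ⟨fun h => hu0 (by rw [← H.I_I u, h, map_zero]), s, -t, ?_, a, ha, ?_⟩
    · simpa using hst
    · have hj := (W.j_mem_one ha).1
      rw [hua, hI, map_add, map_smul, map_smul, LinearMap.sub_apply, LinearMap.sub_apply,
        W.piV_eq_self_iff.2 ha, W.piH_eq_zero_iff.2 ha, W.piV_eq_zero_iff.2 hj,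
        W.piH_eq_self_iff.2 hj]
      module
  have h2 : H.K x '' S.cone x = S.cone x := by
    refine himage _ H.K_K fun u hu => ?_
    obtain ⟨hu0, s, t, hst, a, ha, hua⟩ := (hcone u).1 hu
    refine (hcone _).2 ⟨fun h => hu0 (by rw [← H.K_K u, h, map_zero]), -t, -s, ?_, a, ha, ?_⟩
    · simpa [and_comm] using hst
    · rw [hua, hK, LinearMap.neg_apply, map_add, map_smul, map_smul, W.j_j]
      module
  refine ⟨h1, ?_, h2⟩
  have h3 : ⇑(H.J x) = H.I x ∘ H.K x := by
    rw [← H.mul_IK]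
    rfl
  rw [h3, Set.image_comp, h2, h1]

/-- The Segre structure `S` is determined by the web of `(I, K, J)` if and only if `I` and `K` act
through the factor `ℝ^2`: the frames of the web bring `I` and `K` into the form `1 ⊗ P`, and
conversely the `1`-eigenspaces of `I`, `-I` and `K` are then `α`-planes. -/
lemma hasSegre_iff_actsOnPlaneFactor {S : SegreStructure m M}
    (h : ∀ x, (W.F 0).tangent x = (H.I x).eigenspace 1 ∧
      (W.F 1).tangent x = (H.I x).eigenspace (-1) ∧ (W.F 2).tangent x = (H.K x).eigenspace 1) :
    W.HasSegre S ↔ H.ActsOnPlaneFactor S := by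
  constructor
  · intro hS x
    obtain ⟨h0, h1, h2⟩ := h x
    have := finiteDimensional_tan (m := m) x
    let f : (Fin m → ℝ) ≃ₗ[ℝ] (W.F 0).tangent x :=
      LinearEquiv.ofFinrankEq _ _ (by rw [WebFoliation.finrank_tangent]; simp)
    obtain ⟨hc, hα⟩ := hS.isAdapted_frame f
    let P : Matrix (Fin 2) (Fin 2) ℝ := !![1, 0; 0, -1]
    let Q : Matrix (Fin 2) (Fin 2) ℝ := !![0, -1; -1, 0]
    refine ⟨W.frame x f, hc, hα, P, Q, fun A => ⟨?_, ?_⟩⟩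
    · have e0 : (A * P).col 0 = A.col 0 := by
        ext i
        simp [P, Matrix.col, Matrix.mul_apply, Fin.sum_univ_two]
      have e1 : (A * P).col 1 = -A.col 1 := by
        ext i
        simp [P, Matrix.col, Matrix.mul_apply, Fin.sum_univ_two]
      have hj := (W.j_mem_one (f (A.col 1)).2).1
      have hf := (f (A.col 0)).2
      rw [frame_apply, frame_apply, e0, e1, I_eq_piV_sub_piH h0 h1, map_add,
        LinearMap.sub_apply, LinearMap.sub_apply, W.piV_eq_self_iff.2 hf, W.piH_eq_zero_iff.2 hf,
        W.piV_eq_zero_iff.2 hj, W.piH_eq_self_iff.2 hj, map_neg, Submodule.coe_neg, map_neg]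
      abel
    · have e0 : (A * Q).col 0 = -A.col 1 := by
        ext i
        simp [Q, Matrix.col, Matrix.mul_apply, Fin.sum_univ_two]
      have e1 : (A * Q).col 1 = -A.col 0 := by
        ext i
        simp [Q, Matrix.col, Matrix.mul_apply, Fin.sum_univ_two]
      have hK : H.K x = -W.j x := by rw [j_eq_neg_K h0 h1 h2, neg_neg]
      rw [frame_apply, frame_apply, e0, e1, hK, LinearMap.neg_apply, map_add, W.j_j, map_neg,
        map_neg, Submodule.coe_neg, Submodule.coe_neg, map_neg]
      abel
  · intro hS i x
    obtain ⟨h0, h1, h2⟩ := h x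
    obtain ⟨φ, -, hα, P, Q, hPQ⟩ := hS x
    rw [hα]
    by_cases hm : m = 0
    · have := subsingleton_tan (m := m) hm x
      exact ⟨fun _ => 1, fun h => one_ne_zero (congrFun h 0), Subsingleton.elim _ _⟩
    -- As `m > 0`, the endomorphism `1 ⊗ R` determines `R`.
    have hinj : ∀ R R' : Matrix (Fin 2) (Fin 2) ℝ,
        (∀ A : Matrix (Fin m) (Fin 2) ℝ, A * R = A * R') → R = R' := by
      intro R R' hRR
      ext k l
      have h3 := congrFun (congrFun (hRR (Matrix.of fun _ k' => if k' = k then 1 else 0))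
        ⟨0, Nat.pos_of_ne_zero hm⟩) l
      simpa [Matrix.mul_apply] using h3
    have hP : P * P = 1 := hinj _ _ fun A => φ.injective (by
      rw [← Matrix.mul_assoc, ← (hPQ _).1, ← (hPQ _).1, H.I_I, Matrix.mul_one])
    have hQ : Q * Q = 1 := hinj _ _ fun A => φ.injective (by
      rw [← Matrix.mul_assoc, ← (hPQ _).2, ← (hPQ _).2, H.K_K, Matrix.mul_one])
    have hPQ' : P * Q = -(Q * P) := hinj _ _ fun A => φ.injective (by
      rw [Matrix.mul_neg, ← Matrix.mul_assoc, ← Matrix.mul_assoc, map_neg, ← (hPQ _).2,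
        ← (hPQ _).1, ← (hPQ _).1, ← (hPQ _).2, H.K_I])
    -- A matrix that anti-commutes with an involution is conjugate to its negative.
    have htr : ∀ R R' : Matrix (Fin 2) (Fin 2) ℝ, R' * R' = 1 → R * R' = -(R' * R) →
        R.trace = 0 := by
      intro R R' h3 h4
      have h5 := congrArg (fun T => (T * R').trace) h4
      simp only [Matrix.neg_mul, Matrix.trace_neg] at h5
      rw [Matrix.trace_mul_cycle R' R R', Matrix.mul_assoc R R' R', h3, Matrix.mul_one,
        Matrix.one_mul, self_eq_neg] at h5
      exact h5
    have htrP : P.trace = 0 := htr P Q hQ hPQ'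
    have htrQ : Q.trace = 0 := htr Q P hP (by rw [hPQ', neg_neg])
    fin_cases i
    · change (W.F 0).tangent x ∈ _
      rw [h0]
      exact exists_eigenspace_eq_alphaModel φ (fun B => (hPQ B).1) hP htrP
    · change (W.F 1).tangent x ∈ _
      rw [h1, ← eigenspace_neg_one]
      refine exists_eigenspace_eq_alphaModel φ (R := -P) (fun B => ?_) (by rw [neg_mul_neg, hP])
        (by rw [Matrix.trace_neg, htrP, neg_zero])
      rw [LinearMap.neg_apply, (hPQ B).1, Matrix.mul_neg, map_neg]
    · change (W.F 2).tangent x ∈ _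
      rw [h2]
      exact exists_eigenspace_eq_alphaModel φ (fun B => (hPQ B).2) hQ htrQ

end ThreeWeb

end HyperParaComplex

end

theorem theorem1 (m : ℕ) (M : Type*) [TopologicalSpace M] [T2Space M]
    [ChartedSpace (Model m) M] [IsManifold (𝓡 (2 * m)) ∞ M] :
    (∀ W : ThreeWeb m M,
      (∃! S : SegreStructure m M, W.HasSegre S) ∧
      (W.TorsionFree → ∀ S : SegreStructure m M, W.HasSegre S →
        S.AlphaIntegrable ∧
        ∃ H : HyperParaComplex m M, W.Induces H ∧ H.CompatibleWith S)) ∧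
    (∀ (S : SegreStructure m M) (H : HyperParaComplex m M), H.CompatibleWith S →
      ∃ W : ThreeWeb m M, W.TorsionFree ∧ W.Induces H ∧
        (∀ S' : SegreStructure m M, W.HasSegre S' → H.CompatibleWith S') ∧
        (W.HasSegre S ↔ H.ActsOnPlaneFactor S)) := by
  refine ⟨fun W => ⟨⟨W.segre, W.hasSegre_segre, fun S hS => hS.unique W.hasSegre_segre⟩,
    fun hW S hS => ⟨hW.alphaIntegrable hS, hW.hyperParaComplex, hW.induces,
      hS.compatibleWith (fun _ => rfl) fun _ => rfl⟩⟩, fun S H _ => ?_⟩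
  obtain ⟨W, h⟩ := H.exists_web
  have hj : ∀ x, W.j x = -H.K x := fun x => W.j_eq_neg_K (h x).1 (h x).2.1 (h x).2.2
  have hN : NijenhuisZero W.j := by
    have h1 : W.j = fun x => -H.K x := funext hj
    rw [h1]
    exact H.paraK.neg.integrable
  refine ⟨W, W.torsionFree_of_nijenhuisZero_j hN, fun x => ?_, fun S' hS' => ?_,
    ThreeWeb.hasSegre_iff_actsOnPlaneFactor h⟩
  · refine ⟨(h x).1.symm, (h x).2.1.symm, (h x).2.2.symm, ?_⟩
    rw [← W.eigenspace_neg_j_neg_one, hj, neg_neg]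
  · exact hS'.compatibleWith (fun x => ThreeWeb.I_eq_piV_sub_piH (h x).1 (h x).2.1)
      fun x => by rw [hj, neg_neg]
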